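/- \textbf{Proposition.} Let $H$ be a Hopf algebra over a field $K$, with comultiplication $\Delta(x)=x_1\otimes x_2$, and let $\overline H=H/K1_H$ be the cokernel of the unit $K\to H$, with classes written $\overline x$. Regard $\overline H$ as a left $H$-comodule via $\rho(\overline x)=x_1\otimes\overline{x_2}$. The following assertions are equivalent: (a) $H$ is formally smooth as a $K$-coalgebra, i.e. the $H$-bicomodule $\operatorname{Coker}(\Delta)$ (a quotient of $H\otimes H$ with left coaction $\Delta\otimes H$ and right coaction $H\otimes\Delta$) is injective with respect to those morphisms of $H$-bicomodules that have a $K$-linear retraction. (b) $H$ is formally smooth as a coalgebra in the monoidal category $\mathfrak M_H$ of right $H$-modules (tensor products carrying the diagonal action, $H$ acting on itself by right multiplication), i.e. $\operatorname{Coker}(\Delta)$, with the action induced by the diagonal one on $H\otimes H$, is injective in the category of $H$-bicomodules in $\mathfrak M_H$ with respect to those morphisms that have a right $H$-linear retraction. (c) $\overline H$ is injective in the category of left $H$-comodules. (d) There exists an fs-retraction, i.e. a $K$-linear map $\chi:H\otimes\overline H\to\overline H$ such that for all $x,y\in H$ one has $\rho(\chi(x\otimes\overline y))=x_1\otimes\chi(x_2\otimes\overline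 y)$ and $\chi(x_1\otimes\overline{x_2})=\overline x$. (e) $H$ is a left hereditary coalgebra: every quotient of an injective left $H$-comodule is injective. (e$'$) $H$ is a right hereditary coalgebra: every quotient of an injective right $H$-comodule is injective. If $H$ is finite dimensional, these are also equivalent to: (f) The comultiplication $\overline H\to\overline H\otimes\overline H$, $\overline x\mapsto\overline{x_1}\otimes\overline{x_2}$, has a left $H$-colinear retraction, where $\overline H\otimes\overline H$ is a left $H$-comodule via $\rho\otimes\overline H$. -/

import Mathlib

open scoped TensorProduct

universe u v w

namespace FormalSmooth

/-! ### Comodules over a coalgebra -/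

/-- A left comodule structure on the `K`-module `M` over the `K`-coalgebra `C`. -/
@[ext]
structure LeftComodule (K : Type u) (C : Type v) (M : Type w) [Field K]
    [AddCommGroup C] [Module K C] [Coalgebra K C] [AddCommGroup M] [Module K M] where
  coact : M →ₗ[K] C ⊗[K] M
  coassoc : (TensorProduct.assoc K C C M).toLinearMap ∘ₗ
      (Coalgebra.comul (R := K) (A := C)).rTensor M ∘ₗ coact = coact.lTensor C ∘ₗ coact
  counit_coact : (Coalgebra.counit (R := K) (A := C)).rTensor M ∘ₗ coact =
      TensorProduct.mk K K M 1

/-- A right comodule structure on the `K`-module `M` over the `K`-coalgebra `C`. -/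
@[ext]
structure RightComodule (K : Type u) (C : Type v) (M : Type w) [Field K]
    [AddCommGroup C] [Module K C] [Coalgebra K C] [AddCommGroup M] [Module K M] where
  coact : M →ₗ[K] M ⊗[K] C
  coassoc : (TensorProduct.assoc K M C C).toLinearMap ∘ₗ coact.rTensor C ∘ₗ coact =
      (Coalgebra.comul (R := K) (A := C)).lTensor M ∘ₗ coact
  counit_coact : (Coalgebra.counit (R := K) (A := C)).lTensor M ∘ₗ coact =
      (TensorProduct.mk K M K).flip 1

section Comodules

variable {K : Type u} {C : Type v} [Field K] [AddCommGroup C] [Module K C] [Coalgebra K C]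
variable {M N Q : Type w} [AddCommGroup M] [Module K M] [AddCommGroup N] [Module K N]
  [AddCommGroup Q] [Module K Q]

/-- Left colinear maps, the morphisms of left comodules. -/
def LeftComodule.IsColinear (X : LeftComodule K C M) (Y : LeftComodule K C N)
    (f : M →ₗ[K] N) : Prop :=
  Y.coact ∘ₗ f = f.lTensor C ∘ₗ X.coact

/-- Right colinear maps, the morphisms of right comodules. -/
def RightComodule.IsColinear (X : RightComodule K C M) (Y : RightComodule K C N)
    (f : M →ₗ[K] N) : Prop :=
  Y.coact ∘ₗ f = f.rTensor C ∘ₗ X.coact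

/-- The coalgebra as a left comodule over itself. -/
def LeftComodule.regular (K : Type u) (C : Type v) [Field K] [AddCommGroup C] [Module K C]
    [Coalgebra K C] : LeftComodule K C C where
  coact := Coalgebra.comul
  coassoc := Coalgebra.coassoc
  counit_coact := Coalgebra.rTensor_counit_comp_comul

/-- The coalgebra as a right comodule over itself. -/
def RightComodule.regular (K : Type u) (C : Type v) [Field K] [AddCommGroup C] [Module K C]
    [Coalgebra K C] : RightComodule K C C where
  coact := Coalgebra.comul
  coassoc := Coalgebra.coassoc
  counit_coact := Coalgebra.lTensor_counit_comp_comul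

/-- For a left comodule `M` and a vector space `N`, the left comodule `M ⊗ N` with coaction
`m ⊗ n ↦ m₋₁ ⊗ (m₀ ⊗ n)`. -/
def LeftComodule.tensorRight (X : LeftComodule K C M) (N : Type w) [AddCommGroup N]
    [Module K N] : LeftComodule K C (M ⊗[K] N) where
  coact := (TensorProduct.assoc K C M N).toLinearMap ∘ₗ X.coact.rTensor N
  coassoc := by
    refine TensorProduct.ext' fun m n => ?_
    have key : ∀ t : C ⊗[K] M,
        TensorProduct.assoc K C C (M ⊗[K] N)
          ((Coalgebra.comul (R := K) (A := C)).rTensor (M ⊗[K] N)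
            (TensorProduct.assoc K C M N (t ⊗ₜ n))) =
        (((TensorProduct.mk K M N).flip n).lTensor C).lTensor C
          (TensorProduct.assoc K C C M
            ((Coalgebra.comul (R := K) (A := C)).rTensor M t)) := by
      intro t
      induction t with
      | zero => simp
      | add x y hx hy => simp only [TensorProduct.add_tmul, map_add, hx, hy]
      | tmul c m =>
        simp only [TensorProduct.assoc_tmul, LinearMap.rTensor_tmul]
        generalize Coalgebra.comul (R := K) c = s
        induction s with
        | zero => simp
        | add x y hx hy => simp only [TensorProduct.add_tmul, map_add, hx, hy]
        | tmul a b => simp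
    have key2 : ∀ t : C ⊗[K] M,
        (((TensorProduct.assoc K C M N).toLinearMap ∘ₗ X.coact.rTensor N).lTensor C)
            (TensorProduct.assoc K C M N (t ⊗ₜ n)) =
        (((TensorProduct.mk K M N).flip n).lTensor C).lTensor C (X.coact.lTensor C t) := by
      intro t
      induction t with
      | zero => simp
      | add x y hx hy => simp only [TensorProduct.add_tmul, map_add, hx, hy]
      | tmul c m =>
        simp only [TensorProduct.assoc_tmul, LinearMap.lTensor_tmul, LinearMap.comp_apply,
          LinearMap.rTensor_tmul, LinearEquiv.coe_coe]
        congr 1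
        generalize X.coact m = s
        induction s with
        | zero => simp
        | add x y hx hy => simp only [TensorProduct.add_tmul, map_add, hx, hy]
        | tmul a b => simp
    have h := LinearMap.congr_fun X.coassoc m
    simp only [LinearMap.comp_apply, LinearEquiv.coe_coe] at h
    simp only [LinearMap.comp_apply, LinearEquiv.coe_coe, LinearMap.rTensor_tmul] at *
    rw [key, h]
    exact (key2 _).symm
  counit_coact := by
    refine TensorProduct.ext' fun m n => ?_
    have key : ∀ t : C ⊗[K] M,
        (Coalgebra.counit (R := K) (A := C)).rTensor (M ⊗[K] N)
            (TensorProduct.assoc K C M N (t ⊗ₜ n)) =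
        ((TensorProduct.mk K M N).flip n).lTensor K
          ((Coalgebra.counit (R := K) (A := C)).rTensor M t) := by
      intro t
      induction t with
      | zero => simp
      | add x y hx hy => simp only [TensorProduct.add_tmul, map_add, hx, hy]
      | tmul c m => simp
    have h := LinearMap.congr_fun X.counit_coact m
    simp only [LinearMap.comp_apply] at h
    simp only [LinearMap.comp_apply, LinearEquiv.coe_coe, LinearMap.rTensor_tmul]
    rw [key, h]
    simp

/-- For a right comodule `M` and a vector space `N`, the right comodule `N ⊗ M` with coaction
`n ⊗ m ↦ (n ⊗ m₀) ⊗ m₁`. -/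
def RightComodule.tensorLeft (X : RightComodule K C M) (N : Type w) [AddCommGroup N]
    [Module K N] : RightComodule K C (N ⊗[K] M) where
  coact := (TensorProduct.assoc K N M C).symm.toLinearMap ∘ₗ X.coact.lTensor N
  coassoc := by
    refine TensorProduct.ext' fun n m => ?_
    have key : ∀ t : M ⊗[K] C,
        TensorProduct.assoc K (N ⊗[K] M) C C
          (((TensorProduct.assoc K N M C).symm.toLinearMap ∘ₗ X.coact.lTensor N).rTensor C
            ((TensorProduct.assoc K N M C).symm (n ⊗ₜ t))) =
        (TensorProduct.mk K N M n).rTensor (C ⊗[K] C)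
          (TensorProduct.assoc K M C C (X.coact.rTensor C t)) := by
      intro t
      induction t with
      | zero => simp
      | add x y hx hy => simp only [TensorProduct.tmul_add, map_add, hx, hy]
      | tmul m c =>
        simp only [TensorProduct.assoc_symm_tmul, LinearMap.rTensor_tmul, LinearMap.comp_apply,
          LinearMap.lTensor_tmul, LinearEquiv.coe_coe]
        generalize X.coact m = s
        induction s with
        | zero => simp
        | add x y hx hy =>
          simp only [TensorProduct.tmul_add, TensorProduct.add_tmul, map_add, hx, hy]
        | tmul a b => simp
    have key2 : ∀ t : M ⊗[K] C,
        (Coalgebra.comul (R := K) (A := C)).lTensor (N ⊗[K] M)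
            ((TensorProduct.assoc K N M C).symm (n ⊗ₜ t)) =
        (TensorProduct.mk K N M n).rTensor (C ⊗[K] C)
          ((Coalgebra.comul (R := K) (A := C)).lTensor M t) := by
      intro t
      induction t with
      | zero => simp
      | add x y hx hy => simp only [TensorProduct.tmul_add, map_add, hx, hy]
      | tmul m c => simp
    have h := LinearMap.congr_fun X.coassoc m
    simp only [LinearMap.comp_apply, LinearEquiv.coe_coe] at h
    simp only [LinearMap.comp_apply, LinearEquiv.coe_coe, LinearMap.lTensor_tmul]
    rw [key2, ← h]
    exact key _
  counit_coact := by
    refine TensorProduct.ext' fun n m => ?_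
    have key : ∀ t : M ⊗[K] C,
        (Coalgebra.counit (R := K) (A := C)).lTensor (N ⊗[K] M)
            ((TensorProduct.assoc K N M C).symm (n ⊗ₜ t)) =
        (TensorProduct.mk K N M n).rTensor K
          ((Coalgebra.counit (R := K) (A := C)).lTensor M t) := by
      intro t
      induction t with
      | zero => simp
      | add x y hx hy => simp only [TensorProduct.tmul_add, map_add, hx, hy]
      | tmul m c => simp
    have h := LinearMap.congr_fun X.counit_coact m
    simp only [LinearMap.comp_apply] at h
    simp only [LinearMap.comp_apply, LinearEquiv.coe_coe, LinearMap.lTensor_tmul]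
    rw [key, h]
    simp

/-- The quotient of a left comodule by a subspace on which the induced coaction vanishes. -/
def LeftComodule.quotient (X : LeftComodule K C M) (S : Submodule K M)
    (hS : S ≤ LinearMap.ker (S.mkQ.lTensor C ∘ₗ X.coact)) : LeftComodule K C (M ⧸ S) where
  coact := S.liftQ (S.mkQ.lTensor C ∘ₗ X.coact) hS
  coassoc := by
    refine Submodule.linearMap_qext _ (LinearMap.ext fun m => ?_)
    have key : ∀ t : C ⊗[K] M,
        TensorProduct.assoc K C C (M ⧸ S)
          ((Coalgebra.comul (R := K) (A := C)).rTensor (M ⧸ S) (S.mkQ.lTensor C t)) =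
        (S.mkQ.lTensor C).lTensor C (TensorProduct.assoc K C C M
          ((Coalgebra.comul (R := K) (A := C)).rTensor M t)) := by
      intro t
      induction t with
      | zero => simp
      | add x y hx hy => simp only [map_add, hx, hy]
      | tmul c m =>
        simp only [LinearMap.lTensor_tmul, LinearMap.rTensor_tmul]
        generalize Coalgebra.comul (R := K) c = s
        induction s with
        | zero => simp
        | add x y hx hy => simp only [TensorProduct.add_tmul, map_add, hx, hy]
        | tmul a b => simp
    have h := LinearMap.congr_fun X.coassoc m
    simp only [LinearMap.comp_apply, LinearEquiv.coe_coe] at h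
    simp only [LinearMap.comp_apply, LinearEquiv.coe_coe, Submodule.mkQ_apply,
      Submodule.liftQ_apply]
    rw [key, h]
    generalize X.coact m = t
    induction t with
    | zero => simp
    | add x y hx hy => simp only [map_add, hx, hy]
    | tmul c m => simp
  counit_coact := by
    refine Submodule.linearMap_qext _ (LinearMap.ext fun m => ?_)
    have key : ∀ t : C ⊗[K] M,
        (Coalgebra.counit (R := K) (A := C)).rTensor (M ⧸ S) (S.mkQ.lTensor C t) =
        S.mkQ.lTensor K ((Coalgebra.counit (R := K) (A := C)).rTensor M t) := by
      intro t
      induction t with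
      | zero => simp
      | add x y hx hy => simp only [map_add, hx, hy]
      | tmul c m => simp
    have h := LinearMap.congr_fun X.counit_coact m
    simp only [LinearMap.comp_apply] at h
    simp only [LinearMap.comp_apply, Submodule.mkQ_apply, Submodule.liftQ_apply]
    rw [key, h]
    simp

/-- The quotient of a right comodule by a subspace on which the induced coaction vanishes. -/
def RightComodule.quotient (X : RightComodule K C M) (S : Submodule K M)
    (hS : S ≤ LinearMap.ker (S.mkQ.rTensor C ∘ₗ X.coact)) : RightComodule K C (M ⧸ S) where
  coact := S.liftQ (S.mkQ.rTensor C ∘ₗ X.coact) hS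
  coassoc := by
    refine Submodule.linearMap_qext _ (LinearMap.ext fun m => ?_)
    have key : ∀ t : M ⊗[K] C,
        TensorProduct.assoc K (M ⧸ S) C C
          ((S.liftQ (S.mkQ.rTensor C ∘ₗ X.coact) hS).rTensor C (S.mkQ.rTensor C t)) =
        S.mkQ.rTensor (C ⊗[K] C) (TensorProduct.assoc K M C C (X.coact.rTensor C t)) := by
      intro t
      induction t with
      | zero => simp
      | add x y hx hy => simp only [map_add, hx, hy]
      | tmul m c =>
        simp only [LinearMap.rTensor_tmul, Submodule.mkQ_apply, Submodule.liftQ_apply,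
          LinearMap.comp_apply]
        generalize X.coact m = s
        induction s with
        | zero => simp
        | add x y hx hy => simp only [TensorProduct.add_tmul, map_add, hx, hy]
        | tmul a b => simp
    have h := LinearMap.congr_fun X.coassoc m
    simp only [LinearMap.comp_apply, LinearEquiv.coe_coe] at h
    simp only [LinearMap.comp_apply, LinearEquiv.coe_coe, Submodule.mkQ_apply,
      Submodule.liftQ_apply]
    rw [key, h]
    generalize X.coact m = t
    induction t with
    | zero => simp
    | add x y hx hy => simp only [map_add, hx, hy]
    | tmul m c => simp
  counit_coact := by
    refine Submodule.linearMap_qext _ (LinearMap.ext fun m => ?_)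
    have key : ∀ t : M ⊗[K] C,
        (Coalgebra.counit (R := K) (A := C)).lTensor (M ⧸ S) (S.mkQ.rTensor C t) =
        S.mkQ.rTensor K ((Coalgebra.counit (R := K) (A := C)).lTensor M t) := by
      intro t
      induction t with
      | zero => simp
      | add x y hx hy => simp only [map_add, hx, hy]
      | tmul m c => simp
    have h := LinearMap.congr_fun X.counit_coact m
    simp only [LinearMap.comp_apply] at h
    simp only [LinearMap.comp_apply, Submodule.mkQ_apply, Submodule.liftQ_apply]
    rw [key, h]
    simp

end Comodules

section Injective

variable {K : Type u} {C : Type v} [Field K] [AddCommGroup C] [Module K C] [Coalgebra K C]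

/-- Injective objects of the category of left `C`-comodules. -/
def LeftComodule.IsInjective {I : Type v} [AddCommGroup I] [Module K I]
    (Z : LeftComodule K C I) : Prop :=
  ∀ (M N : Type v) [AddCommGroup M] [Module K M] [AddCommGroup N] [Module K N]
    (X : LeftComodule K C M) (Y : LeftComodule K C N) (i : M →ₗ[K] N) (f : M →ₗ[K] I),
    X.IsColinear Y i → Function.Injective i → X.IsColinear Z f →
      ∃ g : N →ₗ[K] I, Y.IsColinear Z g ∧ g ∘ₗ i = f

/-- Injective objects of the category of right `C`-comodules. -/
def RightComodule.IsInjective {I : Type v} [AddCommGroup I] [Module K I]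
    (Z : RightComodule K C I) : Prop :=
  ∀ (M N : Type v) [AddCommGroup M] [Module K M] [AddCommGroup N] [Module K N]
    (X : RightComodule K C M) (Y : RightComodule K C N) (i : M →ₗ[K] N) (f : M →ₗ[K] I),
    X.IsColinear Y i → Function.Injective i → X.IsColinear Z f →
      ∃ g : N →ₗ[K] I, Y.IsColinear Z g ∧ g ∘ₗ i = f

/-- `C` is left hereditary: every quotient of an injective left comodule is injective. -/
def IsLeftHereditary (K : Type u) (C : Type v) [Field K] [AddCommGroup C] [Module K C]
    [Coalgebra K C] : Prop :=
  ∀ (I Q : Type v) [AddCommGroup I] [Module K I] [AddCommGroup Q] [Module K Q]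
    (X : LeftComodule K C I) (Y : LeftComodule K C Q) (p : I →ₗ[K] Q),
    X.IsColinear Y p → Function.Surjective p → X.IsInjective → Y.IsInjective

/-- `C` is right hereditary: every quotient of an injective right comodule is injective. -/
def IsRightHereditary (K : Type u) (C : Type v) [Field K] [AddCommGroup C] [Module K C]
    [Coalgebra K C] : Prop :=
  ∀ (I Q : Type v) [AddCommGroup I] [Module K I] [AddCommGroup Q] [Module K Q]
    (X : RightComodule K C I) (Y : RightComodule K C Q) (p : I →ₗ[K] Q),
    X.IsColinear Y p → Function.Surjective p → X.IsInjective → Y.IsInjective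

end Injective

/-! ### Bicomodules and formally smooth coalgebras in vector spaces -/

/-- A `C`-bicomodule structure on `M`. -/
structure Bicomodule (K : Type u) (C : Type v) (M : Type w) [Field K]
    [AddCommGroup C] [Module K C] [Coalgebra K C] [AddCommGroup M] [Module K M] where
  left : LeftComodule K C M
  right : RightComodule K C M
  compat : (TensorProduct.assoc K C M C).toLinearMap ∘ₗ left.coact.rTensor C ∘ₗ right.coact =
      right.coact.lTensor C ∘ₗ left.coact

section Bicomodules

variable {K : Type u} {C : Type v} [Field K] [AddCommGroup C] [Module K C] [Coalgebra K C]
variable {M N : Type w} [AddCommGroup M] [Module K M] [AddCommGroup N] [Module K N]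

/-- Morphisms of bicomodules: left and right colinear maps. -/
def Bicomodule.IsBicolinear (X : Bicomodule K C M) (Y : Bicomodule K C N)
    (f : M →ₗ[K] N) : Prop :=
  X.left.IsColinear Y.left f ∧ X.right.IsColinear Y.right f

/-- The bicomodule `C ⊗ C` with left coaction `Δ ⊗ C` and right coaction `C ⊗ Δ`. -/
def Bicomodule.tensorSelf (K : Type u) (C : Type v) [Field K] [AddCommGroup C] [Module K C]
    [Coalgebra K C] : Bicomodule K C (C ⊗[K] C) where
  left := (LeftComodule.regular K C).tensorRight C
  right := (RightComodule.regular K C).tensorLeft C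
  compat := by
    refine TensorProduct.ext' fun c d => ?_
    have key : ∀ t : C ⊗[K] C,
        TensorProduct.assoc K C (C ⊗[K] C) C
          (((TensorProduct.assoc K C C C).toLinearMap ∘ₗ
              (Coalgebra.comul (R := K) (A := C)).rTensor C).rTensor C
            ((TensorProduct.assoc K C C C).symm (c ⊗ₜ t))) =
        (TensorProduct.assoc K C C C).symm.toLinearMap.lTensor C
          (TensorProduct.assoc K C C (C ⊗[K] C) (Coalgebra.comul (R := K) c ⊗ₜ t)) := by
      intro t
      induction t with
      | zero => simp
      | add x y hx hy => simp only [TensorProduct.tmul_add, map_add, hx, hy]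
      | tmul a b =>
        simp only [TensorProduct.assoc_symm_tmul, LinearMap.rTensor_tmul, LinearMap.comp_apply,
          LinearEquiv.coe_coe]
        generalize Coalgebra.comul (R := K) c = s
        induction s with
        | zero => simp
        | add x y hx hy => simp only [TensorProduct.add_tmul, map_add, hx, hy]
        | tmul a b => simp
    have key2 : ∀ s : C ⊗[K] C,
        ((TensorProduct.assoc K C C C).symm.toLinearMap ∘ₗ
            (Coalgebra.comul (R := K) (A := C)).lTensor C).lTensor C
          (TensorProduct.assoc K C C C (s ⊗ₜ d)) =
        (TensorProduct.assoc K C C C).symm.toLinearMap.lTensor C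
          (TensorProduct.assoc K C C (C ⊗[K] C) (s ⊗ₜ Coalgebra.comul (R := K) d)) := by
      intro s
      induction s with
      | zero => simp
      | add x y hx hy => simp only [TensorProduct.add_tmul, map_add, hx, hy]
      | tmul a b => simp
    simp only [LeftComodule.tensorRight, RightComodule.tensorLeft, LeftComodule.regular,
      RightComodule.regular]
    exact (key _).trans (key2 _).symm

/-- The quotient of a bicomodule by a subspace on which the induced coactions vanish. -/
def Bicomodule.quotient (X : Bicomodule K C M) (S : Submodule K M)
    (hl : S ≤ LinearMap.ker (S.mkQ.lTensor C ∘ₗ X.left.coact))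
    (hr : S ≤ LinearMap.ker (S.mkQ.rTensor C ∘ₗ X.right.coact)) : Bicomodule K C (M ⧸ S) where
  left := X.left.quotient S hl
  right := X.right.quotient S hr
  compat := by
    refine Submodule.linearMap_qext _ (LinearMap.ext fun m => ?_)
    have key : ∀ t : M ⊗[K] C,
        TensorProduct.assoc K C (M ⧸ S) C
          ((X.left.quotient S hl).coact.rTensor C (S.mkQ.rTensor C t)) =
        (S.mkQ.rTensor C).lTensor C (TensorProduct.assoc K C M C (X.left.coact.rTensor C t)) := by
      intro t
      induction t with
      | zero => simp
      | add x y hx hy => simp only [map_add, hx, hy]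
      | tmul m c =>
        simp only [LinearMap.rTensor_tmul, Submodule.mkQ_apply, LeftComodule.quotient,
          Submodule.liftQ_apply, LinearMap.comp_apply]
        generalize X.left.coact m = s
        induction s with
        | zero => simp
        | add x y hx hy => simp only [TensorProduct.add_tmul, map_add, hx, hy]
        | tmul a b => simp
    have key2 : ∀ t : C ⊗[K] M,
        (X.right.quotient S hr).coact.lTensor C (S.mkQ.lTensor C t) =
        (S.mkQ.rTensor C).lTensor C (X.right.coact.lTensor C t) := by
      intro t
      induction t with
      | zero => simp
      | add x y hx hy => simp only [map_add, hx, hy]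
      | tmul c m => simp [RightComodule.quotient]
    have h := LinearMap.congr_fun X.compat m
    simp only [LinearMap.comp_apply, LinearEquiv.coe_coe] at h
    exact (key _).trans ((congrArg _ h).trans (key2 _).symm)

theorem tensorSelf_left_apply (x : C) :
    (Bicomodule.tensorSelf K C).left.coact (Coalgebra.comul (R := K) x) =
      (Coalgebra.comul (R := K) (A := C)).lTensor C (Coalgebra.comul (R := K) x) :=
  Coalgebra.coassoc_apply x

theorem tensorSelf_right_apply (x : C) :
    (Bicomodule.tensorSelf K C).right.coact (Coalgebra.comul (R := K) x) =
      (Coalgebra.comul (R := K) (A := C)).rTensor C (Coalgebra.comul (R := K) x) :=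
  Coalgebra.coassoc_symm_apply x

theorem range_comul_le_left :
    LinearMap.range (Coalgebra.comul (R := K) (A := C)) ≤
      LinearMap.ker ((LinearMap.range (Coalgebra.comul (R := K) (A := C))).mkQ.lTensor C ∘ₗ
        (Bicomodule.tensorSelf K C).left.coact) := by
  rintro _ ⟨x, rfl⟩
  rw [LinearMap.mem_ker, LinearMap.comp_apply, tensorSelf_left_apply, ← LinearMap.comp_apply,
    ← LinearMap.lTensor_comp, LinearMap.range_mkQ_comp, LinearMap.lTensor_zero,
    LinearMap.zero_apply]

theorem range_comul_le_right :
    LinearMap.range (Coalgebra.comul (R := K) (A := C)) ≤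
      LinearMap.ker ((LinearMap.range (Coalgebra.comul (R := K) (A := C))).mkQ.rTensor C ∘ₗ
        (Bicomodule.tensorSelf K C).right.coact) := by
  rintro _ ⟨x, rfl⟩
  rw [LinearMap.mem_ker, LinearMap.comp_apply, tensorSelf_right_apply, ← LinearMap.comp_apply,
    ← LinearMap.rTensor_comp, LinearMap.range_mkQ_comp, LinearMap.rTensor_zero,
    LinearMap.zero_apply]

/-- The cokernel of the comultiplication. -/
abbrev CokerComul (K : Type u) (C : Type v) [Field K] [AddCommGroup C] [Module K C]
    [Coalgebra K C] : Type v :=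
  (C ⊗[K] C) ⧸ LinearMap.range (Coalgebra.comul (R := K) (A := C))

/-- The bicomodule structure of `Coker Δ`. -/
def Bicomodule.cokerComul (K : Type u) (C : Type v) [Field K] [AddCommGroup C] [Module K C]
    [Coalgebra K C] : Bicomodule K C (CokerComul K C) :=
  (Bicomodule.tensorSelf K C).quotient _ range_comul_le_left range_comul_le_right

/-- Relative injectivity of a bicomodule, with respect to the bicomodule maps that have a
`K`-linear retraction. -/
def Bicomodule.IsRelInjective {I : Type v} [AddCommGroup I] [Module K I]
    (Z : Bicomodule K C I) : Prop :=
  ∀ (M N : Type v) [AddCommGroup M] [Module K M] [AddCommGroup N] [Module K N]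
    (X : Bicomodule K C M) (Y : Bicomodule K C N) (i : M →ₗ[K] N) (f : M →ₗ[K] I),
    X.IsBicolinear Y i → (∃ r : N →ₗ[K] M, r ∘ₗ i = LinearMap.id) → X.IsBicolinear Z f →
      ∃ g : N →ₗ[K] I, Y.IsBicolinear Z g ∧ g ∘ₗ i = f

/-- `C` is formally smooth as a coalgebra in vector spaces: the bicomodule `Coker Δ` is
relatively injective. -/
def IsFormallySmooth (K : Type u) (C : Type v) [Field K] [AddCommGroup C] [Module K C]
    [Coalgebra K C] : Prop :=
  (Bicomodule.cokerComul K C).IsRelInjective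

end Bicomodules

/-! ### The monoidal category of right `H`-modules, and its coalgebras -/

/-- A right `H`-module structure on the `K`-module `M`, given by an explicit action map since
tensor products are to carry the diagonal action. -/
structure RightModule (K : Type u) (H : Type v) (M : Type w) [Field K] [Ring H] [Algebra K H]
    [AddCommGroup M] [Module K M] where
  act : M ⊗[K] H →ₗ[K] M
  act_mul : ∀ (m : M) (h h' : H), act (act (m ⊗ₜ h) ⊗ₜ h') = act (m ⊗ₜ (h * h'))
  act_one : ∀ m : M, act (m ⊗ₜ 1) = m

section RightModules

variable {K : Type u} {H : Type v} [Field K] [Ring H]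

/-- Morphisms of right `H`-modules. -/
def RightModule.IsLinear [Algebra K H] {M N : Type*} [AddCommGroup M] [Module K M]
    [AddCommGroup N] [Module K N] (X : RightModule K H M) (Y : RightModule K H N)
    (f : M →ₗ[K] N) : Prop :=
  f ∘ₗ X.act = Y.act ∘ₗ f.rTensor H

/-- The right regular module. -/
def RightModule.regular (K : Type u) (H : Type v) [Field K] [Ring H] [Algebra K H] :
    RightModule K H H where
  act := LinearMap.mul' K H
  act_mul m h h' := by simp [mul_assoc]
  act_one m := by simp

/-- The quotient of a right module by a submodule. -/
def RightModule.quotient [Algebra K H] {M : Type w} [AddCommGroup M] [Module K M]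
    (X : RightModule K H M) (S : Submodule K M)
    (hS : ∀ m ∈ S, ∀ h : H, X.act (m ⊗ₜ h) ∈ S) : RightModule K H (M ⧸ S) where
  act := TensorProduct.lift (S.liftQ ((TensorProduct.curry X.act).compr₂ S.mkQ) (by
    intro m hm
    rw [LinearMap.mem_ker]
    ext h
    simpa using hS m hm h))
  act_mul m h h' := by
    obtain ⟨m, rfl⟩ := S.mkQ_surjective m
    simp [X.act_mul]
  act_one m := by
    obtain ⟨m, rfl⟩ := S.mkQ_surjective m
    simp [X.act_one]

variable [Bialgebra K H]

/-- The auxiliary map `(m ⊗ n) ⊗ (a ⊗ b) ↦ ma ⊗ nb`. -/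
def RightModule.act₂ {M N : Type*} [AddCommGroup M] [Module K M] [AddCommGroup N] [Module K N]
    (X : RightModule K H M) (Y : RightModule K H N) :
    (M ⊗[K] N) ⊗[K] (H ⊗[K] H) →ₗ[K] M ⊗[K] N :=
  TensorProduct.map X.act Y.act ∘ₗ (TensorProduct.tensorTensorTensorComm K M N H H).toLinearMap

@[simp]
theorem RightModule.act₂_tmul {M N : Type*} [AddCommGroup M] [Module K M] [AddCommGroup N]
    [Module K N] (X : RightModule K H M) (Y : RightModule K H N) (m : M) (n : N) (a b : H) :
    X.act₂ Y ((m ⊗ₜ n) ⊗ₜ (a ⊗ₜ b)) = X.act (m ⊗ₜ a) ⊗ₜ Y.act (n ⊗ₜ b) := by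
  simp [RightModule.act₂]

/-- The tensor product of two right modules, with the diagonal action
`(m ⊗ n) h = m h₁ ⊗ n h₂`. -/
def RightModule.diag {M N : Type*} [AddCommGroup M] [Module K M] [AddCommGroup N] [Module K N]
    (X : RightModule K H M) (Y : RightModule K H N) : RightModule K H (M ⊗[K] N) where
  act := X.act₂ Y ∘ₗ (Coalgebra.comul (R := K) (A := H)).lTensor (M ⊗[K] N)
  act_mul t h h' := by
    simp only [LinearMap.comp_apply, LinearMap.lTensor_tmul, Bialgebra.comul_mul]
    generalize Coalgebra.comul (R := K) h = s
    generalize Coalgebra.comul (R := K) h' = s'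
    induction t with
    | zero => simp
    | add x y hx hy => simp only [TensorProduct.add_tmul, map_add, hx, hy]
    | tmul m n =>
      induction s with
      | zero => simp
      | add x y hx hy =>
        simp only [TensorProduct.add_tmul, TensorProduct.tmul_add, map_add, hx, hy, add_mul]
      | tmul a b =>
        induction s' with
        | zero => simp
        | add x y hx hy => simp only [TensorProduct.tmul_add, map_add, hx, hy, mul_add]
        | tmul a' b' => simp [X.act_mul, Y.act_mul]
  act_one t := by
    simp only [LinearMap.comp_apply, LinearMap.lTensor_tmul, Bialgebra.comul_one]
    induction t with
    | zero => simp
    | add x y hx hy => simp only [TensorProduct.add_tmul, map_add, hx, hy]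
    | tmul m n => simp [Algebra.TensorProduct.one_def, X.act_one, Y.act_one]

section

variable {M N P Q : Type*} [AddCommGroup M] [Module K M] [AddCommGroup N] [Module K N]
  [AddCommGroup P] [Module K P] [AddCommGroup Q] [Module K Q]
  {X : RightModule K H M} {Y : RightModule K H N} {Z : RightModule K H P}
  {W : RightModule K H Q}

theorem RightModule.isLinear_iff {f : M →ₗ[K] N} :
    X.IsLinear Y f ↔ ∀ m h, f (X.act (m ⊗ₜ h)) = Y.act (f m ⊗ₜ h) :=
  ⟨fun h m k => by simpa using LinearMap.congr_fun h (m ⊗ₜ k),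
    fun h => TensorProduct.ext' fun m k => by simpa using h m k⟩

theorem RightModule.IsLinear.comp {g : N →ₗ[K] P} {f : M →ₗ[K] N} (hg : Y.IsLinear Z g)
    (hf : X.IsLinear Y f) : X.IsLinear Z (g ∘ₗ f) := by
  rw [RightModule.isLinear_iff] at *
  intro m h
  simp [hf, hg]

theorem RightModule.IsLinear.map {f : M →ₗ[K] P} {g : N →ₗ[K] Q} (hf : X.IsLinear Z f)
    (hg : Y.IsLinear W g) : (X.diag Y).IsLinear (Z.diag W) (TensorProduct.map f g) := by
  rw [RightModule.isLinear_iff] at *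
  intro t h
  simp only [RightModule.diag, LinearMap.comp_apply, LinearMap.lTensor_tmul]
  generalize Coalgebra.comul (R := K) h = s
  induction t with
  | zero => simp
  | add x y hx hy => simp only [TensorProduct.add_tmul, map_add, hx, hy]
  | tmul m n =>
    induction s with
    | zero => simp
    | add x y hx hy => simp only [TensorProduct.tmul_add, map_add, hx, hy]
    | tmul a b => simp [hf, hg]

theorem RightModule.isLinear_id : X.IsLinear X LinearMap.id := by
  rw [RightModule.isLinear_iff]
  intro m h
  simp

theorem RightModule.isLinear_assoc :
    ((X.diag Y).diag Z).IsLinear (X.diag (Y.diag Z)) (TensorProduct.assoc K M N P).toLinearMap := by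
  rw [RightModule.isLinear_iff]
  intro t h
  induction t with
  | zero => simp
  | add x y hx hy => simp only [TensorProduct.add_tmul, map_add, hx, hy]
  | tmul t p =>
    induction t with
    | zero => simp
    | add x y hx hy => simp only [TensorProduct.add_tmul, map_add, hx, hy]
    | tmul m n =>
      let Ψ : H ⊗[K] (H ⊗[K] H) →ₗ[K] M ⊗[K] (N ⊗[K] P) :=
        TensorProduct.map (X.act ∘ₗ TensorProduct.mk K M H m)
          (TensorProduct.map (Y.act ∘ₗ TensorProduct.mk K N H n)
            (Z.act ∘ₗ TensorProduct.mk K P H p))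
      have key : ∀ s : H ⊗[K] H, TensorProduct.assoc K M N P
          ((X.diag Y).act₂ Z (((m ⊗ₜ n) ⊗ₜ p) ⊗ₜ s)) =
          Ψ (TensorProduct.assoc K H H H
            ((Coalgebra.comul (R := K) (A := H)).rTensor H s)) := by
        intro s
        induction s with
        | zero => simp
        | add x y hx hy => simp only [TensorProduct.tmul_add, map_add, hx, hy]
        | tmul a b =>
          simp only [RightModule.act₂_tmul, RightModule.diag, LinearMap.comp_apply,
            LinearMap.lTensor_tmul, LinearMap.rTensor_tmul]
          generalize Coalgebra.comul (R := K) a = s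
          induction s with
          | zero => simp
          | add x y hx hy =>
            simp only [TensorProduct.tmul_add, TensorProduct.add_tmul, map_add, hx, hy]
          | tmul a b => simp [Ψ]
      have key2 : ∀ s : H ⊗[K] H,
          X.act₂ (Y.diag Z) ((m ⊗ₜ (n ⊗ₜ p)) ⊗ₜ s) =
          Ψ ((Coalgebra.comul (R := K) (A := H)).lTensor H s) := by
        intro s
        induction s with
        | zero => simp
        | add x y hx hy => simp only [TensorProduct.tmul_add, map_add, hx, hy]
        | tmul a b =>
          simp only [RightModule.act₂_tmul, RightModule.diag, LinearMap.comp_apply,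
            LinearMap.lTensor_tmul]
          generalize Coalgebra.comul (R := K) b = s
          induction s with
          | zero => simp
          | add x y hx hy => simp only [TensorProduct.tmul_add, map_add, hx, hy]
          | tmul a b => simp [Ψ]
      refine (key _).trans (Eq.trans ?_ (key2 _).symm)
      rw [Coalgebra.coassoc_apply]

theorem RightModule.isLinear_assoc_symm :
    (X.diag (Y.diag Z)).IsLinear ((X.diag Y).diag Z)
      (TensorProduct.assoc K M N P).symm.toLinearMap := by
  have h := RightModule.isLinear_assoc (X := X) (Y := Y) (Z := Z)
  rw [RightModule.isLinear_iff] at *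
  intro t k
  have h' := h ((TensorProduct.assoc K M N P).symm t) k
  simp only [LinearEquiv.coe_coe, LinearEquiv.apply_symm_apply] at h' ⊢
  rw [← h', LinearEquiv.symm_apply_apply]

end

end RightModules

/-- A coalgebra in the monoidal category of right `H`-modules: a `K`-coalgebra `C` with a right
`H`-action for which the comultiplication and the counit are `H`-linear (`K` being an `H`-module
through the counit of `H`). -/
structure ModuleCoalgebra (K : Type u) (H : Type v) (C : Type w) [Field K] [Ring H]
    [Bialgebra K H] [AddCommGroup C] [Module K C] [Coalgebra K C] where
  module : RightModule K H C
  comul_linear : module.IsLinear (module.diag module) (Coalgebra.comul (R := K) (A := C))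
  counit_linear : ∀ (c : C) (h : H), Coalgebra.counit (R := K) (module.act (c ⊗ₜ h)) =
      Coalgebra.counit (R := K) c * Coalgebra.counit (R := K) h

/-- `H` with right multiplication and its own coalgebra structure. -/
def ModuleCoalgebra.regular (K : Type u) (H : Type v) [Field K] [Ring H] [Bialgebra K H] :
    ModuleCoalgebra K H H where
  module := RightModule.regular K H
  comul_linear := by
    rw [RightModule.isLinear_iff]
    intro m h
    simp only [RightModule.regular, RightModule.diag, LinearMap.mul'_apply, Bialgebra.comul_mul,
      LinearMap.comp_apply, LinearMap.lTensor_tmul]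
    generalize Coalgebra.comul (R := K) h = s
    generalize Coalgebra.comul (R := K) m = t
    induction t with
    | zero => simp
    | add x y hx hy => simp only [TensorProduct.add_tmul, map_add, hx, hy, add_mul]
    | tmul m n =>
      induction s with
      | zero => simp
      | add x y hx hy => simp only [TensorProduct.tmul_add, map_add, hx, hy, mul_add]
      | tmul a b => simp
  counit_linear c h := by simp [RightModule.regular]

/-- An object of the category of `C`-bicomodules in the monoidal category of right `H`-modules:
a right module with a `C`-bicomodule structure whose coactions are `H`-linear. -/
structure ModuleBicomodule {K : Type u} {H : Type v} {C : Type v} [Field K] [Ring H]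
    [Bialgebra K H] [AddCommGroup C] [Module K C] [Coalgebra K C] (A : ModuleCoalgebra K H C)
    (M : Type w) [AddCommGroup M] [Module K M] where
  module : RightModule K H M
  bicomodule : Bicomodule K C M
  left_linear : module.IsLinear (A.module.diag module) bicomodule.left.coact
  right_linear : module.IsLinear (module.diag A.module) bicomodule.right.coact

section ModuleBicomodules

variable {K : Type u} {H : Type v} {C : Type v} [Field K] [Ring H]
  [Bialgebra K H] [AddCommGroup C] [Module K C] [Coalgebra K C] {A : ModuleCoalgebra K H C}
variable {M N : Type w} [AddCommGroup M] [Module K M] [AddCommGroup N] [Module K N]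

/-- Morphisms of bicomodules in right `H`-modules. -/
def ModuleBicomodule.IsHom (X : ModuleBicomodule A M) (Y : ModuleBicomodule A N)
    (f : M →ₗ[K] N) : Prop :=
  X.module.IsLinear Y.module f ∧ X.bicomodule.IsBicolinear Y.bicomodule f

/-- `C ⊗ C` with the diagonal action and the coactions `Δ ⊗ C` and `C ⊗ Δ`. -/
def ModuleBicomodule.tensorSelf (A : ModuleCoalgebra K H C) :
    ModuleBicomodule A (C ⊗[K] C) where
  module := A.module.diag A.module
  bicomodule := Bicomodule.tensorSelf K C
  left_linear := RightModule.isLinear_assoc.comp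
    (A.comul_linear.map RightModule.isLinear_id)
  right_linear := RightModule.isLinear_assoc_symm.comp
    (RightModule.isLinear_id.map A.comul_linear)

theorem range_comul_act (A : ModuleCoalgebra K H C) :
    ∀ t ∈ LinearMap.range (Coalgebra.comul (R := K) (A := C)), ∀ h : H,
      (A.module.diag A.module).act (t ⊗ₜ h) ∈
        LinearMap.range (Coalgebra.comul (R := K) (A := C)) := by
  rintro _ ⟨x, rfl⟩ h
  exact ⟨_, RightModule.isLinear_iff.1 A.comul_linear x h⟩

theorem isLinear_mkQ (X : RightModule K H M) (S : Submodule K M)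
    (hS : ∀ m ∈ S, ∀ h : H, X.act (m ⊗ₜ h) ∈ S) : X.IsLinear (X.quotient S hS) S.mkQ := by
  rw [RightModule.isLinear_iff]
  intro m h
  simp [RightModule.quotient]

/-- The structure of `Coker Δ` as a bicomodule in right `H`-modules: the action and the coactions
are the ones induced from `C ⊗ C`. -/
def ModuleBicomodule.cokerComul (A : ModuleCoalgebra K H C) :
    ModuleBicomodule A (CokerComul K C) where
  module := (A.module.diag A.module).quotient _ (range_comul_act A)
  bicomodule := Bicomodule.cokerComul K C
  left_linear := by
    rw [RightModule.isLinear_iff]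
    intro m h
    obtain ⟨m, rfl⟩ := Submodule.mkQ_surjective _ m
    have h1 := RightModule.isLinear_iff.1 (RightModule.IsLinear.comp
      (RightModule.isLinear_id.map (isLinear_mkQ _ _ (range_comul_act A)))
      (ModuleBicomodule.tensorSelf A).left_linear) m h
    have h2 := RightModule.isLinear_iff.1 (isLinear_mkQ _ _ (range_comul_act A)) m h
    rw [← h2]
    exact h1
  right_linear := by
    rw [RightModule.isLinear_iff]
    intro m h
    obtain ⟨m, rfl⟩ := Submodule.mkQ_surjective _ m
    have h1 := RightModule.isLinear_iff.1 (RightModule.IsLinear.comp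
      ((isLinear_mkQ _ _ (range_comul_act A)).map RightModule.isLinear_id)
      (ModuleBicomodule.tensorSelf A).right_linear) m h
    have h2 := RightModule.isLinear_iff.1 (isLinear_mkQ _ _ (range_comul_act A)) m h
    rw [← h2]
    exact h1

/-- Relative injectivity of a bicomodule in right `H`-modules, with respect to the morphisms
that have an `H`-linear retraction. -/
def ModuleBicomodule.IsRelInjective {I : Type v} [AddCommGroup I] [Module K I]
    (Z : ModuleBicomodule A I) : Prop :=
  ∀ (M N : Type v) [AddCommGroup M] [Module K M] [AddCommGroup N] [Module K N]
    (X : ModuleBicomodule A M) (Y : ModuleBicomodule A N) (i : M →ₗ[K] N) (f : M →ₗ[K] I),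
    X.IsHom Y i → (∃ r : N →ₗ[K] M, Y.module.IsLinear X.module r ∧ r ∘ₗ i = LinearMap.id) →
      X.IsHom Z f → ∃ g : N →ₗ[K] I, Y.IsHom Z g ∧ g ∘ₗ i = f

/-- `C` is formally smooth as a coalgebra in right `H`-modules. -/
def ModuleCoalgebra.IsFormallySmooth (A : ModuleCoalgebra K H C) : Prop :=
  (ModuleBicomodule.cokerComul A).IsRelInjective

end ModuleBicomodules

/-! ### The cokernel of the unit, and fs-retractions -/

section Cokernel

variable (K : Type u) (H : Type v) [Field K] [Ring H] [Bialgebra K H]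

/-- The cokernel of the unit `K → H`. -/
abbrev CokerUnit : Type v := H ⧸ LinearMap.range (Algebra.linearMap K H)

/-- The left `H`-comodule structure `x̄ ↦ x₁ ⊗ x̄₂` of the cokernel of the unit. -/
def LeftComodule.cokerUnit : LeftComodule K H (CokerUnit K H) :=
  (LeftComodule.regular K H).quotient _ (by
    rintro _ ⟨x, rfl⟩
    have h0 : (LinearMap.range (Algebra.linearMap K H)).mkQ (1 : H) = 0 := by
      rw [Submodule.mkQ_apply, Submodule.Quotient.mk_eq_zero]
      exact ⟨1, by simp⟩
    rw [LinearMap.mem_ker, Algebra.linearMap_apply, Algebra.algebraMap_eq_smul_one, map_smul,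
      LinearMap.comp_apply, LeftComodule.regular, Bialgebra.comul_one,
      Algebra.TensorProduct.one_def, LinearMap.lTensor_tmul, h0, TensorProduct.tmul_zero,
      smul_zero])

/-- The comultiplication `x̄ ↦ x̄₁ ⊗ x̄₂` of the cokernel of the unit. -/
def comulCokerUnit : CokerUnit K H →ₗ[K] CokerUnit K H ⊗[K] CokerUnit K H :=
  (LinearMap.range (Algebra.linearMap K H)).mkQ.rTensor (CokerUnit K H) ∘ₗ
    (LeftComodule.cokerUnit K H).coact

variable {K H}

/-- An fs-retraction is a linear map `χ : H ⊗ H̄ → H̄` with `a₁ ⊗ ā₂ = x₁ ⊗ χ(x₂ ⊗ ȳ)` whenever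
`χ(x ⊗ ȳ) = ā`, and with `χ(x₁ ⊗ x̄₂) = x̄`. -/
structure IsFsRetraction (χ : H ⊗[K] CokerUnit K H →ₗ[K] CokerUnit K H) : Prop where
  coact_apply : ∀ (x : H) (y : CokerUnit K H),
    (LeftComodule.cokerUnit K H).coact (χ (x ⊗ₜ y)) =
      χ.lTensor H (TensorProduct.assoc K H H (CokerUnit K H)
        (Coalgebra.comul (R := K) x ⊗ₜ y))
  apply_coact : ∀ x : CokerUnit K H, χ ((LeftComodule.cokerUnit K H).coact x) = x

end Cokernel

end FormalSmooth

/-! For a left comodule M with coaction ρ, the twist h ⊗ m ↦ h m₋₁ ⊗ m₀ of H ⊗ M is bijective, with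
inverse h ⊗ m ↦ h S(m₋₁) ⊗ m₀, and it carries 1 ⊗ M onto ρ(M). Hence Coker ρ ≅ H̄ ⊗ M
(`LeftComodule.ofTensor`), with the codiagonal left coaction; for a compatible right coaction or
right action on M, the induced one lives on the factor M alone. The same twist turns (H ⊗ H̄) ⊗ M
with the codiagonal coaction into the cofree comodule H ⊗ (H̄ ⊗ M). An fs-retraction χ is a colinear
splitting of the coaction H̄ → H ⊗ H̄, so it exhibits Coker ρ as a retract of a cofree object: in
comodules for every M, and for M = H also in bicomodules and in bicomodules over right H-modules.
Cofree objects are (relatively) injective, so (d) gives (a) and (b).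

Conversely, (a) or (b) yields a bicolinear retraction π of Coker Δ → H ⊗ Coker Δ ⊗ H. The right
coinvariants of Coker Δ ≅ H̄ ⊗ H are a copy of H̄, formed by the classes [x ⊗ 1], and π sends every
h ⊗ [x ⊗ 1] ⊗ 1 into them; this is an fs-retraction (`exists_isFsRetraction`). The equivalence of
(c) and (d) holds because a comodule is injective exactly when its coaction splits.

For (e), H̄ is a quotient of the injective comodule H. Conversely, let Z be the kernel of I → Q with
I injective. A Schanuel-type comparison of Z → I with Z → H ⊗ Z makes Q a retract of I ⊕ Coker(Z → H
⊗ Z), where both summands are injective (`isLeftHereditary_of_coker`). For (e'), reversing both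
product and coproduct gives a Hopf algebra with the same antipode; formal smoothness does not
notice, while left and right comodules are exchanged.

For (f), composing a retraction with H ⊗ H̄ → H̄ ⊗ H̄ gives an fs-retraction in any dimension. The
converse needs H̄ → H̄ ⊗ H̄ to be injective. In finite dimension there is a nonzero integral
(`exists_integral`), that is, a left colinear surjection of H onto the trivial comodule K. Under
(e), K is then injective and splits off H; applying the projection to Δ(x), for x̄ in the kernel,
shows that x is a scalar. -/

namespace FormalSmooth

/-! ### Colinear maps between bare coactions, with no comodule axioms required. -/

section LeftGeneral

variable {K : Type u} {C : Type v} [Field K] [AddCommGroup C] [Module K C]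
variable {M N P : Type*} [AddCommGroup M] [Module K M] [AddCommGroup N] [Module K N]
  [AddCommGroup P] [Module K P]

/-- A linear map intertwining two coactions of `C` written on the left. -/
def Intertwines (ρ : M →ₗ[K] C ⊗[K] M) (σ : N →ₗ[K] C ⊗[K] N) (f : M →ₗ[K] N) : Prop :=
  σ ∘ₗ f = f.lTensor C ∘ₗ ρ

/-- A linear map intertwining two coactions of `C` written on the right. -/
def RIntertwines (ρ : M →ₗ[K] M ⊗[K] C) (σ : N →ₗ[K] N ⊗[K] C) (f : M →ₗ[K] N) : Prop :=
  σ ∘ₗ f = f.rTensor C ∘ₗ ρ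

section

variable {ρ : M →ₗ[K] C ⊗[K] M} {σ : N →ₗ[K] C ⊗[K] N} {τ : P →ₗ[K] C ⊗[K] P}

theorem Intertwines.apply {f : M →ₗ[K] N} (h : Intertwines ρ σ f) (m : M) :
    σ (f m) = f.lTensor C (ρ m) :=
  LinearMap.congr_fun h m

theorem Intertwines.comp {g : N →ₗ[K] P} {f : M →ₗ[K] N} (hg : Intertwines σ τ g)
    (hf : Intertwines ρ σ f) : Intertwines ρ τ (g ∘ₗ f) :=
  LinearMap.ext fun m => by
    rw [← LinearMap.comp_assoc, hg, LinearMap.comp_assoc, hf, LinearMap.lTensor_comp,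
      LinearMap.comp_assoc]

theorem Intertwines.add {f g : M →ₗ[K] N} (hf : Intertwines ρ σ f) (hg : Intertwines ρ σ g) :
    Intertwines ρ σ (f + g) := by
  unfold Intertwines at *
  rw [LinearMap.comp_add, hf, hg, LinearMap.lTensor_add, LinearMap.add_comp]

theorem Intertwines.sub {f g : M →ₗ[K] N} (hf : Intertwines ρ σ f) (hg : Intertwines ρ σ g) :
    Intertwines ρ σ (f - g) := by
  unfold Intertwines at *
  rw [LinearMap.comp_sub, hf, hg, LinearMap.lTensor_sub, LinearMap.sub_comp]

theorem intertwines_id : Intertwines ρ ρ LinearMap.id :=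
  LinearMap.ext fun m => by simp

/-- A linear map is colinear if it is so after composition with a colinear surjection. -/
theorem Intertwines.of_comp_right {g : N →ₗ[K] P} {f : M →ₗ[K] N} (hf : Intertwines ρ σ f)
    (hs : Function.Surjective f) (h : Intertwines ρ τ (g ∘ₗ f)) : Intertwines σ τ g := by
  refine LinearMap.ext fun n => ?_
  obtain ⟨m, rfl⟩ := hs n
  have h1 := h.apply m
  rw [LinearMap.lTensor_comp, LinearMap.comp_apply, LinearMap.comp_apply, ← hf.apply] at h1
  exact h1

/-- The inverse of a colinear bijection is colinear. -/
theorem Intertwines.inv {f : M →ₗ[K] N} {g : N →ₗ[K] M} (hf : Intertwines ρ σ f)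
    (h1 : f ∘ₗ g = LinearMap.id) (h2 : g ∘ₗ f = LinearMap.id) : Intertwines σ ρ g :=
  hf.of_comp_right (fun n => ⟨g n, LinearMap.congr_fun h1 n⟩) (h2 ▸ intertwines_id)

end

section

variable {ρ : M →ₗ[K] M ⊗[K] C} {σ : N →ₗ[K] N ⊗[K] C} {τ : P →ₗ[K] P ⊗[K] C}

theorem RIntertwines.apply {f : M →ₗ[K] N} (h : RIntertwines ρ σ f) (m : M) :
    σ (f m) = f.rTensor C (ρ m) :=
  LinearMap.congr_fun h m

theorem RIntertwines.comp {g : N →ₗ[K] P} {f : M →ₗ[K] N} (hg : RIntertwines σ τ g)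
    (hf : RIntertwines ρ σ f) : RIntertwines ρ τ (g ∘ₗ f) :=
  LinearMap.ext fun m => by
    rw [← LinearMap.comp_assoc, hg, LinearMap.comp_assoc, hf, LinearMap.rTensor_comp,
      LinearMap.comp_assoc]

theorem rIntertwines_id : RIntertwines ρ ρ LinearMap.id :=
  LinearMap.ext fun m => by simp

/-- A linear map is colinear if it is so after composition with a colinear surjection. -/
theorem RIntertwines.of_comp_right {g : N →ₗ[K] P} {f : M →ₗ[K] N} (hf : RIntertwines ρ σ f)
    (hs : Function.Surjective f) (h : RIntertwines ρ τ (g ∘ₗ f)) : RIntertwines σ τ g := by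
  refine LinearMap.ext fun n => ?_
  obtain ⟨m, rfl⟩ := hs n
  have h1 := h.apply m
  rw [LinearMap.rTensor_comp, LinearMap.comp_apply, LinearMap.comp_apply, ← hf.apply] at h1
  exact h1

/-- The inverse of a colinear bijection is colinear. -/
theorem RIntertwines.inv {f : M →ₗ[K] N} {g : N →ₗ[K] M} (hf : RIntertwines ρ σ f)
    (h1 : f ∘ₗ g = LinearMap.id) (h2 : g ∘ₗ f = LinearMap.id) : RIntertwines σ ρ g :=
  hf.of_comp_right (fun n => ⟨g n, LinearMap.congr_fun h1 n⟩) (h2 ▸ rIntertwines_id)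

end

end LeftGeneral

/-! ### Cofree comodules and their universal property. -/

section Cofree

variable {K : Type u} {C : Type v} [Field K] [AddCommGroup C] [Module K C] [Coalgebra K C]
variable {M N V W : Type w} [AddCommGroup M] [Module K M] [AddCommGroup N] [Module K N]
  [AddCommGroup V] [Module K V] [AddCommGroup W] [Module K W]

/-- The coaction `Δ ⊗ V` of the cofree left comodule `C ⊗ V`. -/
abbrev cofreeCoact (K : Type u) (C : Type v) [Field K] [AddCommGroup C] [Module K C]
    [Coalgebra K C] (V : Type*) [AddCommGroup V] [Module K V] :
    C ⊗[K] V →ₗ[K] C ⊗[K] (C ⊗[K] V) :=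
  (TensorProduct.assoc K C C V).toLinearMap ∘ₗ (Coalgebra.comul (R := K) (A := C)).rTensor V

/-- The coaction `V ⊗ Δ` of the cofree right comodule `V ⊗ C`. -/
abbrev cofreeRCoact (K : Type u) (C : Type v) [Field K] [AddCommGroup C] [Module K C]
    [Coalgebra K C] (V : Type*) [AddCommGroup V] [Module K V] :
    V ⊗[K] C →ₗ[K] (V ⊗[K] C) ⊗[K] C :=
  (TensorProduct.assoc K V C C).symm.toLinearMap ∘ₗ
    (Coalgebra.comul (R := K) (A := C)).lTensor V

theorem intertwines_lTensor {V W : Type*} [AddCommGroup V] [Module K V] [AddCommGroup W]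
    [Module K W] (f : V →ₗ[K] W) :
    Intertwines (cofreeCoact K C V) (cofreeCoact K C W) (f.lTensor C) := by
  refine TensorProduct.ext' fun c v => ?_
  simp only [LinearMap.comp_apply, LinearMap.lTensor_tmul, LinearMap.rTensor_tmul,
    LinearEquiv.coe_coe]
  generalize Coalgebra.comul (R := K) c = s
  induction s with
  | zero => simp
  | add x y hx hy => simp only [TensorProduct.add_tmul, map_add, hx, hy]
  | tmul a b => simp

theorem rIntertwines_rTensor {V W : Type*} [AddCommGroup V] [Module K V] [AddCommGroup W]
    [Module K W] (f : V →ₗ[K] W) :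
    RIntertwines (cofreeRCoact K C V) (cofreeRCoact K C W) (f.rTensor C) := by
  refine TensorProduct.ext' fun v c => ?_
  simp only [LinearMap.comp_apply, LinearMap.lTensor_tmul, LinearMap.rTensor_tmul,
    LinearEquiv.coe_coe]
  generalize Coalgebra.comul (R := K) c = s
  induction s with
  | zero => simp
  | add x y hx hy => simp only [TensorProduct.tmul_add, map_add, hx, hy]
  | tmul a b => simp

theorem LeftComodule.intertwines_coact (X : LeftComodule K C M) :
    Intertwines X.coact (cofreeCoact K C M) X.coact := by
  unfold Intertwines
  rw [LinearMap.comp_assoc, X.coassoc]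

theorem RightComodule.rIntertwines_coact (X : RightComodule K C M) :
    RIntertwines X.coact (cofreeRCoact K C M) X.coact := by
  unfold RIntertwines
  rw [LinearMap.comp_assoc, ← X.coassoc, ← LinearMap.comp_assoc, LinearEquiv.symm_comp,
    LinearMap.id_comp]

/-- The map `ε ⊗ V`. -/
def counitL (K : Type u) (C : Type v) [Field K] [AddCommGroup C] [Module K C] [Coalgebra K C]
    (V : Type*) [AddCommGroup V] [Module K V] : C ⊗[K] V →ₗ[K] V :=
  (TensorProduct.lid K V).toLinearMap ∘ₗ (Coalgebra.counit (R := K) (A := C)).rTensor V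

/-- The map `V ⊗ ε`. -/
def counitR (K : Type u) (C : Type v) [Field K] [AddCommGroup C] [Module K C] [Coalgebra K C]
    (V : Type*) [AddCommGroup V] [Module K V] : V ⊗[K] C →ₗ[K] V :=
  (TensorProduct.rid K V).toLinearMap ∘ₗ (Coalgebra.counit (R := K) (A := C)).lTensor V

@[simp]
theorem counitL_tmul {V : Type*} [AddCommGroup V] [Module K V] (c : C) (x : V) :
    counitL K C V (c ⊗ₜ x) = Coalgebra.counit (R := K) c • x := by
  simp [counitL]

@[simp]
theorem counitR_tmul {V : Type*} [AddCommGroup V] [Module K V] (x : V) (c : C) :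
    counitR K C V (x ⊗ₜ c) = Coalgebra.counit (R := K) c • x := by
  simp [counitR]

@[simp]
theorem LeftComodule.counitL_coact (X : LeftComodule K C M) (m : M) :
    counitL K C M (X.coact m) = m := by
  have h := LinearMap.congr_fun X.counit_coact m
  simp only [LinearMap.comp_apply] at h
  simp [counitL, h]

@[simp]
theorem RightComodule.counitR_coact (X : RightComodule K C M) (m : M) :
    counitR K C M (X.coact m) = m := by
  have h := LinearMap.congr_fun X.counit_coact m
  simp only [LinearMap.comp_apply] at h
  simp [counitR, h]

theorem LeftComodule.coact_injective (X : LeftComodule K C M) :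
    Function.Injective X.coact :=
  Function.LeftInverse.injective X.counitL_coact

/-- A colinear map to a cofree comodule is determined by its composition with the counit. -/
theorem eq_of_intertwines_cofree {ρ : M →ₗ[K] C ⊗[K] M} {F : M →ₗ[K] C ⊗[K] V}
    (hF : Intertwines ρ (cofreeCoact K C V) F) :
    F = (counitL K C V ∘ₗ F).lTensor C ∘ₗ ρ := by
  refine LinearMap.ext fun m => ?_
  have h := congrArg ((counitL K C V).lTensor C) (hF.apply m)
  rw [← LinearMap.comp_apply (LinearMap.lTensor C _) (LinearMap.lTensor C _),
    ← LinearMap.lTensor_comp] at h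
  rw [LinearMap.comp_apply, ← h]
  generalize F m = t
  induction t with
  | zero => simp
  | add x y hx hy => simpa only [map_add] using congrArg₂ (· + ·) hx hy
  | tmul c v =>
    -- The counit meets the second leg of Δ(c), so the right counit law of `C` returns c.
    have key : ∀ s : C ⊗[K] C, (counitL K C V).lTensor C (TensorProduct.assoc K C C V (s ⊗ₜ v)) =
        counitR K C C s ⊗ₜ v := by
      intro s
      induction s with
      | zero => simp
      | add x y hx hy => simp only [TensorProduct.add_tmul, map_add, hx, hy]
      | tmul a b => simp [TensorProduct.smul_tmul]
    simpa using (key _).symm ▸ congrArg (· ⊗ₜ[K] v)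
      ((RightComodule.regular K C).counitR_coact c).symm

theorem eq_of_rIntertwines_cofree {ρ : M →ₗ[K] M ⊗[K] C} {F : M →ₗ[K] V ⊗[K] C}
    (hF : RIntertwines ρ (cofreeRCoact K C V) F) :
    F = (counitR K C V ∘ₗ F).rTensor C ∘ₗ ρ := by
  refine LinearMap.ext fun m => ?_
  have h := congrArg ((counitR K C V).rTensor C) (hF.apply m)
  rw [← LinearMap.comp_apply (LinearMap.rTensor C _) (LinearMap.rTensor C _),
    ← LinearMap.rTensor_comp] at h
  rw [LinearMap.comp_apply, ← h]
  generalize F m = t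
  induction t with
  | zero => simp
  | add x y hx hy => simpa only [map_add] using congrArg₂ (· + ·) hx hy
  | tmul v c =>
    have key : ∀ s : C ⊗[K] C,
        (counitR K C V).rTensor C ((TensorProduct.assoc K V C C).symm (v ⊗ₜ s)) =
        v ⊗ₜ counitL K C C s := by
      intro s
      induction s with
      | zero => simp
      | add x y hx hy => simp only [TensorProduct.tmul_add, map_add, hx, hy]
      | tmul a b => simp [TensorProduct.smul_tmul]
    simpa using (key _).symm ▸ congrArg (v ⊗ₜ[K] ·)
      ((LeftComodule.regular K C).counitL_coact c).symm

end Cofree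

/-! ### Injective comodules as retracts of cofree ones. -/

section InjectiveComodules

variable {K : Type u} {C : Type v} [Field K] [AddCommGroup C] [Module K C] [Coalgebra K C]
variable {M N V W : Type v} [AddCommGroup M] [Module K M] [AddCommGroup N] [Module K N]
  [AddCommGroup V] [Module K V] [AddCommGroup W] [Module K W]

/-- Cofree left comodules are injective. -/
theorem LeftComodule.isInjective_cofree :
    ((LeftComodule.regular K C).tensorRight V).IsInjective := by
  intro M N _ _ _ _ X Y i f hi hinj hf
  obtain ⟨r, hr⟩ := i.exists_leftInverse_of_injective (LinearMap.ker_eq_bot.2 hinj)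
  -- By cofreeness f amounts to the linear map ε ∘ f, which extends along i through the linear
  -- retraction r; the extension is the colinear map attached to it.
  refine ⟨((counitL K C V ∘ₗ f) ∘ₗ r).lTensor C ∘ₗ Y.coact,
    (intertwines_lTensor _).comp Y.intertwines_coact, ?_⟩
  conv_rhs => rw [eq_of_intertwines_cofree hf]
  rw [LinearMap.comp_assoc, hi, ← LinearMap.comp_assoc, ← LinearMap.lTensor_comp,
    LinearMap.comp_assoc i r, hr, LinearMap.comp_id]

/-- A retract of an injective comodule is injective. -/
theorem LeftComodule.IsInjective.retract {X : LeftComodule K C M} {Y : LeftComodule K C N}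
    (hY : Y.IsInjective) {i : M →ₗ[K] N} {p : N →ₗ[K] M} (hi : X.IsColinear Y i)
    (hp : Y.IsColinear X p) (h : p ∘ₗ i = LinearMap.id) : X.IsInjective := by
  intro A B _ _ _ _ S T j f hj hinj hf
  obtain ⟨g, hg, hgj⟩ := hY A B S T j (i ∘ₗ f) hj hinj (Intertwines.comp hi hf)
  refine ⟨p ∘ₗ g, Intertwines.comp hp hg, ?_⟩
  rw [LinearMap.comp_assoc, hgj, ← LinearMap.comp_assoc, h, LinearMap.id_comp]

/-- The regular comodule is injective. -/
theorem LeftComodule.isInjective_regular : (LeftComodule.regular K C).IsInjective := by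
  intro M N _ _ _ _ X Y i f hi hinj hf
  obtain ⟨r, hr⟩ := i.exists_leftInverse_of_injective (LinearMap.ker_eq_bot.2 hinj)
  -- A functional φ on Z gives the colinear map z ↦ z₋₁ φ(z₀). The argument for cofree comodules is
  -- repeated with V = K because K may live in another universe than C.
  have key : ∀ {L : Type v} [AddCommGroup L] [Module K L] (Z : LeftComodule K C L)
      (φ : L →ₗ[K] K), Z.IsColinear (LeftComodule.regular K C)
        ((TensorProduct.rid K C).toLinearMap ∘ₗ φ.lTensor C ∘ₗ Z.coact) := by
    intro L _ _ Z φ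
    have h1 : Intertwines (cofreeCoact K C K) (LeftComodule.regular K C).coact
        (TensorProduct.rid K C).toLinearMap := by
      refine TensorProduct.ext' fun c k => ?_
      simp only [LinearMap.comp_apply, LinearMap.rTensor_tmul, LinearEquiv.coe_coe,
        TensorProduct.rid_tmul, map_smul, LeftComodule.regular]
      generalize Coalgebra.comul (R := K) c = s
      induction s with
      | zero => simp
      | add x y hx hy => simp only [TensorProduct.add_tmul, map_add, hx, hy, smul_add]
      | tmul a b => simp
    exact h1.comp ((intertwines_lTensor φ).comp Z.intertwines_coact)
  refine ⟨_, key Y ((Coalgebra.counit ∘ₗ f) ∘ₗ r), ?_⟩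
  refine LinearMap.ext fun m => ?_
  have h1 := Intertwines.apply hi m
  have h2 := Intertwines.apply hf m
  have h3 := (RightComodule.regular K C).counitR_coact (f m)
  simp only [LinearMap.comp_apply]
  rw [h1, ← LinearMap.comp_apply (LinearMap.lTensor C _) (LinearMap.lTensor C _),
    ← LinearMap.lTensor_comp, LinearMap.comp_assoc, hr, LinearMap.comp_id]
  conv_rhs => rw [← h3]
  rw [show (RightComodule.regular K C).coact (f m) = f.lTensor C (X.coact m) from h2]
  rw [LinearMap.lTensor_comp, LinearMap.comp_apply, counitR, LinearMap.comp_apply]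

/-- A comodule is injective if and only if its coaction has a colinear retraction. -/
theorem LeftComodule.isInjective_iff_exists_retraction (X : LeftComodule K C M) :
    X.IsInjective ↔ ∃ χ : C ⊗[K] M →ₗ[K] M,
      ((LeftComodule.regular K C).tensorRight M).IsColinear X χ ∧
        χ ∘ₗ X.coact = LinearMap.id := by
  -- The coaction is itself a colinear embedding into a cofree comodule, so injectivity extends the
  -- identity along it.
  refine ⟨fun h => h _ _ X _ X.coact LinearMap.id X.intertwines_coact X.coact_injective
    intertwines_id, ?_⟩
  rintro ⟨χ, hχ, h⟩
  exact LeftComodule.isInjective_cofree.retract X.intertwines_coact hχ h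

end InjectiveComodules

/-! ### Tensoring a comodule with an inert vector space on the left. -/

section Transport

variable {K : Type u} {C : Type v} [Field K] [AddCommGroup C] [Module K C] [Coalgebra K C]
variable {M N V : Type w} [AddCommGroup M] [Module K M] [AddCommGroup N] [Module K N]
  [AddCommGroup V] [Module K V]

/-- Transport of a left comodule structure along a linear equivalence. -/
def LeftComodule.congr (X : LeftComodule K C M) (e : M ≃ₗ[K] N) : LeftComodule K C N where
  coact := e.toLinearMap.lTensor C ∘ₗ X.coact ∘ₗ e.symm.toLinearMap
  coassoc := by
    have h0 : (e.toLinearMap.lTensor C ∘ₗ X.coact ∘ₗ e.symm.toLinearMap) ∘ₗ e.toLinearMap =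
        e.toLinearMap.lTensor C ∘ₗ X.coact := by
      rw [LinearMap.comp_assoc, LinearMap.comp_assoc, LinearEquiv.symm_comp, LinearMap.comp_id]
    have h1 := intertwines_lTensor (C := C) e.toLinearMap
    have h2 := X.coassoc
    unfold Intertwines at h1
    simp only [LinearMap.comp_assoc] at h1 h2 ⊢
    rw [← LinearMap.comp_assoc _ _ (Coalgebra.comul.rTensor N), ← LinearMap.comp_assoc,
      h1]
    simp only [LinearMap.comp_assoc]
    rw [← LinearMap.comp_assoc _ _ (LinearMap.rTensor M Coalgebra.comul), ← LinearMap.comp_assoc _ _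
      (TensorProduct.assoc K C C M).toLinearMap, h2]
    have h3 := congrArg (LinearMap.lTensor C) h0
    rw [LinearMap.lTensor_comp, LinearMap.lTensor_comp C _ X.coact] at h3
    exact LinearMap.ext fun n =>
      (LinearMap.congr_fun h3 (X.coact (e.symm n))).symm
  counit_coact := by
    rw [← LinearMap.comp_assoc, LinearMap.rTensor_comp_lTensor, ← LinearMap.lTensor_comp_rTensor,
      LinearMap.comp_assoc, ← LinearMap.comp_assoc _ X.coact, X.counit_coact]
    exact LinearMap.ext fun n => by simp

/-- The left comodule `V ⊗ M` with coaction `v ⊗ m ↦ m₋₁ ⊗ (v ⊗ m₀)`. -/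
def LeftComodule.tensorLeft (X : LeftComodule K C M) (V : Type w) [AddCommGroup V]
    [Module K V] : LeftComodule K C (V ⊗[K] M) :=
  (X.tensorRight V).congr (TensorProduct.comm K M V)

theorem LeftComodule.tensorLeft_coact_tmul (X : LeftComodule K C M) (x : V) (m : M) :
    (X.tensorLeft V).coact (x ⊗ₜ m) = (TensorProduct.mk K V M x).lTensor C (X.coact m) := by
  simp only [LeftComodule.tensorLeft, LeftComodule.congr, LeftComodule.tensorRight,
    LinearMap.comp_apply, LinearEquiv.coe_coe, TensorProduct.comm_symm_tmul,
    LinearMap.rTensor_tmul]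
  generalize X.coact m = t
  induction t with
  | zero => simp
  | add x y hx hy => simp only [TensorProduct.add_tmul, map_add, hx, hy]
  | tmul c m => simp

end Transport

/-! ### Equivariance for bare actions, and actions on the last tensor factor. -/

section Actions

variable {K : Type*} {H : Type*} [Field K] [AddCommGroup H] [Module K H]
variable {M N P : Type*} [AddCommGroup M] [Module K M] [AddCommGroup N] [Module K N]
  [AddCommGroup P] [Module K P]

/-- A linear map commuting with two actions of `H` written on the right. -/
def Equivariant (a : M ⊗[K] H →ₗ[K] M) (b : N ⊗[K] H →ₗ[K] N) (f : M →ₗ[K] N) : Prop :=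
  f ∘ₗ a = b ∘ₗ f.rTensor H

variable {a : M ⊗[K] H →ₗ[K] M} {b : N ⊗[K] H →ₗ[K] N} {c : P ⊗[K] H →ₗ[K] P}

theorem equivariant_iff {f : M →ₗ[K] N} :
    Equivariant a b f ↔ ∀ m h, f (a (m ⊗ₜ h)) = b (f m ⊗ₜ h) :=
  ⟨fun h m k => by simpa using LinearMap.congr_fun h (m ⊗ₜ k),
    fun h => TensorProduct.ext' fun m k => by simpa using h m k⟩

theorem Equivariant.comp {g : N →ₗ[K] P} {f : M →ₗ[K] N} (hg : Equivariant b c g)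
    (hf : Equivariant a b f) : Equivariant a c (g ∘ₗ f) := by
  rw [equivariant_iff] at *
  intro m h
  simp [hf, hg]

theorem equivariant_id : Equivariant a a LinearMap.id := by
  rw [equivariant_iff]
  intro m h
  simp

theorem Equivariant.of_comp_right {g : N →ₗ[K] P} {f : M →ₗ[K] N} (hf : Equivariant a b f)
    (hs : Function.Surjective f) (h : Equivariant a c (g ∘ₗ f)) : Equivariant b c g := by
  rw [equivariant_iff] at *
  intro n k
  obtain ⟨m, rfl⟩ := hs n
  rw [← hf]
  exact h m k

theorem Equivariant.inv {f : M →ₗ[K] N} {g : N →ₗ[K] M} (hf : Equivariant a b f)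
    (h1 : f ∘ₗ g = LinearMap.id) (h2 : g ∘ₗ f = LinearMap.id) : Equivariant b a g :=
  hf.of_comp_right (fun n => ⟨g n, LinearMap.congr_fun h1 n⟩) (h2 ▸ equivariant_id)

/-- The action `(v ⊗ m) h = v ⊗ m h`. -/
def lTensorAct (V : Type*) [AddCommGroup V] [Module K V] (a : M ⊗[K] H →ₗ[K] M) :
    (V ⊗[K] M) ⊗[K] H →ₗ[K] V ⊗[K] M :=
  a.lTensor V ∘ₗ (TensorProduct.assoc K V M H).toLinearMap

@[simp]
theorem lTensorAct_tmul {V : Type*} [AddCommGroup V] [Module K V] (x : V) (m : M) (h : H) :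
    lTensorAct V a ((x ⊗ₜ m) ⊗ₜ h) = x ⊗ₜ a (m ⊗ₜ h) := by
  simp [lTensorAct]

theorem equivariant_rTensor {V W : Type*} [AddCommGroup V] [Module K V] [AddCommGroup W]
    [Module K W] (f : V →ₗ[K] W) :
    Equivariant (lTensorAct V a) (lTensorAct W a) (f.rTensor M) := by
  rw [equivariant_iff]
  intro t h
  induction t with
  | zero => simp
  | add x y hx hy => simp only [TensorProduct.add_tmul, map_add, hx, hy]
  | tmul x m => simp

theorem equivariant_assoc {V W : Type*} [AddCommGroup V] [Module K V] [AddCommGroup W]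
    [Module K W] : Equivariant (lTensorAct (V ⊗[K] W) a) (lTensorAct V (lTensorAct W a))
      (TensorProduct.assoc K V W M).toLinearMap := by
  rw [equivariant_iff]
  intro t h
  induction t with
  | zero => simp
  | add x y hx hy => simp only [TensorProduct.add_tmul, map_add, hx, hy]
  | tmul t m =>
    induction t with
    | zero => simp
    | add x y hx hy => simp only [TensorProduct.add_tmul, map_add, hx, hy]
    | tmul x m => simp

end Actions

/-! ### Right coactions on the last tensor factor. -/

section RightCoactions

variable {K : Type*} {C : Type*} [Field K] [AddCommGroup C] [Module K C]
variable {M : Type*} [AddCommGroup M] [Module K M]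

/-- The right coaction `v ⊗ m ↦ (v ⊗ m₀) ⊗ m₁`. -/
abbrev lTensorRCoact (V : Type*) [AddCommGroup V] [Module K V] (ρ : M →ₗ[K] M ⊗[K] C) :
    V ⊗[K] M →ₗ[K] (V ⊗[K] M) ⊗[K] C :=
  (TensorProduct.assoc K V M C).symm.toLinearMap ∘ₗ ρ.lTensor V

variable {ρ : M →ₗ[K] M ⊗[K] C}

theorem rIntertwines_rTensor_lTensorRCoact {V W : Type*} [AddCommGroup V] [Module K V]
    [AddCommGroup W] [Module K W] (f : V →ₗ[K] W) :
    RIntertwines (lTensorRCoact V ρ) (lTensorRCoact W ρ) (f.rTensor M) := by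
  refine TensorProduct.ext' fun v c => ?_
  simp only [LinearMap.comp_apply, LinearMap.lTensor_tmul, LinearMap.rTensor_tmul,
    LinearEquiv.coe_coe]
  generalize ρ c = s
  induction s with
  | zero => simp
  | add x y hx hy => simp only [TensorProduct.tmul_add, map_add, hx, hy]
  | tmul a b => simp

theorem rIntertwines_lTensor_lTensorRCoact {N V : Type*} [AddCommGroup V] [Module K V]
    [AddCommGroup N] [Module K N] {σ : N →ₗ[K] N ⊗[K] C} {f : M →ₗ[K] N}
    (hf : RIntertwines ρ σ f) :
    RIntertwines (lTensorRCoact V ρ) (lTensorRCoact V σ) (f.lTensor V) := by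
  refine TensorProduct.ext' fun v c => ?_
  simp only [LinearMap.comp_apply, LinearMap.lTensor_tmul, LinearEquiv.coe_coe, hf.apply]
  generalize ρ c = s
  induction s with
  | zero => simp
  | add x y hx hy => simp only [TensorProduct.tmul_add, map_add, hx, hy]
  | tmul a b => simp

theorem rIntertwines_assoc {V W : Type*} [AddCommGroup V] [Module K V] [AddCommGroup W]
    [Module K W] : RIntertwines (lTensorRCoact (V ⊗[K] W) ρ)
      (lTensorRCoact V (lTensorRCoact W ρ)) (TensorProduct.assoc K V W M).toLinearMap := by
  refine TensorProduct.ext' fun t c => ?_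
  induction t with
  | zero => simp
  | add x y hx hy => simp only [TensorProduct.add_tmul, map_add, hx, hy]
  | tmul v w =>
    simp only [LinearMap.comp_apply, LinearMap.lTensor_tmul,
      LinearEquiv.coe_coe, TensorProduct.assoc_tmul]
    generalize ρ c = s
    induction s with
    | zero => simp
    | add x y hx hy => simp only [TensorProduct.tmul_add, map_add, hx, hy]
    | tmul a b => simp

end RightCoactions

/-! ### The twist and its compatibility with right coactions and actions. -/

section Twist

variable {K : Type u} {H : Type v} [Field K] [Ring H]
variable {M N P : Type*} [AddCommGroup M] [Module K M] [AddCommGroup N] [Module K N]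
  [AddCommGroup P] [Module K P]

/-- The map `h ⊗ m ↦ h m₋₁ ⊗ m₀`. -/
def twist [Algebra K H] (ρ : M →ₗ[K] H ⊗[K] M) : H ⊗[K] M →ₗ[K] H ⊗[K] M :=
  (LinearMap.mul' K H).rTensor M ∘ₗ (TensorProduct.assoc K H H M).symm.toLinearMap ∘ₗ
    ρ.lTensor H

@[simp]
theorem twist_tmul [Algebra K H] (ρ : M →ₗ[K] H ⊗[K] M) (h : H) (m : M) :
    twist ρ (h ⊗ₜ m) = h • ρ m := by
  simp only [twist, LinearMap.comp_apply, LinearMap.lTensor_tmul, LinearEquiv.coe_coe]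
  generalize ρ m = t
  induction t with
  | zero => simp
  | add x y hx hy => simp only [TensorProduct.tmul_add, map_add, hx, hy, smul_add]
  | tmul a b => simp [TensorProduct.smul_tmul']

/-- Left multiplication commutes with right multiplication by m₋₁. This reduces the bijectivity of
the twist to two antipode identities on elements of M. -/
theorem twist_smul [Algebra K H] (ρ : M →ₗ[K] H ⊗[K] M) (h : H) (t : H ⊗[K] M) :
    twist ρ (h • t) = h • twist ρ t := by
  induction t with
  | zero => simp
  | add x y hx hy => simp only [map_add, hx, hy, smul_add]
  | tmul a b => simp [TensorProduct.smul_tmul', mul_smul]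

/-- The codiagonal coaction `n ⊗ m ↦ n₋₁ m₋₁ ⊗ (n₀ ⊗ m₀)`. -/
def codiag [Algebra K H] (σ : N →ₗ[K] H ⊗[K] N) (ρ : M →ₗ[K] H ⊗[K] M) :
    N ⊗[K] M →ₗ[K] H ⊗[K] (N ⊗[K] M) :=
  (LinearMap.mul' K H).rTensor (N ⊗[K] M) ∘ₗ
    (TensorProduct.tensorTensorTensorComm K H N H M).toLinearMap ∘ₗ TensorProduct.map σ ρ

theorem Intertwines.rTensor_codiag [Algebra K H] {σ : N →ₗ[K] H ⊗[K] N} {τ : P →ₗ[K] H ⊗[K] P}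
    (ρ : M →ₗ[K] H ⊗[K] M) {f : N →ₗ[K] P} (hf : Intertwines σ τ f) :
    Intertwines (codiag σ ρ) (codiag τ ρ) (f.rTensor M) := by
  refine TensorProduct.ext' fun n m => ?_
  simp only [codiag, LinearMap.comp_apply, LinearMap.rTensor_tmul, TensorProduct.map_tmul,
    LinearEquiv.coe_coe, hf.apply]
  generalize ρ m = s
  generalize σ n = t
  induction t with
  | zero => simp
  | add x y hx hy => simp only [TensorProduct.add_tmul, map_add, hx, hy]
  | tmul a n =>
    induction s with
    | zero => simp
    | add x y hx hy => simp only [TensorProduct.tmul_add, map_add, hx, hy]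
    | tmul b m => simp

/-- The twist acts on M only through ρ, which commutes with R by the bicomodule compatibility; the
factor H is inert for the right coaction. -/
theorem rIntertwines_twist [Algebra K H] {C : Type*} [AddCommGroup C] [Module K C]
    {ρ : M →ₗ[K] H ⊗[K] M} {R : M →ₗ[K] M ⊗[K] C}
    (h : (TensorProduct.assoc K H M C).toLinearMap ∘ₗ ρ.rTensor C ∘ₗ R = R.lTensor H ∘ₗ ρ) :
    RIntertwines (lTensorRCoact H R) (lTensorRCoact H R) (twist ρ) := by
  refine TensorProduct.ext' fun a m => ?_
  simp only [LinearMap.comp_apply, LinearMap.lTensor_tmul, LinearEquiv.coe_coe, twist_tmul]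
  have h1 : ∀ t : H ⊗[K] M, (TensorProduct.assoc K H M C).symm (R.lTensor H (a • t)) =
      ((LinearMap.mulLeft K a).rTensor M).rTensor C
        ((TensorProduct.assoc K H M C).symm (R.lTensor H t)) := by
    intro t
    induction t with
    | zero => simp
    | add x y hx hy => simp only [map_add, hx, hy, smul_add]
    | tmul b m =>
      simp only [TensorProduct.smul_tmul', LinearMap.lTensor_tmul]
      generalize R m = s
      induction s with
      | zero => simp
      | add x y hx hy => simp only [TensorProduct.tmul_add, map_add, hx, hy]
      | tmul m c => simp
  have h2 := LinearMap.congr_fun h m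
  simp only [LinearMap.comp_apply, LinearEquiv.coe_coe] at h2
  rw [h1, ← h2, LinearEquiv.symm_apply_apply]
  generalize R m = s
  induction s with
  | zero => simp
  | add x y hx hy => simp only [TensorProduct.tmul_add, map_add, hx, hy]
  | tmul m c =>
    simp only [LinearMap.rTensor_tmul, TensorProduct.assoc_symm_tmul, twist_tmul]
    congr 1

/-- Since ρ(mk) = m₋₁k₁ ⊗ m₀k₂, multiplying by h on the left turns the action on M alone into the
diagonal one. -/
theorem equivariant_twist [Bialgebra K H] {ρ : M →ₗ[K] H ⊗[K] M} {X : RightModule K H M}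
    (h : X.IsLinear ((RightModule.regular K H).diag X) ρ) :
    Equivariant (lTensorAct H X.act) ((RightModule.regular K H).diag X).act (twist ρ) := by
  have h1 : ∀ (a : H) (t : H ⊗[K] M) (k : H),
      ((RightModule.regular K H).diag X).act ((a • t) ⊗ₜ k) =
        a • ((RightModule.regular K H).diag X).act (t ⊗ₜ k) := by
    intro a t k
    simp only [RightModule.diag, LinearMap.comp_apply, LinearMap.lTensor_tmul]
    generalize Coalgebra.comul (R := K) k = s
    induction t with
    | zero => simp
    | add x y hx hy => simp only [map_add, hx, hy, smul_add, TensorProduct.add_tmul]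
    | tmul b m =>
      induction s with
      | zero => simp
      | add x y hx hy => simp only [TensorProduct.tmul_add, map_add, hx, hy, smul_add]
      | tmul c d => simp [TensorProduct.smul_tmul', RightModule.regular, mul_assoc]
  rw [RightModule.isLinear_iff] at h
  rw [equivariant_iff]
  intro t k
  induction t with
  | zero => simp
  | add x y hx hy => simp only [map_add, hx, hy, TensorProduct.add_tmul]
  | tmul a m => simp [h, h1]

end Twist

/-! ### The twist as an isomorphism from the codiagonal to the cofree comodule. -/

section TwistComodule

variable {K : Type u} {H : Type v} [Field K] [Ring H]
variable {M : Type w} [AddCommGroup M] [Module K M]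

/-- Multiplicativity of Δ and coassociativity of the coaction give Δ(h m₋₁) ⊗ m₀ = h₁m₋₂ ⊗ h₂m₋₁ ⊗
m₀: the codiagonal coaction becomes the cofree one. -/
theorem LeftComodule.intertwines_twist [Bialgebra K H] (X : LeftComodule K H M) :
    Intertwines (codiag (Coalgebra.comul (R := K) (A := H)) X.coact) (cofreeCoact K H M)
      (twist X.coact) := by
  refine TensorProduct.ext' fun h m => ?_
  have h1 : ∀ t : H ⊗[K] M, cofreeCoact K H M (h • t) =
      TensorProduct.assoc K H H M (Coalgebra.comul (R := K) h •
        (TensorProduct.assoc K H H M).symm (cofreeCoact K H M t)) := by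
    intro t
    induction t with
    | zero => simp
    | add x y hx hy => simp only [map_add, hx, hy, smul_add]
    | tmul a m => simp [TensorProduct.smul_tmul', Bialgebra.comul_mul]
  have h2 := LinearMap.congr_fun X.coassoc m
  simp only [LinearMap.comp_apply, twist_tmul] at h2 ⊢
  rw [← LinearMap.comp_apply (TensorProduct.assoc K H H M).toLinearMap, h1]
  simp only [LinearMap.comp_apply] at h2 ⊢
  rw [h2]
  simp only [codiag, LinearMap.comp_apply, TensorProduct.map_tmul]
  generalize X.coact m = t
  generalize Coalgebra.comul (R := K) h = s
  induction t with
  | zero => simp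
  | add x y hx hy => simp only [map_add, hx, hy, smul_add, TensorProduct.tmul_add]
  | tmul a m =>
    induction s with
    | zero => simp
    | add x y hx hy => simp only [map_add, hx, hy, add_smul, TensorProduct.add_tmul]
    | tmul b c =>
      simp only [LinearMap.lTensor_tmul, LinearEquiv.coe_coe,
        TensorProduct.tensorTensorTensorComm_tmul, LinearMap.rTensor_tmul, twist_tmul,
        LinearMap.mul'_apply]
      generalize X.coact m = t
      induction t with
      | zero => simp
      | add x y hx hy => simp only [map_add, hx, hy, smul_add, TensorProduct.tmul_add]
      | tmul d m => simp [TensorProduct.smul_tmul']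

/-- V contributes nothing to the coaction and can be grouped with M. Followed by the twist of V ⊗ M,
this makes (H ⊗ V) ⊗ M cofree. -/
theorem LeftComodule.intertwines_assoc_codiag [Bialgebra K H] (X : LeftComodule K H M)
    {V : Type w} [AddCommGroup V] [Module K V] :
    Intertwines (M := (H ⊗[K] V) ⊗[K] M) (codiag (cofreeCoact K H V) X.coact)
      (codiag (Coalgebra.comul (R := K) (A := H)) (X.tensorLeft V).coact)
      (TensorProduct.assoc K H V M).toLinearMap := by
  refine TensorProduct.ext' fun t m => ?_
  induction t with
  | zero => simp
  | add x y hx hy => simp only [TensorProduct.add_tmul, map_add, hx, hy]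
  | tmul h x =>
    simp only [codiag, LinearMap.comp_apply, LinearEquiv.coe_coe, TensorProduct.assoc_tmul,
      TensorProduct.map_tmul, LinearMap.rTensor_tmul, X.tensorLeft_coact_tmul]
    generalize X.coact m = t
    generalize Coalgebra.comul (R := K) h = s
    induction t with
    | zero => simp
    | add x y hx hy => simp only [map_add, hx, hy, TensorProduct.tmul_add]
    | tmul a m =>
      induction s with
      | zero => simp
      | add x y hx hy => simp only [map_add, hx, hy, TensorProduct.add_tmul]
      | tmul b c => simp

variable [HopfAlgebra K H]

/-- The map `h ⊗ m ↦ h S(m₋₁) ⊗ m₀`. -/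
def twistInv (ρ : M →ₗ[K] H ⊗[K] M) : H ⊗[K] M →ₗ[K] H ⊗[K] M :=
  twist ((HopfAlgebra.antipode K (A := H)).rTensor M ∘ₗ ρ)

/-- This is m₋₂ S(m₋₁) ⊗ m₀ = 1 ⊗ m, the antipode axiom followed by the counit law. -/
theorem LeftComodule.twistInv_coact (X : LeftComodule K H M) (m : M) :
    twistInv X.coact (X.coact m) = 1 ⊗ₜ m := by
  have h := LinearMap.congr_fun X.coassoc m
  simp only [LinearMap.comp_apply] at h
  simp only [twistInv, twist, LinearMap.lTensor_comp, LinearMap.comp_apply]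
  rw [← h]
  conv_rhs => rw [← X.counitL_coact m]
  generalize X.coact m = t
  induction t with
  | zero => simp
  | add x y hx hy => simp only [map_add, hx, hy, TensorProduct.tmul_add]
  | tmul a m =>
    have key : ∀ s : H ⊗[K] H, (LinearMap.mul' K H).rTensor M
        ((TensorProduct.assoc K H H M).symm
          (((HopfAlgebra.antipode K (A := H)).rTensor M).lTensor H
            (TensorProduct.assoc K H H M (s ⊗ₜ m)))) =
        LinearMap.mul' K H ((HopfAlgebra.antipode K (A := H)).lTensor H s) ⊗ₜ m := by
      intro s
      induction s with
      | zero => simp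
      | add x y hx hy => simp only [map_add, hx, hy, TensorProduct.add_tmul]
      | tmul b c => simp
    refine (key _).trans ?_
    rw [HopfAlgebra.mul_antipode_lTensor_comul_apply, counitL_tmul, Algebra.algebraMap_eq_smul_one,
      TensorProduct.smul_tmul]

/-- This is S(m₋₂) m₋₁ ⊗ m₀ = 1 ⊗ m, from the other antipode axiom. -/
theorem LeftComodule.twist_antipode_coact (X : LeftComodule K H M) (m : M) :
    twist X.coact ((HopfAlgebra.antipode K (A := H)).rTensor M (X.coact m)) = 1 ⊗ₜ m := by
  have h := LinearMap.congr_fun X.coassoc m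
  simp only [LinearMap.comp_apply] at h
  have h1 : ∀ t : H ⊗[K] M,
      X.coact.lTensor H ((HopfAlgebra.antipode K (A := H)).rTensor M t) =
        (HopfAlgebra.antipode K (A := H)).rTensor (H ⊗[K] M) (X.coact.lTensor H t) := by
    intro t
    rw [← LinearMap.comp_apply, ← LinearMap.comp_apply, LinearMap.lTensor_comp_rTensor,
      LinearMap.rTensor_comp_lTensor]
  simp only [twist, LinearMap.comp_apply]
  rw [h1, ← h]
  conv_rhs => rw [← X.counitL_coact m]
  generalize X.coact m = t
  induction t with
  | zero => simp
  | add x y hx hy => simp only [map_add, hx, hy, TensorProduct.tmul_add]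
  | tmul a m =>
    have key : ∀ s : H ⊗[K] H, (LinearMap.mul' K H).rTensor M
        ((TensorProduct.assoc K H H M).symm
          ((HopfAlgebra.antipode K (A := H)).rTensor (H ⊗[K] M)
            (TensorProduct.assoc K H H M (s ⊗ₜ m)))) =
        LinearMap.mul' K H ((HopfAlgebra.antipode K (A := H)).rTensor H s) ⊗ₜ m := by
      intro s
      induction s with
      | zero => simp
      | add x y hx hy => simp only [map_add, hx, hy, TensorProduct.add_tmul]
      | tmul b c => simp
    refine (key _).trans ?_
    rw [HopfAlgebra.mul_antipode_rTensor_comul_apply, counitL_tmul, Algebra.algebraMap_eq_smul_one,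
      TensorProduct.smul_tmul]

theorem LeftComodule.twistInv_comp_twist (X : LeftComodule K H M) :
    twistInv X.coact ∘ₗ twist X.coact = LinearMap.id := by
  refine TensorProduct.ext' fun h m => ?_
  rw [LinearMap.comp_apply, twist_tmul, twistInv, twist_smul]
  refine (congrArg _ (X.twistInv_coact m)).trans ?_
  simp [TensorProduct.smul_tmul']

theorem LeftComodule.twist_comp_twistInv (X : LeftComodule K H M) :
    twist X.coact ∘ₗ twistInv X.coact = LinearMap.id := by
  refine TensorProduct.ext' fun h m => ?_
  rw [LinearMap.comp_apply, twistInv, twist_tmul, twist_smul, LinearMap.comp_apply,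
    X.twist_antipode_coact]
  simp [TensorProduct.smul_tmul']

end TwistComodule

/-! ### Cokernels of coactions. -/

section Coker

variable {K : Type u} {C : Type v} [Field K] [AddCommGroup C] [Module K C] [Coalgebra K C]
variable {M : Type v} [AddCommGroup M] [Module K M]

/-- The cokernel of a coaction `M → C ⊗ M`. -/
abbrev LeftComodule.Coker (X : LeftComodule K C M) : Type v :=
  (C ⊗[K] M) ⧸ LinearMap.range X.coact

theorem LeftComodule.range_coact_le (X : LeftComodule K C M) :
    LinearMap.range X.coact ≤ LinearMap.ker ((LinearMap.range X.coact).mkQ.lTensor C ∘ₗ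
      ((LeftComodule.regular K C).tensorRight M).coact) := by
  rintro _ ⟨x, rfl⟩
  rw [LinearMap.mem_ker, LinearMap.comp_apply]
  refine (congrArg _ (Intertwines.apply X.intertwines_coact x)).trans ?_
  rw [← LinearMap.comp_apply, ← LinearMap.lTensor_comp, LinearMap.range_mkQ_comp,
    LinearMap.lTensor_zero, LinearMap.zero_apply]

/-- The cokernel of a coaction, as a quotient comodule of a cofree comodule. -/
def LeftComodule.coker (X : LeftComodule K C M) : LeftComodule K C X.Coker :=
  ((LeftComodule.regular K C).tensorRight M).quotient _ X.range_coact_le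

theorem LeftComodule.intertwines_mkQ {N : Type w} [AddCommGroup N] [Module K N]
    (X : LeftComodule K C N) (S : Submodule K N)
    (hS : S ≤ LinearMap.ker (S.mkQ.lTensor C ∘ₗ X.coact)) :
    Intertwines X.coact (X.quotient S hS).coact S.mkQ :=
  LinearMap.ext fun _ => rfl

/-- Both coactions of V ⊗ M come from M alone, so the compatibility on M passes over; it is what
makes the twist of V ⊗ M right colinear. -/
theorem LeftComodule.tensorLeft_compat {X : LeftComodule K C M} {R : M →ₗ[K] M ⊗[K] C}
    (h : (TensorProduct.assoc K C M C).toLinearMap ∘ₗ X.coact.rTensor C ∘ₗ R =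
      R.lTensor C ∘ₗ X.coact) (V : Type v) [AddCommGroup V] [Module K V] :
    (TensorProduct.assoc K C (V ⊗[K] M) C).toLinearMap ∘ₗ (X.tensorLeft V).coact.rTensor C ∘ₗ
      lTensorRCoact V R = (lTensorRCoact V R).lTensor C ∘ₗ (X.tensorLeft V).coact := by
  refine TensorProduct.ext' fun x m => ?_
  have h1 := LinearMap.congr_fun h m
  simp only [LinearMap.comp_apply, LinearMap.lTensor_tmul, LinearEquiv.coe_coe,
    X.tensorLeft_coact_tmul] at h1 ⊢
  have h2 : ∀ t : M ⊗[K] C, TensorProduct.assoc K C (V ⊗[K] M) C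
      ((X.tensorLeft V).coact.rTensor C ((TensorProduct.assoc K V M C).symm (x ⊗ₜ t))) =
      ((TensorProduct.assoc K V M C).symm.toLinearMap ∘ₗ
        TensorProduct.mk K V (M ⊗[K] C) x).lTensor C
        (TensorProduct.assoc K C M C (X.coact.rTensor C t)) := by
    intro t
    induction t with
    | zero => simp
    | add y z hy hz => simp only [map_add, hy, hz, TensorProduct.tmul_add]
    | tmul m c =>
      simp only [TensorProduct.assoc_symm_tmul, LinearMap.rTensor_tmul, X.tensorLeft_coact_tmul]
      generalize X.coact m = t
      induction t with
      | zero => simp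
      | add y z hy hz => simp only [map_add, hy, hz, TensorProduct.add_tmul]
      | tmul m c => simp
  rw [h2, h1]
  generalize X.coact m = t
  induction t with
  | zero => simp
  | add y z hy hz => simp only [map_add, hy, hz]
  | tmul m c => simp

end Coker

/-! ### Trivial modules: the action on one factor as a diagonal action. -/

section TrivialModule

variable {K : Type u} {H : Type v} [Field K] [Ring H] [Bialgebra K H]

/-- The trivial action of `H` on a vector space, through the counit. -/
def RightModule.trivial (K : Type u) (H : Type v) [Field K] [Ring H] [Bialgebra K H]
    (V : Type*) [AddCommGroup V] [Module K V] : RightModule K H V where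
  act := counitR K H V
  act_mul x h h' := by simp [smul_smul, mul_comm]
  act_one x := by simp

/-- By ε(h₁)h₂ = h, a trivial factor is invisible to the diagonal action. Thus H ⊗ (H̄ ⊗ H), acted
on through the two copies of H, is a cofree bicomodule in right modules. -/
theorem RightModule.trivial_diag_act {V M : Type*} [AddCommGroup V] [Module K V]
    [AddCommGroup M] [Module K M] (X : RightModule K H M) :
    ((RightModule.trivial K H V).diag X).act = lTensorAct V X.act := by
  refine TensorProduct.ext' fun t h => ?_
  induction t with
  | zero => simp
  | add y z hy hz => simp only [map_add, hy, hz, TensorProduct.add_tmul]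
  | tmul x m =>
    have key : ∀ s : H ⊗[K] H, (RightModule.trivial K H V).act₂ X ((x ⊗ₜ m) ⊗ₜ s) =
        x ⊗ₜ X.act (m ⊗ₜ counitL K H H s) := by
      intro s
      induction s with
      | zero => simp
      | add y z hy hz => simp only [map_add, hy, hz, TensorProduct.tmul_add]
      | tmul a b => simp [RightModule.trivial, TensorProduct.smul_tmul]
    refine (key _).trans ?_
    rw [lTensorAct_tmul]
    exact congrArg (fun z => x ⊗ₜ[K] X.act (m ⊗ₜ z))
      ((LeftComodule.regular K H).counitL_coact h)

theorem LeftComodule.tensorLeft_isLinear {M : Type v} [AddCommGroup M] [Module K M]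
    {X : LeftComodule K H M} {A : RightModule K H M}
    (h : A.IsLinear ((RightModule.regular K H).diag A) X.coact)
    (V : Type v) [AddCommGroup V] [Module K V] :
    ((RightModule.trivial K H V).diag A).IsLinear
      ((RightModule.regular K H).diag ((RightModule.trivial K H V).diag A))
      (X.tensorLeft V).coact := by
  rw [RightModule.isLinear_iff]
  intro t k
  induction t with
  | zero => simp
  | add y z hy hz => simp only [map_add, hy, hz, TensorProduct.add_tmul]
  | tmul x m =>
    have h1 : A.IsLinear ((RightModule.trivial K H V).diag A) (TensorProduct.mk K V M x) := by
      rw [RightModule.isLinear_iff]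
      intro m k
      simp [RightModule.trivial_diag_act]
    have h2 := RightModule.isLinear_iff.1
      ((RightModule.isLinear_id (X := RightModule.regular K H)).map h1) (X.coact m) k
    rw [RightModule.trivial_diag_act, lTensorAct_tmul, X.tensorLeft_coact_tmul,
      X.tensorLeft_coact_tmul, RightModule.isLinear_iff.1 h]
    exact h2

end TrivialModule

/-! ### The isomorphism Coker ρ ≅ H̄ ⊗ M and its embedding into a cofree comodule. -/

section CokerTensor

variable {K : Type u} {H : Type v} [Field K] [Ring H] [HopfAlgebra K H]
variable {M : Type v} [AddCommGroup M] [Module K M]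

/-- The quotient map `H → H / K`. -/
abbrev unitMkQ (K : Type u) (H : Type v) [Field K] [Ring H] [Bialgebra K H] :
    H →ₗ[K] CokerUnit K H :=
  (LinearMap.range (Algebra.linearMap K H)).mkQ

theorem unitMkQ_one : unitMkQ K H 1 = 0 := by
  rw [Submodule.mkQ_apply, Submodule.Quotient.mk_eq_zero]
  exact ⟨1, by simp⟩

theorem unitMkQ_rTensor_surjective : Function.Surjective ((unitMkQ K H).rTensor M) :=
  LinearMap.rTensor_surjective M (Submodule.mkQ_surjective _)

theorem intertwines_unitMkQ :
    Intertwines (Coalgebra.comul (R := K) (A := H)) (LeftComodule.cokerUnit K H).coact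
      (unitMkQ K H) :=
  LinearMap.ext fun _ => rfl

/-- The map `x̄ ⊗ m ↦ x m₋₁ ⊗ m₀` modulo the image of the coaction. -/
def LeftComodule.ofTensor (X : LeftComodule K H M) : CokerUnit K H ⊗[K] M →ₗ[K] X.Coker :=
  TensorProduct.lift ((LinearMap.range (Algebra.linearMap K H)).liftQ
    (TensorProduct.curry ((LinearMap.range X.coact).mkQ ∘ₗ twist X.coact)) (by
      rintro _ ⟨x, rfl⟩
      rw [LinearMap.mem_ker, Algebra.linearMap_apply, Algebra.algebraMap_eq_smul_one, map_smul]
      refine (congrArg (x • ·) ?_).trans (smul_zero x)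
      refine LinearMap.ext fun m => ?_
      simp only [TensorProduct.curry_apply, LinearMap.comp_apply, twist_tmul, one_smul]
      exact (Submodule.Quotient.mk_eq_zero _).2 ⟨m, rfl⟩))

theorem LeftComodule.ofTensor_comp (X : LeftComodule K H M) :
    X.ofTensor ∘ₗ (unitMkQ K H).rTensor M =
      (LinearMap.range X.coact).mkQ ∘ₗ twist X.coact :=
  TensorProduct.ext' fun h m => by simp [LeftComodule.ofTensor]

/-- The map `[h ⊗ m] ↦ h S(m₋₁) ⊗ m₀`. -/
def LeftComodule.toTensor (X : LeftComodule K H M) : X.Coker →ₗ[K] CokerUnit K H ⊗[K] M :=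
  (LinearMap.range X.coact).liftQ ((unitMkQ K H).rTensor M ∘ₗ twistInv X.coact) (by
    rintro _ ⟨m, rfl⟩
    rw [LinearMap.mem_ker, LinearMap.comp_apply, X.twistInv_coact, LinearMap.rTensor_tmul,
      unitMkQ_one, TensorProduct.zero_tmul])

theorem LeftComodule.toTensor_comp (X : LeftComodule K H M) :
    X.toTensor ∘ₗ (LinearMap.range X.coact).mkQ = (unitMkQ K H).rTensor M ∘ₗ twistInv X.coact :=
  Submodule.liftQ_mkQ _ _ _

/-- The twist exchanges 1 ⊗ M with the image of the coaction, so it and its inverse descend to the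
quotients, where they remain inverse to each other. -/
theorem LeftComodule.toTensor_comp_ofTensor (X : LeftComodule K H M) :
    X.toTensor ∘ₗ X.ofTensor = LinearMap.id := by
  rw [← LinearMap.cancel_right (unitMkQ_rTensor_surjective (K := K) (H := H) (M := M)),
    LinearMap.comp_assoc, X.ofTensor_comp, ← LinearMap.comp_assoc, X.toTensor_comp,
    LinearMap.comp_assoc, X.twistInv_comp_twist, LinearMap.comp_id, LinearMap.id_comp]

theorem LeftComodule.ofTensor_comp_toTensor (X : LeftComodule K H M) :
    X.ofTensor ∘ₗ X.toTensor = LinearMap.id := by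
  rw [← LinearMap.cancel_right (Submodule.mkQ_surjective (LinearMap.range X.coact)),
    LinearMap.comp_assoc, X.toTensor_comp, ← LinearMap.comp_assoc, X.ofTensor_comp,
    LinearMap.comp_assoc, X.twist_comp_twistInv, LinearMap.comp_id, LinearMap.id_comp]

/-- Colinearity may be tested after the colinear surjection H ⊗ M → H̄ ⊗ M, where it is that of the
twist. -/
theorem LeftComodule.intertwines_ofTensor (X : LeftComodule K H M) :
    Intertwines (codiag (LeftComodule.cokerUnit K H).coact X.coact) X.coker.coact X.ofTensor := by
  refine (intertwines_unitMkQ.rTensor_codiag X.coact).of_comp_right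
    unitMkQ_rTensor_surjective ?_
  rw [X.ofTensor_comp]
  exact (LeftComodule.intertwines_mkQ _ _ _).comp X.intertwines_twist

theorem LeftComodule.rIntertwines_ofTensor {C : Type*} [AddCommGroup C] [Module K C]
    {X : LeftComodule K H M} {R : M →ₗ[K] M ⊗[K] C}
    (h : (TensorProduct.assoc K H M C).toLinearMap ∘ₗ X.coact.rTensor C ∘ₗ R =
      R.lTensor H ∘ₗ X.coact) {S : X.Coker →ₗ[K] X.Coker ⊗[K] C}
    (hS : RIntertwines (lTensorRCoact H R) S (LinearMap.range X.coact).mkQ) :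
    RIntertwines (lTensorRCoact (CokerUnit K H) R) S X.ofTensor := by
  refine (rIntertwines_rTensor_lTensorRCoact (unitMkQ K H)).of_comp_right
    unitMkQ_rTensor_surjective ?_
  rw [X.ofTensor_comp]
  exact hS.comp (rIntertwines_twist h)

theorem LeftComodule.equivariant_ofTensor {X : LeftComodule K H M} {A : RightModule K H M}
    (h : A.IsLinear ((RightModule.regular K H).diag A) X.coact)
    {b : X.Coker ⊗[K] H →ₗ[K] X.Coker}
    (hb : Equivariant ((RightModule.regular K H).diag A).act b (LinearMap.range X.coact).mkQ) :
    Equivariant (lTensorAct (CokerUnit K H) A.act) b X.ofTensor := by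
  refine (equivariant_rTensor (unitMkQ K H)).of_comp_right
    unitMkQ_rTensor_surjective ?_
  rw [X.ofTensor_comp]
  exact hb.comp (equivariant_twist h)

/-- The embedding of the cokernel of a coaction into the cofree comodule `H ⊗ (H̄ ⊗ M)`. -/
def LeftComodule.cokerEmb (X : LeftComodule K H M) :
    X.Coker →ₗ[K] H ⊗[K] (CokerUnit K H ⊗[K] M) :=
  twist (X.tensorLeft (CokerUnit K H)).coact ∘ₗ
    (TensorProduct.assoc K H (CokerUnit K H) M).toLinearMap ∘ₗ
      (LeftComodule.cokerUnit K H).coact.rTensor M ∘ₗ X.toTensor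

/-- The retraction of the embedding `cokerEmb` defined by an fs-retraction. -/
def LeftComodule.cokerRetr (X : LeftComodule K H M)
    (χ : H ⊗[K] CokerUnit K H →ₗ[K] CokerUnit K H) :
    H ⊗[K] (CokerUnit K H ⊗[K] M) →ₗ[K] X.Coker :=
  X.ofTensor ∘ₗ χ.rTensor M ∘ₗ (TensorProduct.assoc K H (CokerUnit K H) M).symm.toLinearMap ∘ₗ
    twistInv (X.tensorLeft (CokerUnit K H)).coact

/-- Both maps are made of mutually inverse isomorphisms around the coaction of H̄ and around χ, each
tensored with M; the splitting of the coaction by χ is all that is needed. -/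
theorem LeftComodule.cokerRetr_comp_cokerEmb (X : LeftComodule K H M)
    {χ : H ⊗[K] CokerUnit K H →ₗ[K] CokerUnit K H}
    (h : χ ∘ₗ (LeftComodule.cokerUnit K H).coact = LinearMap.id) :
    X.cokerRetr χ ∘ₗ X.cokerEmb = LinearMap.id := by
  refine LinearMap.ext fun t => ?_
  have h1 := LinearMap.congr_fun (X.tensorLeft (CokerUnit K H)).twistInv_comp_twist
  have h2 := congrArg (LinearMap.rTensor M) h
  rw [LinearMap.rTensor_comp, LinearMap.rTensor_id] at h2
  simp only [LinearMap.comp_apply, LinearMap.id_apply] at h1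
  simp only [LeftComodule.cokerRetr, LeftComodule.cokerEmb, LinearMap.comp_apply, h1,
    LinearEquiv.coe_coe, LinearEquiv.symm_apply_apply]
  rw [← LinearMap.comp_apply (χ.rTensor M), h2]
  exact LinearMap.congr_fun X.ofTensor_comp_toTensor t

/-- The path is Coker ρ ≅ H̄ ⊗ M → (H ⊗ H̄) ⊗ M ≅ H ⊗ (H̄ ⊗ M), codiagonal until the final twist
makes the coaction cofree. -/
theorem LeftComodule.intertwines_cokerEmb (X : LeftComodule K H M) :
    Intertwines X.coker.coact (cofreeCoact K H (CokerUnit K H ⊗[K] M)) X.cokerEmb :=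
  (X.tensorLeft (CokerUnit K H)).intertwines_twist.comp
    (X.intertwines_assoc_codiag.comp
      (((LeftComodule.cokerUnit K H).intertwines_coact.rTensor_codiag X.coact).comp
        (X.intertwines_ofTensor.inv X.ofTensor_comp_toTensor X.toTensor_comp_ofTensor)))

theorem LeftComodule.intertwines_cokerRetr (X : LeftComodule K H M)
    {χ : H ⊗[K] CokerUnit K H →ₗ[K] CokerUnit K H}
    (h : Intertwines (cofreeCoact K H (CokerUnit K H)) (LeftComodule.cokerUnit K H).coact χ) :
    Intertwines (cofreeCoact K H (CokerUnit K H ⊗[K] M)) X.coker.coact (X.cokerRetr χ) :=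
  X.intertwines_ofTensor.comp ((h.rTensor_codiag X.coact).comp
    ((X.intertwines_assoc_codiag.inv (LinearEquiv.comp_symm _) (LinearEquiv.symm_comp _)).comp
      ((X.tensorLeft (CokerUnit K H)).intertwines_twist.inv
        (X.tensorLeft (CokerUnit K H)).twist_comp_twistInv
        (X.tensorLeft (CokerUnit K H)).twistInv_comp_twist)))

section

variable {X : LeftComodule K H M}
  {R : M →ₗ[K] M ⊗[K] H} {S : X.Coker →ₗ[K] X.Coker ⊗[K] H}

theorem LeftComodule.rIntertwines_cokerEmb
    (h : (TensorProduct.assoc K H M H).toLinearMap ∘ₗ X.coact.rTensor H ∘ₗ R =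
      R.lTensor H ∘ₗ X.coact)
    (hS : RIntertwines (lTensorRCoact H R) S (LinearMap.range X.coact).mkQ) :
    RIntertwines S (lTensorRCoact H (lTensorRCoact (CokerUnit K H) R)) X.cokerEmb :=
  (rIntertwines_twist (LeftComodule.tensorLeft_compat h _)).comp
    (rIntertwines_assoc.comp ((rIntertwines_rTensor_lTensorRCoact _).comp
        ((LeftComodule.rIntertwines_ofTensor h hS).inv X.ofTensor_comp_toTensor
          X.toTensor_comp_ofTensor)))

/-- Any linear χ will do: the right coaction sits on M alone and commutes with χ ⊗ M. The same
reason makes the retraction equivariant below. -/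
theorem LeftComodule.rIntertwines_cokerRetr
    (h : (TensorProduct.assoc K H M H).toLinearMap ∘ₗ X.coact.rTensor H ∘ₗ R =
      R.lTensor H ∘ₗ X.coact)
    (hS : RIntertwines (lTensorRCoact H R) S (LinearMap.range X.coact).mkQ)
    (χ : H ⊗[K] CokerUnit K H →ₗ[K] CokerUnit K H) :
    RIntertwines (lTensorRCoact H (lTensorRCoact (CokerUnit K H) R)) S (X.cokerRetr χ) :=
  (LeftComodule.rIntertwines_ofTensor h hS).comp
    ((rIntertwines_rTensor_lTensorRCoact _).comp
      ((rIntertwines_assoc.inv (LinearEquiv.comp_symm _) (LinearEquiv.symm_comp _)).comp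
        ((rIntertwines_twist (LeftComodule.tensorLeft_compat h _)).inv
          (X.tensorLeft (CokerUnit K H)).twist_comp_twistInv
          (X.tensorLeft (CokerUnit K H)).twistInv_comp_twist)))

variable {A : RightModule K H M} {b : X.Coker ⊗[K] H →ₗ[K] X.Coker}

theorem LeftComodule.equivariant_cokerEmb
    (h : A.IsLinear ((RightModule.regular K H).diag A) X.coact)
    (hb : Equivariant ((RightModule.regular K H).diag A).act b (LinearMap.range X.coact).mkQ) :
    Equivariant b ((RightModule.regular K H).diag
      ((RightModule.trivial K H (CokerUnit K H)).diag A)).act X.cokerEmb := by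
  have h1 := equivariant_twist (LeftComodule.tensorLeft_isLinear h (CokerUnit K H))
  rw [RightModule.trivial_diag_act] at h1
  exact h1.comp (equivariant_assoc.comp ((equivariant_rTensor _).comp
    ((LeftComodule.equivariant_ofTensor h hb).inv X.ofTensor_comp_toTensor
      X.toTensor_comp_ofTensor)))

theorem LeftComodule.equivariant_cokerRetr
    (h : A.IsLinear ((RightModule.regular K H).diag A) X.coact)
    (hb : Equivariant ((RightModule.regular K H).diag A).act b (LinearMap.range X.coact).mkQ)
    (χ : H ⊗[K] CokerUnit K H →ₗ[K] CokerUnit K H) :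
    Equivariant ((RightModule.regular K H).diag
      ((RightModule.trivial K H (CokerUnit K H)).diag A)).act b (X.cokerRetr χ) := by
  have h1 := equivariant_twist (LeftComodule.tensorLeft_isLinear h (CokerUnit K H))
  rw [RightModule.trivial_diag_act] at h1
  exact (LeftComodule.equivariant_ofTensor h hb).comp ((equivariant_rTensor _).comp
    ((equivariant_assoc.inv (LinearEquiv.comp_symm _) (LinearEquiv.symm_comp _)).comp
      (h1.inv (X.tensorLeft (CokerUnit K H)).twist_comp_twistInv
          (X.tensorLeft (CokerUnit K H)).twistInv_comp_twist)))

end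

/-- fs-retractions are the colinear retractions of the coaction of `H̄`. -/
theorem isFsRetraction_iff {χ : H ⊗[K] CokerUnit K H →ₗ[K] CokerUnit K H} :
    IsFsRetraction χ ↔ Intertwines (cofreeCoact K H (CokerUnit K H))
        (LeftComodule.cokerUnit K H).coact χ ∧
      χ ∘ₗ (LeftComodule.cokerUnit K H).coact = LinearMap.id :=
  ⟨fun h => ⟨TensorProduct.ext' h.1, LinearMap.ext h.2⟩,
    fun h => ⟨fun x y => h.1.apply (x ⊗ₜ y), LinearMap.congr_fun h.2⟩⟩

theorem isInjective_cokerUnit_iff :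
    (LeftComodule.cokerUnit K H).IsInjective ↔
      ∃ χ : H ⊗[K] CokerUnit K H →ₗ[K] CokerUnit K H, IsFsRetraction χ := by
  rw [LeftComodule.isInjective_iff_exists_retraction]
  exact exists_congr fun χ => isFsRetraction_iff.symm

/-- If `H` has an fs-retraction then the cokernel of every coaction is injective. -/
theorem IsFsRetraction.isInjective_coker {χ : H ⊗[K] CokerUnit K H →ₗ[K] CokerUnit K H}
    (h : IsFsRetraction χ) (X : LeftComodule K H M) : X.coker.IsInjective := by
  rw [isFsRetraction_iff] at h
  exact LeftComodule.isInjective_cofree.retract X.intertwines_cokerEmb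
    (X.intertwines_cokerRetr h.1) (X.cokerRetr_comp_cokerEmb h.2)

end CokerTensor

/-! ### Cofree bicomodules and relative injectivity. -/

section Cofree

variable {K : Type u} {C : Type v} [Field K] [AddCommGroup C] [Module K C] [Coalgebra K C]
variable {M N W : Type v} [AddCommGroup M] [Module K M] [AddCommGroup N] [Module K N]
  [AddCommGroup W] [Module K W]

/-- The bicomodule `M ⊗ N` for a left comodule `M` and a right comodule `N`. -/
def Bicomodule.tensor (X : LeftComodule K C M) (Y : RightComodule K C N) :
    Bicomodule K C (M ⊗[K] N) where
  left := X.tensorRight N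
  right := Y.tensorLeft M
  compat := by
    refine TensorProduct.ext' fun m n => ?_
    have key : ∀ t : N ⊗[K] C, TensorProduct.assoc K C (M ⊗[K] N) C
        ((X.tensorRight N).coact.rTensor C ((TensorProduct.assoc K M N C).symm (m ⊗ₜ t))) =
        (TensorProduct.assoc K M N C).symm.toLinearMap.lTensor C
          (TensorProduct.assoc K C M (N ⊗[K] C) (X.coact m ⊗ₜ t)) := by
      intro t
      induction t with
      | zero => simp
      | add x y hx hy => simp only [TensorProduct.tmul_add, map_add, hx, hy]
      | tmul n c =>
        simp only [TensorProduct.assoc_symm_tmul, LinearMap.rTensor_tmul,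
          LeftComodule.tensorRight, LinearMap.comp_apply, LinearEquiv.coe_coe]
        generalize X.coact m = s
        induction s with
        | zero => simp
        | add x y hx hy => simp only [TensorProduct.add_tmul, map_add, hx, hy]
        | tmul a b => simp
    have key2 : ∀ s : C ⊗[K] M, (Y.tensorLeft M).coact.lTensor C
        (TensorProduct.assoc K C M N (s ⊗ₜ n)) =
        (TensorProduct.assoc K M N C).symm.toLinearMap.lTensor C
          (TensorProduct.assoc K C M (N ⊗[K] C) (s ⊗ₜ Y.coact n)) := by
      intro s
      induction s with
      | zero => simp
      | add x y hx hy => simp only [TensorProduct.add_tmul, map_add, hx, hy]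
      | tmul a b => simp [RightComodule.tensorLeft]
    exact (key _).trans (key2 _).symm

/-- The cofree bicomodule `C ⊗ (W ⊗ C)`. -/
def Bicomodule.cofree (K : Type u) (C : Type v) [Field K] [AddCommGroup C] [Module K C]
    [Coalgebra K C] (W : Type v) [AddCommGroup W] [Module K W] :
    Bicomodule K C (C ⊗[K] (W ⊗[K] C)) :=
  Bicomodule.tensor (LeftComodule.regular K C) ((RightComodule.regular K C).tensorLeft W)

/-- The map `m ↦ m₋₁ ⊗ (m₀ ⊗ m₁)`. -/
def Bicomodule.coact (X : Bicomodule K C M) : M →ₗ[K] C ⊗[K] (M ⊗[K] C) :=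
  X.right.coact.lTensor C ∘ₗ X.left.coact

theorem Bicomodule.isBicolinear_coact (X : Bicomodule K C M) :
    X.IsBicolinear (Bicomodule.cofree K C M) X.coact := by
  refine ⟨(intertwines_lTensor _).comp X.left.intertwines_coact, ?_⟩
  have h : X.coact = (TensorProduct.assoc K C M C).toLinearMap ∘ₗ X.left.coact.rTensor C ∘ₗ
    X.right.coact := X.compat.symm
  rw [h]
  exact rIntertwines_assoc.comp
    ((rIntertwines_rTensor _).comp X.right.rIntertwines_coact)

theorem Bicomodule.isBicolinear_map (f : M →ₗ[K] N) :
    (Bicomodule.cofree K C M).IsBicolinear (Bicomodule.cofree K C N)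
      ((f.rTensor C).lTensor C) :=
  ⟨intertwines_lTensor _, rIntertwines_lTensor_lTensorRCoact (rIntertwines_rTensor f)⟩

theorem Bicomodule.IsBicolinear.comp {P : Type v} [AddCommGroup P] [Module K P]
    {X : Bicomodule K C M} {Y : Bicomodule K C N} {Z : Bicomodule K C P} {g : N →ₗ[K] P}
    {f : M →ₗ[K] N} (hg : Y.IsBicolinear Z g) (hf : X.IsBicolinear Y f) :
    X.IsBicolinear Z (g ∘ₗ f) :=
  ⟨Intertwines.comp hg.1 hf.1, RIntertwines.comp hg.2 hf.2⟩

/-- The projection `ε ⊗ (W ⊗ ε)` of the cofree bicomodule. -/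
def cofreeCounit (K : Type u) (C : Type v) [Field K] [AddCommGroup C] [Module K C]
    [Coalgebra K C] (W : Type v) [AddCommGroup W] [Module K W] : C ⊗[K] (W ⊗[K] C) →ₗ[K] W :=
  counitR K C W ∘ₗ counitL K C (W ⊗[K] C)

theorem rIntertwines_counitL {R : W →ₗ[K] W ⊗[K] C} :
    RIntertwines (lTensorRCoact C R) R (counitL K C W) := by
  refine TensorProduct.ext' fun c x => ?_
  simp only [LinearMap.comp_apply, LinearMap.lTensor_tmul, LinearEquiv.coe_coe, counitL_tmul,
    map_smul]
  generalize R x = s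
  induction s with
  | zero => simp
  | add x y hx hy => simp only [TensorProduct.tmul_add, map_add, smul_add, hx, hy]
  | tmul a b => simp [TensorProduct.smul_tmul']

/-- Apply the universal property of cofree comodules on the left, then on the right: a bicolinear
map is recovered from its composite with ε ⊗ W ⊗ ε. -/
theorem Bicomodule.eq_of_isBicolinear_cofree {X : Bicomodule K C M}
    {F : M →ₗ[K] C ⊗[K] (W ⊗[K] C)} (hF : X.IsBicolinear (Bicomodule.cofree K C W) F) :
    F = ((cofreeCounit K C W ∘ₗ F).rTensor C).lTensor C ∘ₗ X.coact := by
  have h1 := eq_of_intertwines_cofree hF.1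
  have h2 : RIntertwines X.right.coact (cofreeRCoact K C W) (counitL K C (W ⊗[K] C) ∘ₗ F) :=
    RIntertwines.comp rIntertwines_counitL hF.2
  have h3 := eq_of_rIntertwines_cofree h2
  conv_lhs => rw [h1, h3]
  rw [LinearMap.lTensor_comp, LinearMap.comp_assoc]
  rfl

/-- This is the linear retraction that makes the two-sided coaction an admissible embedding into a
cofree bicomodule. -/
theorem cofreeCounit_comp_coact (X : Bicomodule K C M) :
    cofreeCounit K C M ∘ₗ X.coact = LinearMap.id := by
  refine LinearMap.ext fun m => ?_
  have key : ∀ t : C ⊗[K] M, cofreeCounit K C M (X.right.coact.lTensor C t) = counitL K C M t := by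
    intro t
    induction t with
    | zero => simp
    | add x y hx hy => simp only [map_add, hx, hy]
    | tmul c m => simp [cofreeCounit]
  exact (key _).trans (X.left.counitL_coact m)

/-- The linear map attached to F extends along i through r; the bicolinear map attached to the
extension restricts to the one attached to F, which is F. This is relative injectivity of cofree
bicomodules. -/
theorem Bicomodule.extend_comp {X : Bicomodule K C M} {Y : Bicomodule K C N} {i : M →ₗ[K] N}
    (hi : X.IsBicolinear Y i) {r : N →ₗ[K] M} (hr : r ∘ₗ i = LinearMap.id)
    {F : M →ₗ[K] C ⊗[K] (W ⊗[K] C)} (hF : X.IsBicolinear (Bicomodule.cofree K C W) F) :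
    ((((cofreeCounit K C W ∘ₗ F) ∘ₗ r).rTensor C).lTensor C ∘ₗ Y.coact) ∘ₗ i = F := by
  have h1 : Y.coact ∘ₗ i = (i.rTensor C).lTensor C ∘ₗ X.coact := by
    rw [Bicomodule.coact, LinearMap.comp_assoc, hi.1, ← LinearMap.comp_assoc,
      ← LinearMap.lTensor_comp, hi.2, LinearMap.lTensor_comp, LinearMap.comp_assoc]
    rfl
  conv_rhs => rw [Bicomodule.eq_of_isBicolinear_cofree hF]
  rw [LinearMap.comp_assoc, h1, ← LinearMap.comp_assoc, ← LinearMap.lTensor_comp,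
    ← LinearMap.rTensor_comp, LinearMap.comp_assoc i r, hr, LinearMap.comp_id]

/-- Retracts of cofree bicomodules are relatively injective. -/
theorem Bicomodule.isRelInjective_of_retract {Z : Bicomodule K C N}
    {ι : N →ₗ[K] C ⊗[K] (W ⊗[K] C)} {π : C ⊗[K] (W ⊗[K] C) →ₗ[K] N}
    (hι : Z.IsBicolinear (Bicomodule.cofree K C W) ι)
    (hπ : (Bicomodule.cofree K C W).IsBicolinear Z π) (h : π ∘ₗ ι = LinearMap.id) :
    Z.IsRelInjective := by
  rintro A B _ _ _ _ X Y i f hi ⟨r, hr⟩ hf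
  refine ⟨π ∘ₗ ((((cofreeCounit K C W ∘ₗ ι ∘ₗ f) ∘ₗ r).rTensor C).lTensor C ∘ₗ Y.coact),
    hπ.comp ((Bicomodule.isBicolinear_map _).comp Y.isBicolinear_coact), ?_⟩
  rw [LinearMap.comp_assoc, Bicomodule.extend_comp hi hr (hι.comp hf), ← LinearMap.comp_assoc, h,
    LinearMap.id_comp]

theorem Bicomodule.IsRelInjective.exists_retraction {Z : Bicomodule K C N}
    (h : Z.IsRelInjective) : ∃ π : C ⊗[K] (N ⊗[K] C) →ₗ[K] N,
      (Bicomodule.cofree K C N).IsBicolinear Z π ∧ π ∘ₗ Z.coact = LinearMap.id :=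
  h _ _ Z (Bicomodule.cofree K C N) Z.coact LinearMap.id Z.isBicolinear_coact
    ⟨_, cofreeCounit_comp_coact Z⟩ ⟨intertwines_id, rIntertwines_id⟩

end Cofree

/-! ### The same for bicomodules in right `H`-modules. -/

section ModuleCofree

variable {K : Type u} {H : Type v} {C : Type v} [Field K] [Ring H]
  [Bialgebra K H] [AddCommGroup C] [Module K C] [Coalgebra K C] {A : ModuleCoalgebra K H C}
variable {M N W : Type v} [AddCommGroup M] [Module K M] [AddCommGroup N] [Module K N]
  [AddCommGroup W] [Module K W]

/-- The cofree bicomodule `C ⊗ (W ⊗ C)` in right `H`-modules, with the diagonal action. -/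
def ModuleBicomodule.cofree (A : ModuleCoalgebra K H C) (X : RightModule K H W) :
    ModuleBicomodule A (C ⊗[K] (W ⊗[K] C)) where
  module := A.module.diag (X.diag A.module)
  bicomodule := Bicomodule.cofree K C W
  left_linear := RightModule.isLinear_assoc.comp
    (A.comul_linear.map RightModule.isLinear_id)
  right_linear := RightModule.isLinear_assoc_symm.comp
    (RightModule.isLinear_id.map (RightModule.isLinear_assoc_symm.comp
      (RightModule.isLinear_id.map A.comul_linear)))

theorem ModuleBicomodule.isHom_coact (X : ModuleBicomodule A M) :
    X.IsHom (ModuleBicomodule.cofree A X.module) X.bicomodule.coact :=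
  ⟨(RightModule.isLinear_id.map X.right_linear).comp X.left_linear,
    X.bicomodule.isBicolinear_coact⟩

theorem ModuleBicomodule.IsHom.comp {P : Type v} [AddCommGroup P] [Module K P]
    {X : ModuleBicomodule A M} {Y : ModuleBicomodule A N} {Z : ModuleBicomodule A P}
    {g : N →ₗ[K] P} {f : M →ₗ[K] N} (hg : Y.IsHom Z g) (hf : X.IsHom Y f) :
    X.IsHom Z (g ∘ₗ f) :=
  ⟨hg.1.comp hf.1, hg.2.comp hf.2⟩

/-- The counit of C is H-linear and ε(h₁)h₂ = h, so the diagonal action collapses to the one on W.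
-/
theorem isLinear_counitL (A : ModuleCoalgebra K H C) (X : RightModule K H W) :
    (A.module.diag X).IsLinear X (counitL K C W) := by
  rw [RightModule.isLinear_iff]
  intro t h
  induction t with
  | zero => simp
  | add x y hx hy => simp only [TensorProduct.add_tmul, map_add, hx, hy]
  | tmul c x =>
    have key : ∀ s : H ⊗[K] H, counitL K C W (A.module.act₂ X ((c ⊗ₜ x) ⊗ₜ s)) =
        X.act ((Coalgebra.counit (R := K) c • x) ⊗ₜ counitL K H H s) := by
      intro s
      induction s with
      | zero => simp
      | add x y hx hy => simp only [TensorProduct.tmul_add, map_add, hx, hy]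
      | tmul a b =>
        simp only [RightModule.act₂_tmul, counitL_tmul, A.counit_linear,
          ← TensorProduct.smul_tmul', map_smul, TensorProduct.tmul_smul, smul_smul, mul_comm]
    refine (key _).trans ?_
    rw [counitL_tmul]
    exact congrArg (fun z => X.act (_ ⊗ₜ z)) ((LeftComodule.regular K H).counitL_coact h)

theorem isLinear_counitR (A : ModuleCoalgebra K H C) (X : RightModule K H W) :
    (X.diag A.module).IsLinear X (counitR K C W) := by
  rw [RightModule.isLinear_iff]
  intro t h
  induction t with
  | zero => simp
  | add x y hx hy => simp only [TensorProduct.add_tmul, map_add, hx, hy]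
  | tmul x c =>
    have key : ∀ s : H ⊗[K] H, counitR K C W (X.act₂ A.module ((x ⊗ₜ c) ⊗ₜ s)) =
        X.act ((Coalgebra.counit (R := K) c • x) ⊗ₜ counitR K H H s) := by
      intro s
      induction s with
      | zero => simp
      | add x y hx hy => simp only [TensorProduct.tmul_add, map_add, hx, hy]
      | tmul a b =>
        simp only [RightModule.act₂_tmul, counitR_tmul, A.counit_linear,
          ← TensorProduct.smul_tmul', map_smul, TensorProduct.tmul_smul, smul_smul, mul_comm]
    refine (key _).trans ?_
    rw [counitR_tmul]
    exact congrArg (fun z => X.act (_ ⊗ₜ z)) ((RightComodule.regular K H).counitR_coact h)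

theorem isLinear_cofreeCounit (X : RightModule K H W) :
    (ModuleBicomodule.cofree A X).module.IsLinear X (cofreeCounit K C W) :=
  (isLinear_counitR A X).comp (isLinear_counitL A (X.diag A.module))

/-- Retracts of cofree bicomodules in right `H`-modules are relatively injective. -/
theorem ModuleBicomodule.isRelInjective_of_retract {Z : ModuleBicomodule A N}
    {V : RightModule K H W}
    {ι : N →ₗ[K] C ⊗[K] (W ⊗[K] C)} {π : C ⊗[K] (W ⊗[K] C) →ₗ[K] N}
    (hι : Z.IsHom (ModuleBicomodule.cofree A V) ι)
    (hπ : (ModuleBicomodule.cofree A V).IsHom Z π) (h : π ∘ₗ ι = LinearMap.id) :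
    Z.IsRelInjective := by
  rintro P Q _ _ _ _ X Y i f hi ⟨r, hrl, hr⟩ hf
  refine ⟨π ∘ₗ ((((cofreeCounit K C W ∘ₗ ι ∘ₗ f) ∘ₗ r).rTensor C).lTensor C ∘ₗ
    Y.bicomodule.coact), hπ.comp (ModuleBicomodule.IsHom.comp (Y := .cofree A Y.module)
      ⟨?_, Bicomodule.isBicolinear_map _⟩ Y.isHom_coact), ?_⟩
  · exact RightModule.isLinear_id.map
      (((isLinear_cofreeCounit V).comp (hι.comp hf).1 |>.comp hrl).map RightModule.isLinear_id)
  · rw [LinearMap.comp_assoc, Bicomodule.extend_comp hi.2 hr (hι.comp hf).2,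
      ← LinearMap.comp_assoc, h, LinearMap.id_comp]

/-- H-linearity of π is dropped on purpose: bicolinearity alone produces an fs-retraction, so (a)
and (b) feed the same construction. -/
theorem ModuleBicomodule.IsRelInjective.exists_retraction {Z : ModuleBicomodule A N}
    (h : Z.IsRelInjective) : ∃ π : C ⊗[K] (N ⊗[K] C) →ₗ[K] N,
      (Bicomodule.cofree K C N).IsBicolinear Z.bicomodule π ∧
        π ∘ₗ Z.bicomodule.coact = LinearMap.id := by
  obtain ⟨π, hπ, h⟩ := h _ _ Z (ModuleBicomodule.cofree A Z.module) Z.bicomodule.coact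
    LinearMap.id Z.isHom_coact ⟨_, isLinear_cofreeCounit _, cofreeCounit_comp_coact _⟩
    ⟨RightModule.isLinear_id, intertwines_id, rIntertwines_id⟩
  exact ⟨π, hπ.2, h⟩

end ModuleCofree

/-! ### From an fs-retraction to formal smoothness. -/

section FormallySmooth

variable {K : Type u} {H : Type v} [Field K] [Ring H] [HopfAlgebra K H]

theorem equivariant_mkQ_range_comul :
    Equivariant ((RightModule.regular K H).diag (RightModule.regular K H)).act
      (ModuleBicomodule.cokerComul (ModuleCoalgebra.regular K H)).module.act
      (LinearMap.range (LeftComodule.regular K H).coact).mkQ :=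
  isLinear_mkQ _ _ (range_comul_act (ModuleCoalgebra.regular K H))

theorem rIntertwines_mkQ_range_comul :
    RIntertwines (lTensorRCoact H (Coalgebra.comul (R := K) (A := H)))
      (Bicomodule.cokerComul K H).right.coact
      (LinearMap.range (LeftComodule.regular K H).coact).mkQ :=
  LinearMap.ext fun _ => rfl

theorem regular_isLinear : (RightModule.regular K H).IsLinear
    ((RightModule.regular K H).diag (RightModule.regular K H))
    (LeftComodule.regular K H).coact :=
  (ModuleCoalgebra.regular K H).comul_linear

theorem regular_compat : (TensorProduct.assoc K H H H).toLinearMap ∘ₗ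
    (LeftComodule.regular K H).coact.rTensor H ∘ₗ Coalgebra.comul (R := K) (A := H) =
      (Coalgebra.comul (R := K) (A := H)).lTensor H ∘ₗ (LeftComodule.regular K H).coact :=
  Coalgebra.coassoc

theorem isLinear_cokerEmb :
    (ModuleBicomodule.cokerComul (ModuleCoalgebra.regular K H)).module.IsLinear
      ((RightModule.regular K H).diag
      ((RightModule.trivial K H (CokerUnit K H)).diag (RightModule.regular K H)))
      (LeftComodule.regular K H).cokerEmb :=
  LeftComodule.equivariant_cokerEmb regular_isLinear equivariant_mkQ_range_comul

theorem isBicolinear_cokerEmb :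
    (Bicomodule.cokerComul K H).IsBicolinear (Bicomodule.cofree K H (CokerUnit K H))
      (LeftComodule.regular K H).cokerEmb :=
  ⟨LeftComodule.intertwines_cokerEmb (LeftComodule.regular K H),
    LeftComodule.rIntertwines_cokerEmb regular_compat rIntertwines_mkQ_range_comul⟩

theorem isLinear_cokerRetr (χ : H ⊗[K] CokerUnit K H →ₗ[K] CokerUnit K H) :
    ((RightModule.regular K H).diag
      ((RightModule.trivial K H (CokerUnit K H)).diag (RightModule.regular K H))).IsLinear
      (ModuleBicomodule.cokerComul (ModuleCoalgebra.regular K H)).module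
      ((LeftComodule.regular K H).cokerRetr χ) :=
  LeftComodule.equivariant_cokerRetr regular_isLinear equivariant_mkQ_range_comul χ

theorem rIntertwines_cokerRetr_regular (χ : H ⊗[K] CokerUnit K H →ₗ[K] CokerUnit K H) :
    RIntertwines
      (lTensorRCoact H (lTensorRCoact (CokerUnit K H) (Coalgebra.comul (R := K) (A := H))))
      (Bicomodule.cokerComul K H).right.coact ((LeftComodule.regular K H).cokerRetr χ) :=
  LeftComodule.rIntertwines_cokerRetr (X := LeftComodule.regular K H)
    (R := Coalgebra.comul (R := K) (A := H)) regular_compat rIntertwines_mkQ_range_comul χ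

theorem IsFsRetraction.isBicolinear_cokerRetr
    {χ : H ⊗[K] CokerUnit K H →ₗ[K] CokerUnit K H} (h : IsFsRetraction χ) :
    (Bicomodule.cofree K H (CokerUnit K H)).IsBicolinear (Bicomodule.cokerComul K H)
      ((LeftComodule.regular K H).cokerRetr χ) :=
  ⟨LeftComodule.intertwines_cokerRetr (LeftComodule.regular K H) (isFsRetraction_iff.1 h).1,
    rIntertwines_cokerRetr_regular χ⟩

/-- With H̄ a trivial module, the retract of the case M = H respects the actions as well as both
coactions. -/
theorem IsFsRetraction.isFormallySmooth_module
    {χ : H ⊗[K] CokerUnit K H →ₗ[K] CokerUnit K H} (h : IsFsRetraction χ) :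
    (ModuleCoalgebra.regular K H).IsFormallySmooth :=
  ModuleBicomodule.isRelInjective_of_retract
    (V := RightModule.trivial K H (CokerUnit K H)) ⟨isLinear_cokerEmb, isBicolinear_cokerEmb⟩
    ⟨isLinear_cokerRetr χ, h.isBicolinear_cokerRetr⟩
    (LeftComodule.cokerRetr_comp_cokerEmb _ (isFsRetraction_iff.1 h).2)

theorem IsFsRetraction.isFormallySmooth
    {χ : H ⊗[K] CokerUnit K H →ₗ[K] CokerUnit K H} (h : IsFsRetraction χ) :
    IsFormallySmooth K H :=
  Bicomodule.isRelInjective_of_retract isBicolinear_cokerEmb h.isBicolinear_cokerRetr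
    (LeftComodule.cokerRetr_comp_cokerEmb _ (isFsRetraction_iff.1 h).2)

end FormallySmooth

/-! ### From formal smoothness to an fs-retraction, by taking right coinvariants. -/

section FsRetractionOfSmooth

variable {K : Type u} {H : Type v} [Field K] [Ring H] [HopfAlgebra K H]

/-- The map `x̄ ↦ [x ⊗ 1]` from `H̄` to `Coker Δ`. -/
def tensorOne (K : Type u) (H : Type v) [Field K] [Ring H] [HopfAlgebra K H] :
    CokerUnit K H →ₗ[K] CokerComul K H :=
  (LeftComodule.regular K H).ofTensor ∘ₗ (TensorProduct.mk K (CokerUnit K H) H).flip 1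

/-- The map `[a ⊗ b] ↦ a S(b)` modulo scalars, from `Coker Δ` to `H̄`. -/
def mulAntipode (K : Type u) (H : Type v) [Field K] [Ring H] [HopfAlgebra K H] :
    CokerComul K H →ₗ[K] CokerUnit K H :=
  counitR K H (CokerUnit K H) ∘ₗ (LeftComodule.regular K H).toTensor

theorem mulAntipode_tensorOne (x : CokerUnit K H) :
    mulAntipode K H (tensorOne K H x) = x := by
  have h := LinearMap.congr_fun (LeftComodule.regular K H).toTensor_comp_ofTensor (x ⊗ₜ 1)
  refine (congrArg (counitR K H (CokerUnit K H)) h).trans ?_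
  simp

/-- As 1 is grouplike, the codiagonal coaction of x̄ ⊗ 1 is x₁ ⊗ (x̄₂ ⊗ 1). -/
theorem intertwines_tensorOne : Intertwines (LeftComodule.cokerUnit K H).coact
    (Bicomodule.cokerComul K H).left.coact (tensorOne K H) := by
  refine (LeftComodule.regular K H).intertwines_ofTensor.comp (LinearMap.ext fun x => ?_)
  simp only [codiag, LinearMap.comp_apply, LinearMap.flip_apply, TensorProduct.mk_apply,
    TensorProduct.map_tmul, LinearEquiv.coe_coe]
  rw [show (LeftComodule.regular K H).coact 1 = (1 : H) ⊗ₜ[K] (1 : H) from Bialgebra.comul_one]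
  generalize (LeftComodule.cokerUnit K H).coact x = s
  induction s with
  | zero => simp
  | add x y hx hy => simp only [TensorProduct.add_tmul, map_add, hx, hy]
  | tmul a b => simp

theorem rIntertwines_ofTensor_regular :
    RIntertwines (cofreeRCoact K H (CokerUnit K H)) (Bicomodule.cokerComul K H).right.coact
      (LeftComodule.regular K H).ofTensor :=
  LeftComodule.rIntertwines_ofTensor (X := LeftComodule.regular K H)
    (R := Coalgebra.comul (R := K) (A := H)) regular_compat rIntertwines_mkQ_range_comul

theorem right_coact_tensorOne (x : CokerUnit K H) :
    (Bicomodule.cokerComul K H).right.coact (tensorOne K H x) = tensorOne K H x ⊗ₜ 1 := by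
  refine (rIntertwines_ofTensor_regular.apply (x ⊗ₜ 1)).trans ?_
  simp only [LinearMap.comp_apply, LinearMap.lTensor_tmul, Bialgebra.comul_one,
    Algebra.TensorProduct.one_def, LinearEquiv.coe_coe, TensorProduct.assoc_symm_tmul]
  rfl

/-- The coinvariants of the right comodule `Coker Δ` are the classes of `x ⊗ 1`. -/
theorem tensorOne_mulAntipode {t : CokerComul K H}
    (ht : (Bicomodule.cokerComul K H).right.coact t = t ⊗ₜ 1) :
    tensorOne K H (mulAntipode K H t) = t := by
  have hq : RIntertwines (Bicomodule.cokerComul K H).right.coact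
      (cofreeRCoact K H (CokerUnit K H)) (LeftComodule.regular K H).toTensor :=
    rIntertwines_ofTensor_regular.inv (LeftComodule.regular K H).ofTensor_comp_toTensor
      (LeftComodule.regular K H).toTensor_comp_ofTensor
  have h1 : cofreeRCoact K H (CokerUnit K H) ((LeftComodule.regular K H).toTensor t) =
      (LeftComodule.regular K H).toTensor t ⊗ₜ 1 :=
    (hq.apply t).trans (congrArg ((LeftComodule.regular K H).toTensor.rTensor H) ht)
  -- Under Coker Δ ≅ H̄ ⊗ H a coinvariant becomes some y with (H̄ ⊗ Δ)(y) = y ⊗ 1; applying ε to the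
  -- middle factor gives y = (H̄ ⊗ ε)(y) ⊗ 1.
  have h2 := LinearMap.congr_fun (eq_of_rIntertwines_cofree (V := CokerUnit K H)
    (rIntertwines_id (ρ := cofreeRCoact K H (CokerUnit K H))))
    ((LeftComodule.regular K H).toTensor t)
  rw [LinearMap.comp_id, LinearMap.id_apply, LinearMap.comp_apply, h1,
    LinearMap.rTensor_tmul] at h2
  refine (congrArg (LeftComodule.regular K H).ofTensor h2.symm).trans ?_
  exact LinearMap.congr_fun (LeftComodule.regular K H).ofTensor_comp_toTensor t

/-- A bicolinear retraction of the coaction of `Coker Δ` induces an fs-retraction. -/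
theorem exists_isFsRetraction {π : H ⊗[K] (CokerComul K H ⊗[K] H) →ₗ[K] CokerComul K H}
    (hπ : (Bicomodule.cofree K H (CokerComul K H)).IsBicolinear (Bicomodule.cokerComul K H) π)
    (h : π ∘ₗ (Bicomodule.cokerComul K H).coact = LinearMap.id) :
    ∃ χ : H ⊗[K] CokerUnit K H →ₗ[K] CokerUnit K H, IsFsRetraction χ := by
  let g : CokerUnit K H →ₗ[K] CokerComul K H ⊗[K] H :=
    (TensorProduct.mk K (CokerComul K H) H).flip 1 ∘ₗ tensorOne K H
  -- That is, ψ(a ⊗ x̄) = π(a ⊗ [x ⊗ 1] ⊗ 1).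
  let ψ : H ⊗[K] CokerUnit K H →ₗ[K] CokerComul K H := π ∘ₗ g.lTensor H
  have hψ : Intertwines (cofreeCoact K H (CokerUnit K H))
      (Bicomodule.cokerComul K H).left.coact ψ :=
    Intertwines.comp hπ.1 (intertwines_lTensor g)
  -- The right coaction of the cofree bicomodule sees only its last factor, here 1, so the right
  -- colinear π takes coinvariant values.
  have hco : ∀ t : H ⊗[K] CokerUnit K H,
      (Bicomodule.cokerComul K H).right.coact (ψ t) = ψ t ⊗ₜ 1 := by
    intro t
    induction t with
    | zero => simp
    | add x y hx hy => simp only [map_add, hx, hy, TensorProduct.add_tmul]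
    | tmul a x =>
      refine (RIntertwines.apply hπ.2 (a ⊗ₜ g x)).trans ?_
      simp only [Bicomodule.cofree, Bicomodule.tensor, RightComodule.tensorLeft,
        RightComodule.regular, g, LinearMap.comp_apply, LinearMap.lTensor_tmul,
        LinearMap.flip_apply, TensorProduct.mk_apply, Bialgebra.comul_one,
        Algebra.TensorProduct.one_def, LinearEquiv.coe_coe, TensorProduct.assoc_symm_tmul,
        LinearMap.rTensor_tmul, ψ]
  refine ⟨mulAntipode K H ∘ₗ ψ, isFsRetraction_iff.2 ⟨LinearMap.ext fun t => ?_,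
    LinearMap.ext fun x => ?_⟩⟩
  -- By coinvariance `tensorOne` recovers ψ(t) from its image in H̄, so left colinearity of ψ passes
  -- to χ after applying the left inverse `mulAntipode`.
  · have h1 := intertwines_tensorOne.apply (mulAntipode K H (ψ t))
    rw [tensorOne_mulAntipode (hco t), hψ.apply] at h1
    have h2 := congrArg ((mulAntipode K H).lTensor H) h1
    rw [← LinearMap.comp_apply, ← LinearMap.lTensor_comp,
      ← LinearMap.comp_apply (LinearMap.lTensor H (mulAntipode K H)) (LinearMap.lTensor H _),
      ← LinearMap.lTensor_comp, show mulAntipode K H ∘ₗ tensorOne K H = LinearMap.id from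
        LinearMap.ext mulAntipode_tensorOne, LinearMap.lTensor_id] at h2
    exact h2.symm
  -- The two-sided coaction of [x ⊗ 1] is x₁ ⊗ [x₂ ⊗ 1] ⊗ 1, so ψ(x₁ ⊗ x̄₂) is π of the coaction of
  -- [x ⊗ 1], namely [x ⊗ 1].
  · have h1 : (Bicomodule.cokerComul K H).right.coact ∘ₗ tensorOne K H = g :=
      LinearMap.ext right_coact_tensorOne
    have h2 := LinearMap.congr_fun h (tensorOne K H x)
    rw [LinearMap.comp_apply, Bicomodule.coact, LinearMap.comp_apply,
      intertwines_tensorOne.apply, ← LinearMap.comp_apply (LinearMap.lTensor H _),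
      ← LinearMap.lTensor_comp, h1] at h2
    exact (congrArg (mulAntipode K H) h2).trans (mulAntipode_tensorOne x)

end FsRetractionOfSmooth

/-! ### Hereditariness from injectivity of the cokernels of coactions. -/

section Hereditary

variable {K : Type u} {C : Type v} [Field K] [AddCommGroup C] [Module K C]

theorem lTensor_subtype_injective {M : Type v} [AddCommGroup M] [Module K M]
    (S : Submodule K M) : Function.Injective (S.subtype.lTensor C) :=
  Module.Flat.lTensor_preserves_injective_linearMap _ S.injective_subtype

variable [Coalgebra K C]

/-- The subcomodule structure on a subspace `S` with `ρ(S) ⊆ C ⊗ S`. -/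
theorem LeftComodule.exists_sub {M : Type v} [AddCommGroup M] [Module K M]
    (X : LeftComodule K C M) (S : Submodule K M)
    (hS : ∀ m ∈ S, X.coact m ∈ LinearMap.range (S.subtype.lTensor C)) :
    ∃ Y : LeftComodule K C S, Y.IsColinear X S.subtype := by
  let ρ : S →ₗ[K] C ⊗[K] S :=
    (LinearEquiv.ofInjective (S.subtype.lTensor C) (lTensor_subtype_injective S)).symm.toLinearMap ∘ₗ
      (X.coact ∘ₗ S.subtype).codRestrict _ fun m => hS m m.2
  have hρ : X.coact ∘ₗ S.subtype = S.subtype.lTensor C ∘ₗ ρ := LinearMap.ext fun m =>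
    (congrArg Subtype.val (LinearEquiv.apply_symm_apply
      (LinearEquiv.ofInjective (S.subtype.lTensor C) (lTensor_subtype_injective S))
      ((X.coact ∘ₗ S.subtype).codRestrict _ (fun m => hS m m.2) m))).symm
  refine ⟨⟨ρ, ?_, ?_⟩, hρ⟩
  -- By flatness C ⊗ C ⊗ S embeds into C ⊗ C ⊗ M, where coassociativity is that of `X`.
  · have h1 : Function.Injective ((S.subtype.lTensor C).lTensor C) :=
      Module.Flat.lTensor_preserves_injective_linearMap _ (lTensor_subtype_injective S)
    have h2 : Intertwines (cofreeCoact K C S) (cofreeCoact K C M) (S.subtype.lTensor C) :=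
      intertwines_lTensor _
    refine LinearMap.ext fun m => h1 ?_
    have h3 := h2.apply (ρ m)
    have h4 := LinearMap.congr_fun hρ m
    simp only [LinearMap.comp_apply] at h4
    rw [← h4, show cofreeCoact K C M (X.coact (S.subtype m)) = _ from
      X.intertwines_coact.apply _, h4, ← LinearMap.comp_apply (LinearMap.lTensor C X.coact),
      ← LinearMap.lTensor_comp, hρ, LinearMap.lTensor_comp] at h3
    exact h3.symm
  · refine LinearMap.ext fun m => ?_
    have h1 : Function.Injective (S.subtype.lTensor K) :=
      Module.Flat.lTensor_preserves_injective_linearMap _ S.injective_subtype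
    refine h1 ?_
    have h2 := LinearMap.congr_fun X.counit_coact m
    have h4 := LinearMap.congr_fun hρ m
    simp only [LinearMap.comp_apply, Submodule.subtype_apply] at h4 h2 ⊢
    rw [h4, ← LinearMap.comp_apply, LinearMap.rTensor_comp_lTensor] at h2
    rw [← LinearMap.comp_apply, LinearMap.lTensor_comp_rTensor, h2]
    simp

/-- If the cokernels of all coactions are injective then the coalgebra is left hereditary. -/
theorem isLeftHereditary_of_coker
    (h : ∀ (M : Type v) [AddCommGroup M] [Module K M] (X : LeftComodule K C M),
      X.coker.IsInjective) : IsLeftHereditary K C := by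
  intro I Q _ _ _ _ X Y p hp hsurj hX
  -- Tensoring with C is exact, so C ⊗ ker p is the kernel of C ⊗ p and the kernel of p is a
  -- subcomodule.
  obtain ⟨Z, hZ⟩ := X.exists_sub (LinearMap.ker p) (by
    intro m hm
    have h1 := lTensor_exact C (LinearMap.exact_subtype_ker_map p) hsurj
    refine (h1 _).1 ?_
    rw [← Intertwines.apply hp, LinearMap.mem_ker.1 hm, map_zero])
  -- Schanuel-type comparison of the embeddings of Z into the injectives I and C ⊗ Z: α and β are
  -- colinear maps between them, in both directions, that respect Z.
  obtain ⟨α, hα, hαi⟩ := LeftComodule.isInjective_cofree _ _ Z X (LinearMap.ker p).subtype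
    Z.coact hZ (LinearMap.ker p).injective_subtype Z.intertwines_coact
  obtain ⟨β, hβ, hβi⟩ := hX _ _ Z ((LeftComodule.regular K C).tensorRight _) Z.coact (LinearMap.ker p).subtype Z.intertwines_coact
    Z.coact_injective hZ
  obtain ⟨s, hs⟩ := p.exists_rightInverse_of_surjective (LinearMap.range_eq_top.2 hsurj)
  have hsp : ∀ x, ∃ m : LinearMap.ker p, s (p x) - x = (m : I) := fun x =>
    ⟨⟨s (p x) - x, by
      have := LinearMap.congr_fun hs (p x)
      rw [LinearMap.mem_ker, map_sub, sub_eq_zero]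
      exact this⟩, rfl⟩
  -- A map killing ker p factors through p by way of the linear section s. Since p is a colinear
  -- surjection, the factored map is colinear when f is, although s need not be.
  have hfac : ∀ {R : Type v} [AddCommGroup R] [Module K R] (f : I →ₗ[K] R),
      f ∘ₗ (LinearMap.ker p).subtype = 0 → (f ∘ₗ s) ∘ₗ p = f := by
    intro R _ _ f hf
    refine LinearMap.ext fun x => ?_
    obtain ⟨m, hm⟩ := hsp x
    have h1 := LinearMap.congr_fun hf m
    rw [LinearMap.comp_apply, Submodule.subtype_apply, ← hm, map_sub, LinearMap.zero_apply,
      sub_eq_zero] at h1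
    exact h1
  have hq : Intertwines (cofreeCoact K C _) Z.coker.coact (LinearMap.range Z.coact).mkQ :=
    LeftComodule.intertwines_mkQ _ _ _
  have ha : (((LinearMap.range Z.coact).mkQ ∘ₗ α) ∘ₗ s) ∘ₗ p =
      (LinearMap.range Z.coact).mkQ ∘ₗ α := hfac _ (by
    rw [LinearMap.comp_assoc, hαi, LinearMap.range_mkQ_comp])
  have hc : ((LinearMap.id - β ∘ₗ α) ∘ₗ s) ∘ₗ p = LinearMap.id - β ∘ₗ α := hfac _ (by
    rw [LinearMap.sub_comp, LinearMap.comp_assoc, hαi, hβi, LinearMap.id_comp, sub_self])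
  obtain ⟨b, hb⟩ : ∃ b : Z.Coker →ₗ[K] Q, b ∘ₗ (LinearMap.range Z.coact).mkQ = p ∘ₗ β :=
    ⟨(LinearMap.range Z.coact).liftQ (p ∘ₗ β) (by
      rw [LinearMap.range_le_ker_iff, LinearMap.comp_assoc, hβi]
      exact LinearMap.ext fun m => m.2), Submodule.liftQ_mkQ _ _ _⟩
  have ha' : Intertwines Y.coact Z.coker.coact (((LinearMap.range Z.coact).mkQ ∘ₗ α) ∘ₗ s) :=
    Intertwines.of_comp_right hp hsurj (by rw [ha]; exact hq.comp hα)
  have hc' : Intertwines Y.coact X.coact ((LinearMap.id - β ∘ₗ α) ∘ₗ s) :=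
    Intertwines.of_comp_right hp hsurj (by
      rw [hc]; exact intertwines_id.sub (Intertwines.comp hβ hα))
  have hb' : Intertwines Z.coker.coact Y.coact b :=
    hq.of_comp_right (Submodule.mkQ_surjective _) (hb ▸ Intertwines.comp hp hβ)
  -- On I this is p(1 − βα) + pβα = p. Hence Q is a retract of I ⊕ Coker(Z → C ⊗ Z), and a map into
  -- Q is extended by extending its two components.
  have hid : p ∘ₗ ((LinearMap.id - β ∘ₗ α) ∘ₗ s) +
      b ∘ₗ (((LinearMap.range Z.coact).mkQ ∘ₗ α) ∘ₗ s) = LinearMap.id := by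
    rw [← LinearMap.cancel_right hsurj, LinearMap.add_comp, LinearMap.comp_assoc, hc,
      LinearMap.comp_assoc, ha, ← LinearMap.comp_assoc, hb, LinearMap.comp_sub,
      LinearMap.comp_id, LinearMap.comp_assoc, sub_add_cancel, LinearMap.id_comp]
  intro A B _ _ _ _ S T i f hi hinj hf
  obtain ⟨g₁, hg₁, e₁⟩ := hX _ _ S T i _ hi hinj (hc'.comp hf)
  obtain ⟨g₂, hg₂, e₂⟩ := h _ Z _ _ S T i _ hi hinj (ha'.comp hf)
  refine ⟨p ∘ₗ g₁ + b ∘ₗ g₂, (Intertwines.comp hp hg₁).add (hb'.comp hg₂), ?_⟩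
  rw [LinearMap.add_comp, LinearMap.comp_assoc, e₁, LinearMap.comp_assoc i g₂ b, e₂,
    ← LinearMap.comp_assoc, ← LinearMap.comp_assoc _ _ b, ← LinearMap.add_comp, hid,
    LinearMap.id_comp]

end Hereditary

/-! ### The equivalences on the left side. -/

section TFAE

variable {K : Type u} {H : Type v} [Field K] [Ring H] [HopfAlgebra K H]

/-- Everything passes through fs-retractions; only hereditariness returns to injectivity of H̄
directly. -/
theorem isFormallySmooth_tfae : List.TFAE
    [IsFormallySmooth K H,
     (ModuleCoalgebra.regular K H).IsFormallySmooth,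
     (LeftComodule.cokerUnit K H).IsInjective,
     ∃ χ : H ⊗[K] CokerUnit K H →ₗ[K] CokerUnit K H, IsFsRetraction χ,
     IsLeftHereditary K H] := by
  tfae_have 1 → 4 := fun h => by
    obtain ⟨π, hπ, e⟩ := Bicomodule.IsRelInjective.exists_retraction h
    exact exists_isFsRetraction hπ e
  tfae_have 2 → 4 := fun h => by
    obtain ⟨π, hπ, e⟩ := ModuleBicomodule.IsRelInjective.exists_retraction h
    exact exists_isFsRetraction hπ e
  tfae_have 4 → 1 := fun ⟨_, h⟩ => h.isFormallySmooth
  tfae_have 4 → 2 := fun ⟨_, h⟩ => h.isFormallySmooth_module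
  tfae_have 3 ↔ 4 := isInjective_cokerUnit_iff
  tfae_have 4 → 5 := fun ⟨_, h⟩ => isLeftHereditary_of_coker fun _ _ _ X => h.isInjective_coker X
  -- H̄ is a quotient of the regular comodule, which is injective.
  tfae_have 5 → 3 := fun h => h _ _ (LeftComodule.regular K H) _ (unitMkQ K H)
    intertwines_unitMkQ (Submodule.mkQ_surjective _) LeftComodule.isInjective_regular
  tfae_finish

end TFAE

/-! ### The opposite co-opposite Hopf algebra. -/

/-- The space `C`, to be equipped with the opposite comultiplication, and with the opposite
multiplication if there is one. -/
def OpCop (C : Type*) : Type _ := C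

namespace OpCop

instance {C : Type*} [AddCommGroup C] : AddCommGroup (OpCop C) := inferInstanceAs (AddCommGroup C)

instance {K C : Type*} [Field K] [AddCommGroup C] [Module K C] : Module K (OpCop C) :=
  inferInstanceAs (Module K C)

section Coalgebra

variable {K : Type u} {C : Type v} [Field K] [AddCommGroup C] [Module K C]

/-- The identity map `C → OpCop C`. -/
def of (K : Type u) (C : Type v) [Field K] [AddCommGroup C] [Module K C] : C ≃ₗ[K] OpCop C :=
  LinearEquiv.refl K C

/-- The map `a ⊗ b ↦ b ⊗ a`. -/
def swap (K : Type u) (C : Type v) [Field K] [AddCommGroup C] [Module K C] :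
    C ⊗[K] C ≃ₗ[K] OpCop C ⊗[K] OpCop C :=
  TensorProduct.comm K C C ≪≫ₗ TensorProduct.congr (of K C) (of K C)

@[simp]
theorem swap_tmul (a b : C) : swap K C (a ⊗ₜ b) = of K C b ⊗ₜ of K C a := rfl

variable [Coalgebra K C]

instance : CoalgebraStruct K (OpCop C) where
  comul := (swap K C).toLinearMap ∘ₗ Coalgebra.comul ∘ₗ (of K C).symm.toLinearMap
  counit := Coalgebra.counit ∘ₗ (of K C).symm.toLinearMap

theorem comul_of (c : C) : Coalgebra.comul (R := K) (of K C c) =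
    swap K C (Coalgebra.comul (R := K) c) := rfl

theorem counit_of (c : C) : Coalgebra.counit (R := K) (of K C c) =
    Coalgebra.counit (R := K) c := rfl

instance : Coalgebra K (OpCop C) where
  coassoc := by
    refine LinearMap.ext fun x => ?_
    obtain ⟨x, rfl⟩ := (of K C).surjective x
    -- Ψ reverses three factors, a ⊗ (b ⊗ c) ↦ c ⊗ (b ⊗ a), and exchanges the two sides of
    -- coassociativity.
    let Ψ : C ⊗[K] (C ⊗[K] C) →ₗ[K] OpCop C ⊗[K] (OpCop C ⊗[K] OpCop C) :=
      (TensorProduct.assoc K _ _ _).toLinearMap ∘ₗ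
        (TensorProduct.comm K _ _).toLinearMap ∘ₗ
          TensorProduct.map (of K C).toLinearMap (swap K C).toLinearMap
    have h1 : ∀ s : C ⊗[K] C, TensorProduct.assoc K _ _ _
        ((Coalgebra.comul (R := K) (A := OpCop C)).rTensor (OpCop C) (swap K C s)) =
        Ψ ((Coalgebra.comul (R := K) (A := C)).lTensor C s) := by
      intro s
      induction s with
      | zero => simp
      | add x y hx hy => simp only [map_add, hx, hy]
      | tmul a b => simp [Ψ, comul_of]
    have h2 : ∀ s : C ⊗[K] C,
        (Coalgebra.comul (R := K) (A := OpCop C)).lTensor (OpCop C) (swap K C s) =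
        Ψ (TensorProduct.assoc K _ _ _ ((Coalgebra.comul (R := K) (A := C)).rTensor C s)) := by
      intro s
      induction s with
      | zero => simp
      | add x y hx hy => simp only [map_add, hx, hy]
      | tmul a b =>
        simp only [swap_tmul, LinearMap.lTensor_tmul, LinearMap.rTensor_tmul, comul_of]
        generalize Coalgebra.comul (R := K) a = s
        induction s with
        | zero => simp
        | add x y hx hy =>
          simp only [map_add, hx, hy, TensorProduct.tmul_add, TensorProduct.add_tmul]
        | tmul a b => simp [Ψ]
    simp only [LinearMap.comp_apply, comul_of, LinearEquiv.coe_coe]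
    rw [h1, h2, Coalgebra.coassoc_apply]
  rTensor_counit_comp_comul := by
    refine LinearMap.ext fun x => ?_
    obtain ⟨x, rfl⟩ := (of K C).surjective x
    have h1 : ∀ s : C ⊗[K] C,
        (Coalgebra.counit (R := K) (A := OpCop C)).rTensor (OpCop C) (swap K C s) =
        1 ⊗ₜ of K C (counitR K C C s) := by
      intro s
      induction s with
      | zero => simp
      | add x y hx hy => simp only [map_add, hx, hy, TensorProduct.tmul_add]
      | tmul a b =>
        rw [swap_tmul, LinearMap.rTensor_tmul, counit_of, counitR_tmul, map_smul,
          ← TensorProduct.smul_tmul, smul_eq_mul, mul_one]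
    simp only [LinearMap.comp_apply, comul_of]
    rw [h1]
    exact congrArg (fun z => 1 ⊗ₜ of K C z) ((RightComodule.regular K C).counitR_coact x)
  lTensor_counit_comp_comul := by
    refine LinearMap.ext fun x => ?_
    obtain ⟨x, rfl⟩ := (of K C).surjective x
    have h1 : ∀ s : C ⊗[K] C,
        (Coalgebra.counit (R := K) (A := OpCop C)).lTensor (OpCop C) (swap K C s) =
        of K C (counitL K C C s) ⊗ₜ 1 := by
      intro s
      induction s with
      | zero => simp
      | add x y hx hy => simp only [map_add, hx, hy, TensorProduct.add_tmul]
      | tmul a b =>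
        rw [swap_tmul, LinearMap.lTensor_tmul, counit_of, counitL_tmul, map_smul,
          TensorProduct.smul_tmul, smul_eq_mul, mul_one]
    simp only [LinearMap.comp_apply, comul_of]
    rw [h1]
    exact congrArg (fun z => of K C z ⊗ₜ 1) ((LeftComodule.regular K C).counitL_coact x)

end Coalgebra

section Hopf

variable {K : Type u} {H : Type v} [Field K] [Ring H]

instance : Ring (OpCop H) :=
  { (inferInstance : AddCommGroup (OpCop H)) with
    mul := fun a b => ((show H from b) * (show H from a) : H)
    one := (1 : H)
    mul_assoc := fun a b c => (mul_assoc (show H from c) (show H from b) (show H from a)).symm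
    one_mul := fun a => mul_one (show H from a)
    mul_one := fun a => one_mul (show H from a)
    left_distrib := fun a b c => add_mul (show H from b) (show H from c) (show H from a)
    right_distrib := fun a b c => mul_add (show H from c) (show H from a) (show H from b)
    zero_mul := fun a => mul_zero (show H from a)
    mul_zero := fun a => zero_mul (show H from a) }

instance [Algebra K H] : Algebra K (OpCop H) :=
  Algebra.ofModule (fun r x y => mul_smul_comm r (show H from y) (show H from x))
    (fun r x y => smul_mul_assoc r (show H from y) (show H from x))

theorem of_mul [Algebra K H] (a b : H) : of K H a * of K H b = of K H (b * a) := rfl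

theorem of_one [Algebra K H] : of K H 1 = 1 := rfl

theorem swap_mul [Algebra K H] (s t : H ⊗[K] H) :
    swap K H s * swap K H t = swap K H (t * s) := by
  induction s with
  | zero => simp
  | add x y hx hy => simp only [map_add, add_mul, mul_add, hx, hy]
  | tmul a b =>
    induction t with
    | zero => simp
    | add x y hx hy => simp only [map_add, add_mul, mul_add, hx, hy]
    | tmul c d => simp [of_mul]

instance [Bialgebra K H] : Bialgebra K (OpCop H) :=
  Bialgebra.mk' K (OpCop H)
    (by rw [← of_one (K := K), counit_of, Bialgebra.counit_one])
    (by
      intro a b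
      obtain ⟨a, rfl⟩ := (of K H).surjective a
      obtain ⟨b, rfl⟩ := (of K H).surjective b
      rw [of_mul, counit_of, counit_of, counit_of, Bialgebra.counit_mul, mul_comm])
    (by
      rw [← of_one (K := K), comul_of, Bialgebra.comul_one, Algebra.TensorProduct.one_def]
      rfl)
    (by
      intro a b
      obtain ⟨a, rfl⟩ := (of K H).surjective a
      obtain ⟨b, rfl⟩ := (of K H).surjective b
      rw [of_mul, comul_of, comul_of, comul_of, Bialgebra.comul_mul, swap_mul])

/-- Reversing product and coproduct together keeps the antipode and exchanges its two axioms.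
Reversing only one of them would call for an inverse of the antipode. -/
instance [HopfAlgebra K H] : HopfAlgebra K (OpCop H) where
  antipode := (of K H).toLinearMap ∘ₗ HopfAlgebra.antipode K ∘ₗ (of K H).symm.toLinearMap
  mul_antipode_rTensor_comul := by
    refine LinearMap.ext fun x => ?_
    obtain ⟨x, rfl⟩ := (of K H).surjective x
    have h : ∀ s : H ⊗[K] H, LinearMap.mul' K (OpCop H)
        (((of K H).toLinearMap ∘ₗ HopfAlgebra.antipode K ∘ₗ
          (of K H).symm.toLinearMap).rTensor (OpCop H) (swap K H s)) =
        of K H (LinearMap.mul' K H ((HopfAlgebra.antipode K (A := H)).lTensor H s)) := by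
      intro s
      induction s with
      | zero => simp
      | add x y hx hy => simp only [map_add, hx, hy]
      | tmul a b => simp [of_mul]
    refine (h (Coalgebra.comul x)).trans ?_
    rw [HopfAlgebra.mul_antipode_lTensor_comul_apply]
    rw [LinearMap.comp_apply, counit_of, Algebra.linearMap_apply,
      Algebra.algebraMap_eq_smul_one, Algebra.algebraMap_eq_smul_one, map_smul, of_one]
  mul_antipode_lTensor_comul := by
    refine LinearMap.ext fun x => ?_
    obtain ⟨x, rfl⟩ := (of K H).surjective x
    have h : ∀ s : H ⊗[K] H, LinearMap.mul' K (OpCop H)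
        (((of K H).toLinearMap ∘ₗ HopfAlgebra.antipode K ∘ₗ
          (of K H).symm.toLinearMap).lTensor (OpCop H) (swap K H s)) =
        of K H (LinearMap.mul' K H ((HopfAlgebra.antipode K (A := H)).rTensor H s)) := by
      intro s
      induction s with
      | zero => simp
      | add x y hx hy => simp only [map_add, hx, hy]
      | tmul a b => simp [of_mul]
    refine (h (Coalgebra.comul x)).trans ?_
    rw [HopfAlgebra.mul_antipode_rTensor_comul_apply]
    rw [LinearMap.comp_apply, counit_of, Algebra.linearMap_apply,
      Algebra.algebraMap_eq_smul_one, Algebra.algebraMap_eq_smul_one, map_smul, of_one]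

end Hopf

end OpCop

/-! ### Exchanging left and right comodules. -/

section Mirror

variable {K : Type u} {C : Type v} [Field K] [AddCommGroup C] [Module K C]
variable {M N : Type w} [AddCommGroup M] [Module K M] [AddCommGroup N] [Module K N]

/-- The map `m ⊗ c ↦ c ⊗ m`. -/
def flipRight (K : Type u) (C : Type v) [Field K] [AddCommGroup C] [Module K C] (M : Type*)
    [AddCommGroup M] [Module K M] : M ⊗[K] C ≃ₗ[K] OpCop C ⊗[K] M :=
  TensorProduct.comm K M C ≪≫ₗ TensorProduct.congr (OpCop.of K C) (LinearEquiv.refl K M)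

/-- The map `c ⊗ m ↦ m ⊗ c`. -/
def flipLeft (K : Type u) (C : Type v) [Field K] [AddCommGroup C] [Module K C] (M : Type*)
    [AddCommGroup M] [Module K M] : C ⊗[K] M ≃ₗ[K] M ⊗[K] OpCop C :=
  TensorProduct.comm K C M ≪≫ₗ TensorProduct.congr (LinearEquiv.refl K M) (OpCop.of K C)

@[simp]
theorem flipRight_tmul (m : M) (c : C) : flipRight K C M (m ⊗ₜ c) = OpCop.of K C c ⊗ₜ m := rfl

@[simp]
theorem flipLeft_tmul (m : M) (c : C) : flipLeft K C M (c ⊗ₜ m) = m ⊗ₜ OpCop.of K C c := rfl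

theorem flipRight_rTensor (f : M →ₗ[K] N) (t : M ⊗[K] C) :
    flipRight K C N (f.rTensor C t) = f.lTensor (OpCop C) (flipRight K C M t) := by
  induction t with
  | zero => simp
  | add x y hx hy => simp only [map_add, hx, hy]
  | tmul a b => simp

theorem flipLeft_lTensor (f : M →ₗ[K] N) (t : C ⊗[K] M) :
    flipLeft K C N (f.lTensor C t) = f.rTensor (OpCop C) (flipLeft K C M t) := by
  induction t with
  | zero => simp
  | add x y hx hy => simp only [map_add, hx, hy]
  | tmul a b => simp

/-- The map `m ⊗ (a ⊗ b) ↦ b ⊗ (a ⊗ m)`. -/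
def flipRight₂ (K : Type u) (C : Type v) [Field K] [AddCommGroup C] [Module K C] (M : Type*)
    [AddCommGroup M] [Module K M] : M ⊗[K] (C ⊗[K] C) ≃ₗ[K] OpCop C ⊗[K] (OpCop C ⊗[K] M) :=
  TensorProduct.congr (LinearEquiv.refl K M) (OpCop.swap K C) ≪≫ₗ
    TensorProduct.comm K M _ ≪≫ₗ TensorProduct.assoc K _ _ M

/-- The map `a ⊗ (b ⊗ m) ↦ m ⊗ (b ⊗ a)`. -/
def flipLeft₂ (K : Type u) (C : Type v) [Field K] [AddCommGroup C] [Module K C] (M : Type*)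
    [AddCommGroup M] [Module K M] : C ⊗[K] (C ⊗[K] M) ≃ₗ[K] M ⊗[K] (OpCop C ⊗[K] OpCop C) :=
  (TensorProduct.assoc K C C M).symm ≪≫ₗ TensorProduct.comm K _ M ≪≫ₗ
    TensorProduct.congr (LinearEquiv.refl K M) (OpCop.swap K C)

/-- The map `a ⊗ (m ⊗ c) ↦ c ⊗ (m ⊗ a)`. -/
def flipBoth (K : Type u) (C : Type v) [Field K] [AddCommGroup C] [Module K C] (M : Type*)
    [AddCommGroup M] [Module K M] : C ⊗[K] (M ⊗[K] C) ≃ₗ[K] OpCop C ⊗[K] (M ⊗[K] OpCop C) :=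
  flipLeft K C _ ≪≫ₗ TensorProduct.congr (flipRight K C M) (LinearEquiv.refl K _) ≪≫ₗ
    TensorProduct.assoc K _ _ _

theorem flipRight₂_assoc (r : M →ₗ[K] M ⊗[K] C) (t : M ⊗[K] C) :
    ((flipRight K C M).toLinearMap ∘ₗ r).lTensor (OpCop C) (flipRight K C M t) =
      flipRight₂ K C M (TensorProduct.assoc K M C C (r.rTensor C t)) := by
  induction t with
  | zero => simp
  | add x y hx hy => simp only [map_add, hx, hy]
  | tmul m c =>
    simp only [flipRight_tmul, LinearMap.lTensor_tmul, LinearMap.comp_apply,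
      LinearMap.rTensor_tmul]
    generalize r m = s
    induction s with
    | zero => simp
    | add x y hx hy => simp only [map_add, hx, hy, TensorProduct.add_tmul, TensorProduct.tmul_add]
    | tmul a b => simp [flipRight₂]

theorem flipLeft₂_lTensor (l : M →ₗ[K] C ⊗[K] M) (t : C ⊗[K] M) :
    TensorProduct.assoc K _ _ _
      (((flipLeft K C M).toLinearMap ∘ₗ l).rTensor (OpCop C) (flipLeft K C M t)) =
      flipLeft₂ K C M (l.lTensor C t) := by
  induction t with
  | zero => simp
  | add x y hx hy => simp only [map_add, hx, hy]
  | tmul c m =>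
    simp only [flipLeft_tmul, LinearMap.lTensor_tmul, LinearMap.comp_apply,
      LinearMap.rTensor_tmul]
    generalize l m = s
    induction s with
    | zero => simp
    | add x y hx hy => simp only [map_add, hx, hy, TensorProduct.add_tmul, TensorProduct.tmul_add]
    | tmul a b => simp [flipLeft₂]

theorem flipBoth_rTensor (l : M →ₗ[K] C ⊗[K] M) (t : M ⊗[K] C) :
    ((flipLeft K C M).toLinearMap ∘ₗ l).lTensor (OpCop C) (flipRight K C M t) =
      flipBoth K C M (TensorProduct.assoc K C M C (l.rTensor C t)) := by
  induction t with
  | zero => simp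
  | add x y hx hy => simp only [map_add, hx, hy]
  | tmul m c =>
    simp only [flipRight_tmul, LinearMap.lTensor_tmul, LinearMap.comp_apply,
      LinearMap.rTensor_tmul]
    generalize l m = s
    induction s with
    | zero => simp
    | add x y hx hy => simp only [map_add, hx, hy, TensorProduct.add_tmul, TensorProduct.tmul_add]
    | tmul a b => simp [flipBoth]

theorem flipBoth_lTensor (r : M →ₗ[K] M ⊗[K] C) (t : C ⊗[K] M) :
    TensorProduct.assoc K _ _ _
      (((flipRight K C M).toLinearMap ∘ₗ r).rTensor (OpCop C) (flipLeft K C M t)) =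
      flipBoth K C M (r.lTensor C t) := by
  induction t with
  | zero => simp
  | add x y hx hy => simp only [map_add, hx, hy]
  | tmul c m => simp [flipBoth]

variable [Coalgebra K C]

theorem flipRight₂_comul (t : M ⊗[K] C) : TensorProduct.assoc K _ _ _
    ((Coalgebra.comul (R := K) (A := OpCop C)).rTensor M (flipRight K C M t)) =
      flipRight₂ K C M ((Coalgebra.comul (R := K) (A := C)).lTensor M t) := by
  induction t with
  | zero => simp
  | add x y hx hy => simp only [map_add, hx, hy]
  | tmul m c => simp [flipRight₂, OpCop.comul_of]

theorem flipLeft₂_comul (t : C ⊗[K] M) :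
    (Coalgebra.comul (R := K) (A := OpCop C)).lTensor M (flipLeft K C M t) =
      flipLeft₂ K C M (TensorProduct.assoc K C C M
        ((Coalgebra.comul (R := K) (A := C)).rTensor M t)) := by
  induction t with
  | zero => simp
  | add x y hx hy => simp only [map_add, hx, hy]
  | tmul c m => simp [flipLeft₂, OpCop.comul_of]

theorem counit_flipRight (t : M ⊗[K] C) :
    (Coalgebra.counit (R := K) (A := OpCop C)).rTensor M (flipRight K C M t) =
      TensorProduct.comm K M K ((Coalgebra.counit (R := K) (A := C)).lTensor M t) := by
  induction t with
  | zero => simp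
  | add x y hx hy => simp only [map_add, hx, hy]
  | tmul m c => simp [OpCop.counit_of]

theorem counit_flipLeft (t : C ⊗[K] M) :
    (Coalgebra.counit (R := K) (A := OpCop C)).lTensor M (flipLeft K C M t) =
      TensorProduct.comm K K M ((Coalgebra.counit (R := K) (A := C)).rTensor M t) := by
  induction t with
  | zero => simp
  | add x y hx hy => simp only [map_add, hx, hy]
  | tmul c m => simp [OpCop.counit_of]

/-- A right comodule over `C` as a left comodule over `OpCop C`. -/
def RightComodule.opCop (X : RightComodule K C M) : LeftComodule K (OpCop C) M where
  coact := (flipRight K C M).toLinearMap ∘ₗ X.coact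
  coassoc := LinearMap.ext fun m => (flipRight₂_comul _).trans
    ((congrArg (flipRight₂ K C M) (LinearMap.congr_fun X.coassoc m).symm).trans
      (flipRight₂_assoc _ _).symm)
  counit_coact := LinearMap.ext fun m => (counit_flipRight _).trans
    ((congrArg (TensorProduct.comm K M K) (LinearMap.congr_fun X.counit_coact m)).trans (by simp))

/-- A left comodule over `C` as a right comodule over `OpCop C`. -/
def LeftComodule.opCop (X : LeftComodule K C M) : RightComodule K (OpCop C) M where
  coact := (flipLeft K C M).toLinearMap ∘ₗ X.coact
  coassoc := LinearMap.ext fun m => (flipLeft₂_lTensor _ _).trans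
    ((congrArg (flipLeft₂ K C M) (LinearMap.congr_fun X.coassoc m).symm).trans
      (flipLeft₂_comul _).symm)
  counit_coact := LinearMap.ext fun m => (counit_flipLeft _).trans
    ((congrArg (TensorProduct.comm K K M) (LinearMap.congr_fun X.counit_coact m)).trans (by simp))

/-- Injectivity quantifies over all test comodules, so every comodule on the opposite side must be
seen to arise by mirroring. -/
theorem RightComodule.opCop_surjective (Y : LeftComodule K (OpCop C) M) :
    ∃ X : RightComodule K C M, X.opCop = Y := by
  have h : (flipRight K C M).toLinearMap ∘ₗ ((flipRight K C M).symm.toLinearMap ∘ₗ Y.coact) =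
      Y.coact := by
    rw [← LinearMap.comp_assoc, LinearEquiv.comp_symm, LinearMap.id_comp]
  have h' := LinearMap.congr_fun h
  refine ⟨⟨(flipRight K C M).symm.toLinearMap ∘ₗ Y.coact, LinearMap.ext fun m => ?_,
    LinearMap.ext fun m => ?_⟩, LeftComodule.ext h⟩
  · apply (flipRight₂ K C M).injective
    refine (flipRight₂_assoc _ _).symm.trans (Eq.trans ?_ (flipRight₂_comul _))
    have h2 := LinearMap.congr_fun Y.coassoc m
    rw [h]
    simp only [LinearMap.comp_apply, LinearEquiv.coe_coe, LinearEquiv.apply_symm_apply] at h2 ⊢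
    exact h2.symm
  · apply (TensorProduct.comm K M K).injective
    refine (counit_flipRight _).symm.trans ?_
    have h2 := LinearMap.congr_fun Y.counit_coact m
    simp only [LinearMap.comp_apply, LinearEquiv.coe_coe, LinearEquiv.apply_symm_apply] at h2 ⊢
    rw [h2]
    simp

theorem LeftComodule.opCop_surjective (Y : RightComodule K (OpCop C) M) :
    ∃ X : LeftComodule K C M, X.opCop = Y := by
  have h : (flipLeft K C M).toLinearMap ∘ₗ ((flipLeft K C M).symm.toLinearMap ∘ₗ Y.coact) =
      Y.coact := by
    rw [← LinearMap.comp_assoc, LinearEquiv.comp_symm, LinearMap.id_comp]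
  refine ⟨⟨(flipLeft K C M).symm.toLinearMap ∘ₗ Y.coact, LinearMap.ext fun m => ?_,
    LinearMap.ext fun m => ?_⟩, RightComodule.ext h⟩
  · apply (flipLeft₂ K C M).injective
    refine (flipLeft₂_comul _).symm.trans (Eq.trans ?_ (flipLeft₂_lTensor _ _))
    have h2 := LinearMap.congr_fun Y.coassoc m
    rw [h]
    simp only [LinearMap.comp_apply, LinearEquiv.coe_coe, LinearEquiv.apply_symm_apply] at h2 ⊢
    exact h2.symm
  · apply (TensorProduct.comm K K M).injective
    refine (counit_flipLeft _).symm.trans ?_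
    have h2 := LinearMap.congr_fun Y.counit_coact m
    simp only [LinearMap.comp_apply, LinearEquiv.coe_coe, LinearEquiv.apply_symm_apply] at h2 ⊢
    rw [h2]
    simp

theorem RightComodule.opCop_isColinear {X : RightComodule K C M} {Y : RightComodule K C N}
    {f : M →ₗ[K] N} : X.opCop.IsColinear Y.opCop f ↔ X.IsColinear Y f := by
  constructor
  · intro h
    refine LinearMap.ext fun m => (flipRight K C N).injective ?_
    exact (Intertwines.apply h m).trans (flipRight_rTensor _ _).symm
  · intro h
    refine LinearMap.ext fun m => ?_
    exact (congrArg (flipRight K C N) (RIntertwines.apply h m)).trans (flipRight_rTensor _ _)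

theorem LeftComodule.opCop_isColinear {X : LeftComodule K C M} {Y : LeftComodule K C N}
    {f : M →ₗ[K] N} : X.opCop.IsColinear Y.opCop f ↔ X.IsColinear Y f := by
  constructor
  · intro h
    refine LinearMap.ext fun m => (flipLeft K C N).injective ?_
    exact (RIntertwines.apply h m).trans (flipLeft_lTensor _ _).symm
  · intro h
    refine LinearMap.ext fun m => ?_
    exact (congrArg (flipLeft K C N) (Intertwines.apply h m)).trans (flipLeft_lTensor _ _)

/-- A bicomodule over `C` as a bicomodule over `OpCop C`. -/
def Bicomodule.opCop (X : Bicomodule K C M) : Bicomodule K (OpCop C) M where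
  left := X.right.opCop
  right := X.left.opCop
  compat := LinearMap.ext fun m => (flipBoth_lTensor _ _).trans
    ((congrArg (flipBoth K C M) (LinearMap.congr_fun X.compat m).symm).trans
      (flipBoth_rTensor _ _).symm)

theorem Bicomodule.opCop_surjective (Y : Bicomodule K (OpCop C) M) :
    ∃ X : Bicomodule K C M, X.opCop = Y := by
  obtain ⟨l, r, h⟩ := Y
  obtain ⟨l, rfl⟩ := RightComodule.opCop_surjective l
  obtain ⟨r, rfl⟩ := LeftComodule.opCop_surjective r
  refine ⟨⟨r, l, LinearMap.ext fun m => (flipBoth K C M).injective ?_⟩, rfl⟩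
  exact (flipBoth_rTensor _ _).symm.trans ((LinearMap.congr_fun h m).symm.trans
    (flipBoth_lTensor _ _))

theorem Bicomodule.opCop_isBicolinear {X : Bicomodule K C M} {Y : Bicomodule K C N}
    {f : M →ₗ[K] N} : X.opCop.IsBicolinear Y.opCop f ↔ X.IsBicolinear Y f :=
  (and_congr RightComodule.opCop_isColinear LeftComodule.opCop_isColinear).trans and_comm

end Mirror

/-! ### Injectivity, hereditariness and formal smoothness under the mirror. -/

section MirrorProperties

variable {K : Type u} {C : Type v} [Field K] [AddCommGroup C] [Module K C] [Coalgebra K C]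
variable {M N : Type v} [AddCommGroup M] [Module K M] [AddCommGroup N] [Module K N]

theorem RightComodule.opCop_isInjective {Z : RightComodule K C M} :
    Z.opCop.IsInjective ↔ Z.IsInjective := by
  constructor
  · intro h A B _ _ _ _ X Y i f hi hinj hf
    obtain ⟨g, hg, e⟩ := h A B X.opCop Y.opCop i f (RightComodule.opCop_isColinear.2 hi) hinj
      (RightComodule.opCop_isColinear.2 hf)
    exact ⟨g, RightComodule.opCop_isColinear.1 hg, e⟩
  · intro h A B _ _ _ _ X Y i f hi hinj hf
    obtain ⟨X, rfl⟩ := RightComodule.opCop_surjective X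
    obtain ⟨Y, rfl⟩ := RightComodule.opCop_surjective Y
    obtain ⟨g, hg, e⟩ := h A B X Y i f (RightComodule.opCop_isColinear.1 hi) hinj
      (RightComodule.opCop_isColinear.1 hf)
    exact ⟨g, RightComodule.opCop_isColinear.2 hg, e⟩

theorem isLeftHereditary_opCop : IsLeftHereditary K (OpCop C) ↔ IsRightHereditary K C := by
  constructor
  · intro h I Q _ _ _ _ X Y p hp hs hX
    exact RightComodule.opCop_isInjective.1 (h I Q X.opCop Y.opCop p
      (RightComodule.opCop_isColinear.2 hp) hs (RightComodule.opCop_isInjective.2 hX))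
  · intro h I Q _ _ _ _ X Y p hp hs hX
    obtain ⟨X, rfl⟩ := RightComodule.opCop_surjective X
    obtain ⟨Y, rfl⟩ := RightComodule.opCop_surjective Y
    exact RightComodule.opCop_isInjective.2 (h I Q X Y p
      (RightComodule.opCop_isColinear.1 hp) hs (RightComodule.opCop_isInjective.1 hX))

theorem Bicomodule.opCop_isRelInjective {Z : Bicomodule K C M} :
    Z.opCop.IsRelInjective ↔ Z.IsRelInjective := by
  constructor
  · intro h A B _ _ _ _ X Y i f hi hinj hf
    obtain ⟨g, hg, e⟩ := h A B X.opCop Y.opCop i f (Bicomodule.opCop_isBicolinear.2 hi) hinj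
      (Bicomodule.opCop_isBicolinear.2 hf)
    exact ⟨g, Bicomodule.opCop_isBicolinear.1 hg, e⟩
  · intro h A B _ _ _ _ X Y i f hi hinj hf
    obtain ⟨X, rfl⟩ := Bicomodule.opCop_surjective X
    obtain ⟨Y, rfl⟩ := Bicomodule.opCop_surjective Y
    obtain ⟨g, hg, e⟩ := h A B X Y i f (Bicomodule.opCop_isBicolinear.1 hi) hinj
      (Bicomodule.opCop_isBicolinear.1 hf)
    exact ⟨g, Bicomodule.opCop_isBicolinear.2 hg, e⟩

theorem Bicomodule.IsRelInjective.of_equiv {X : Bicomodule K C M} {Y : Bicomodule K C N}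
    (hX : X.IsRelInjective) (e : M ≃ₗ[K] N) (he : X.IsBicolinear Y e.toLinearMap) :
    Y.IsRelInjective := by
  intro A B _ _ _ _ S T i f hi hr hf
  obtain ⟨g, hg, h⟩ := hX A B S T i (e.symm.toLinearMap ∘ₗ f) hi hr
    (Bicomodule.IsBicolinear.comp
      ⟨Intertwines.inv he.1 (LinearEquiv.comp_symm e) (LinearEquiv.symm_comp e),
        RIntertwines.inv he.2 (LinearEquiv.comp_symm e) (LinearEquiv.symm_comp e)⟩ hf)
  refine ⟨e.toLinearMap ∘ₗ g, he.comp hg, ?_⟩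
  rw [LinearMap.comp_assoc, h, ← LinearMap.comp_assoc, LinearEquiv.comp_symm, LinearMap.id_comp]

theorem range_comul_map_swap :
    (LinearMap.range (Coalgebra.comul (R := K) (A := C))).map (OpCop.swap K C).toLinearMap =
      LinearMap.range (Coalgebra.comul (R := K) (A := OpCop C)) := by
  refine le_antisymm ?_ ?_
  · rintro _ ⟨_, ⟨x, rfl⟩, rfl⟩
    exact ⟨OpCop.of K C x, rfl⟩
  · rintro _ ⟨x, rfl⟩
    exact ⟨_, ⟨(OpCop.of K C).symm x, rfl⟩, rfl⟩

/-- Exchanging the two factors of C ⊗ C exchanges Δ ⊗ C with C ⊗ Δ. -/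
theorem isBicolinear_swap : (Bicomodule.tensorSelf K C).opCop.IsBicolinear
    (Bicomodule.tensorSelf K (OpCop C)) (OpCop.swap K C).toLinearMap := by
  constructor
  · refine TensorProduct.ext' fun a b => ?_
    simp only [Bicomodule.opCop, RightComodule.opCop, Bicomodule.tensorSelf,
      LeftComodule.tensorRight, RightComodule.tensorLeft, LeftComodule.regular,
      RightComodule.regular, LinearMap.comp_apply, LinearEquiv.coe_coe, OpCop.swap_tmul,
      LinearMap.rTensor_tmul, LinearMap.lTensor_tmul, OpCop.comul_of]
    generalize Coalgebra.comul (R := K) b = s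
    induction s with
    | zero => simp
    | add x y hx hy => simp only [map_add, hx, hy, TensorProduct.add_tmul, TensorProduct.tmul_add]
    | tmul c d => simp
  · refine TensorProduct.ext' fun a b => ?_
    simp only [Bicomodule.opCop, LeftComodule.opCop, Bicomodule.tensorSelf,
      LeftComodule.tensorRight, RightComodule.tensorLeft, LeftComodule.regular,
      RightComodule.regular, LinearMap.comp_apply, LinearEquiv.coe_coe, OpCop.swap_tmul,
      LinearMap.rTensor_tmul, LinearMap.lTensor_tmul, OpCop.comul_of]
    generalize Coalgebra.comul (R := K) a = s
    induction s with
    | zero => simp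
    | add x y hx hy => simp only [map_add, hx, hy, TensorProduct.add_tmul, TensorProduct.tmul_add]
    | tmul c d => simp

/-- The isomorphism between the cokernels of the comultiplications of `C` and `OpCop C`. -/
def cokerComulSwap (K : Type u) (C : Type v) [Field K] [AddCommGroup C] [Module K C]
    [Coalgebra K C] : CokerComul K C ≃ₗ[K] CokerComul K (OpCop C) :=
  Submodule.Quotient.equiv _ _ (OpCop.swap K C) range_comul_map_swap

theorem isBicolinear_cokerComulSwap : (Bicomodule.cokerComul K C).opCop.IsBicolinear
    (Bicomodule.cokerComul K (OpCop C)) (cokerComulSwap K C).toLinearMap := by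
  have h1 : (Bicomodule.tensorSelf K C).IsBicolinear (Bicomodule.cokerComul K C)
      (LinearMap.range (Coalgebra.comul (R := K) (A := C))).mkQ :=
    ⟨LinearMap.ext fun _ => rfl, LinearMap.ext fun _ => rfl⟩
  have h2 : (Bicomodule.tensorSelf K (OpCop C)).IsBicolinear (Bicomodule.cokerComul K (OpCop C))
      (LinearMap.range (Coalgebra.comul (R := K) (A := OpCop C))).mkQ :=
    ⟨LinearMap.ext fun _ => rfl, LinearMap.ext fun _ => rfl⟩
  have h3 := h2.comp isBicolinear_swap
  have h1' := Bicomodule.opCop_isBicolinear.2 h1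
  exact ⟨Intertwines.of_comp_right h1'.1 (Submodule.mkQ_surjective _) h3.1,
    RIntertwines.of_comp_right h1'.2 (Submodule.mkQ_surjective _) h3.2⟩

/-- Formal smoothness is left-right symmetric: swapping factors identifies the two cokernels, and
mirroring preserves the test morphisms. -/
theorem isFormallySmooth_opCop : IsFormallySmooth K (OpCop C) ↔ IsFormallySmooth K C := by
  have he := isBicolinear_cokerComulSwap (K := K) (C := C)
  refine Iff.trans ⟨fun h => h.of_equiv (cokerComulSwap K C).symm ?_,
    fun h => h.of_equiv (cokerComulSwap K C) he⟩ Bicomodule.opCop_isRelInjective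
  exact ⟨Intertwines.inv he.1 (LinearEquiv.comp_symm _) (LinearEquiv.symm_comp _),
    RIntertwines.inv he.2 (LinearEquiv.comp_symm _) (LinearEquiv.symm_comp _)⟩

end MirrorProperties

/-- The left-hand result for the opposite co-opposite Hopf algebra is the right-hand result for H.
-/
theorem isFormallySmooth_iff_isRightHereditary {K : Type u} {H : Type v} [Field K] [Ring H]
    [HopfAlgebra K H] : IsFormallySmooth K H ↔ IsRightHereditary K H :=
  isFormallySmooth_opCop.symm.trans
    (((isFormallySmooth_tfae (K := K) (H := OpCop H)).out 0 4).trans isLeftHereditary_opCop)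

/-! ### Matrix coefficients and the existence of integrals. -/

section Comatrix

variable {K : Type u} {H : Type v} [Field K] [Ring H] [HopfAlgebra K H]
variable {n : Type*} [Fintype n]

/-- The map `x ↦ x₁ φ(x₂)`. -/
def hit (φ : H →ₗ[K] K) : H →ₗ[K] H :=
  (TensorProduct.rid K H).toLinearMap ∘ₗ φ.lTensor H ∘ₗ Coalgebra.comul

theorem hit_sum {ι : Type*} (s : Finset ι) (φ : ι → H →ₗ[K] K) (x : H) :
    hit (∑ i ∈ s, φ i) x = ∑ i ∈ s, hit (φ i) x := by
  simp only [hit, LinearMap.comp_apply]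
  generalize Coalgebra.comul (R := K) x = t
  induction t with
  | zero => simp
  | add x y hx hy => simp only [map_add, hx, hy, Finset.sum_add_distrib]
  | tmul a b => simp [Finset.sum_smul]

/-- The matrix coefficients of the regular comodule. -/
noncomputable def coeff (b : Module.Basis n K H) (i j : n) : H := hit (b.coord j) (b i)

theorem sum_rid_lTensor_coord_tmul (b : Module.Basis n K H) (t : H ⊗[K] H) :
    ∑ j, TensorProduct.rid K H ((b.coord j).lTensor H t) ⊗ₜ[K] b j = t := by
  induction t with
  | zero => simp
  | add x y hx hy => simp only [map_add, TensorProduct.add_tmul, Finset.sum_add_distrib, hx, hy]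
  | tmul a x =>
    simp only [LinearMap.lTensor_tmul, TensorProduct.rid_tmul, TensorProduct.smul_tmul,
      ← TensorProduct.tmul_sum, Module.Basis.coord_apply, b.sum_repr]

theorem comul_basis (b : Module.Basis n K H) (i : n) :
    Coalgebra.comul (R := K) (b i) = ∑ j, coeff b i j ⊗ₜ b j :=
  (sum_rid_lTensor_coord_tmul b _).symm

variable [DecidableEq n]

/-- A square matrix with `Δ(cᵢⱼ) = ∑ₖ cᵢₖ ⊗ cₖⱼ` and `ε(cᵢⱼ) = δᵢⱼ`. -/
structure IsComatrix (K : Type u) {H : Type v} [Field K] [Ring H] [HopfAlgebra K H]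
    {n : Type*} [Fintype n] [DecidableEq n] (c : n → n → H) : Prop where
  comul_eq : ∀ i j, Coalgebra.comul (R := K) (c i j) = ∑ k, c i k ⊗ₜ c k j
  counit_eq : ∀ i j, Coalgebra.counit (R := K) (c i j) = if i = j then 1 else 0

/-- The antipode axioms at cᵢⱼ say that the matrix S(c) is inverse to c, on this side and on the
other. -/
theorem IsComatrix.sum_antipode_mul {c : n → n → H} (h : IsComatrix K c) (i j : n) :
    ∑ k, HopfAlgebra.antipode K (c i k) * c k j = if i = j then 1 else 0 := by
  have h1 := HopfAlgebra.mul_antipode_rTensor_comul_apply (R := K) (c i j)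
  rw [h.comul_eq, h.counit_eq] at h1
  simp only [map_sum, LinearMap.rTensor_tmul, LinearMap.mul'_apply] at h1
  rw [h1]
  split_ifs <;> simp

theorem IsComatrix.sum_mul_antipode {c : n → n → H} (h : IsComatrix K c) (i j : n) :
    ∑ k, c i k * HopfAlgebra.antipode K (c k j) = if i = j then 1 else 0 := by
  have h1 := HopfAlgebra.mul_antipode_lTensor_comul_apply (R := K) (c i j)
  rw [h.comul_eq, h.counit_eq] at h1
  simp only [map_sum, LinearMap.lTensor_tmul, LinearMap.mul'_apply] at h1
  rw [h1]
  split_ifs <;> simp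

/-- The transpose of the image under the antipode of a comatrix is a comatrix. -/
theorem IsComatrix.antipode {c : n → n → H} (h : IsComatrix K c) :
    IsComatrix K fun i j => HopfAlgebra.antipode K (c j i) := by
  refine ⟨fun i j => ?_, fun i j => by
    rw [HopfAlgebra.counit_antipode, h.counit_eq]; simp only [eq_comm]⟩
  -- Over H ⊗ H, E = Δ(S(c)) is a left inverse of D = Δ(c) because Δ is multiplicative, and the
  -- expected value G of Δ(S(c)) is a right inverse; hence E = G.
  let D : Matrix n n (H ⊗[K] H) := .of fun i j => Coalgebra.comul (R := K) (c i j)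
  let E : Matrix n n (H ⊗[K] H) :=
    .of fun i j => Coalgebra.comul (R := K) (HopfAlgebra.antipode K (c i j))
  let G : Matrix n n (H ⊗[K] H) :=
    .of fun i j => ∑ k, HopfAlgebra.antipode K (c k j) ⊗ₜ HopfAlgebra.antipode K (c i k)
  have h1 : E * D = 1 := by
    ext i j
    simp only [Matrix.mul_apply, E, D, Matrix.of_apply, ← Bialgebra.comul_mul, ← map_sum,
      h.sum_antipode_mul, Matrix.one_apply]
    split_ifs <;> simp
  have h2 : D * G = 1 := by
    ext i j
    simp only [Matrix.mul_apply, D, G, Matrix.of_apply, h.comul_eq, Finset.sum_mul_sum,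
      Algebra.TensorProduct.tmul_mul_tmul, Matrix.one_apply]
    have h3 : ∀ a b : n, ∑ l, (c i a * HopfAlgebra.antipode K (c b j)) ⊗ₜ[K]
        (c a l * HopfAlgebra.antipode K (c l b)) =
        if a = b then (c i a * HopfAlgebra.antipode K (c b j)) ⊗ₜ[K] 1 else 0 := by
      intro a b
      rw [← TensorProduct.tmul_sum, h.sum_mul_antipode]
      split_ifs <;> simp
    refine (Finset.sum_comm.trans (Finset.sum_congr rfl fun a _ => Finset.sum_comm)).trans ?_
    simp only [h3, Finset.sum_ite_eq, Finset.mem_univ, if_true]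
    rw [← TensorProduct.sum_tmul, h.sum_mul_antipode]
    split_ifs <;> simp [Algebra.TensorProduct.one_def]
  exact congrArg (fun A : Matrix n n (H ⊗[K] H) => A j i) (left_inv_eq_right_inv h1 h2)

/-- Expand Δ(x dⱼₗ) = ∑ₖ x₁dⱼₖ ⊗ x₂dₖₗ and absorb dₖₗ into the functional. -/
theorem hit_mul_comatrix {d : n → n → H} (hd : IsComatrix K d) (φ : H →ₗ[K] K) (x : H)
    (j l : n) : hit φ (x * d j l) =
      ∑ k, hit (φ ∘ₗ LinearMap.mulRight K (d k l)) x * d j k := by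
  simp only [hit, LinearMap.comp_apply, Bialgebra.comul_mul, hd.comul_eq]
  generalize Coalgebra.comul (R := K) x = t
  induction t with
  | zero => simp
  | add x y hx hy => simp only [map_add, add_mul, hx, hy, Finset.sum_add_distrib]
  | tmul a b => simp [Finset.mul_sum]

/-- Compare the coefficients of bⱼ in the last factor of coassociativity, and in the counit law, at
bᵢ. -/
theorem isComatrix_coeff (b : Module.Basis n K H) : IsComatrix K (coeff b) := by
  refine ⟨fun i j => ?_, fun i j => ?_⟩
  · have h := Coalgebra.coassoc_apply (R := K) (b i)
    rw [comul_basis] at h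
    simp only [map_sum, LinearMap.rTensor_tmul, LinearMap.lTensor_tmul, comul_basis,
      TensorProduct.tmul_sum] at h
    have h1 := congrArg (TensorProduct.map LinearMap.id
      ((TensorProduct.rid K H).toLinearMap ∘ₗ (b.coord j).lTensor H)) h
    have h2 : ∀ (s : H ⊗[K] H) (x : H), TensorProduct.map LinearMap.id
        ((TensorProduct.rid K H).toLinearMap ∘ₗ (b.coord j).lTensor H)
          (TensorProduct.assoc K H H H (s ⊗ₜ x)) = b.coord j x • s := by
      intro s x
      induction s with
      | zero => simp
      | add y z hy hz => simp only [map_add, TensorProduct.add_tmul, smul_add, hy, hz]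
      | tmul y z => simp
    simp only [map_sum, h2] at h1
    simpa [Finsupp.single_apply, ← TensorProduct.tmul_sum] using h1
  · have h : Coalgebra.counit (R := K) (coeff b i j) =
        b.coord j (counitL K H H (Coalgebra.comul (R := K) (b i))) := by
      simp only [coeff, hit, LinearMap.comp_apply]
      generalize Coalgebra.comul (R := K) (b i) = t
      induction t with
      | zero => simp
      | add x y hx hy => simp only [map_add, hx, hy]
      | tmul a x => simp [mul_comm]
    rw [h, show counitL K H H (Coalgebra.comul (R := K) (b i)) = b i from
      (LeftComodule.regular K H).counitL_coact (b i)]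
    simp [Finsupp.single_apply]

/-- A finite dimensional Hopf algebra has a nonzero integral. -/
theorem exists_integral [FiniteDimensional K H] :
    ∃ φ : H →ₗ[K] K, φ ≠ 0 ∧ ∀ x, hit φ x = φ x • (1 : H) := by
  classical
  let b := Module.finBasis K H
  let c := coeff b
  have hc : IsComatrix K c := isComatrix_coeff b
  let d := fun i j => HopfAlgebra.antipode K (HopfAlgebra.antipode K (c i j))
  have hd : IsComatrix K d := hc.antipode.antipode
  -- Candidate integrals x ↦ ∑ⱼ bⱼ*(x S²(cⱼₗ)). The square of the antipode is there so that the
  -- factors d and S(c) in the computation below cancel.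
  let φ := fun l => ∑ j, b.coord j ∘ₗ LinearMap.mulRight K (d j l)
  have hφ : ∀ l x, φ l x = ∑ j, b.coord j (x * d j l) := fun l x => by simp [φ]
  have hcoord : ∀ k y, hit (b.coord k) y = ∑ i, b.coord i y • c i k := fun k y => by
    conv_lhs => rw [← b.sum_repr y]
    rw [map_sum]
    exact Finset.sum_congr rfl fun i _ => map_smul _ _ _
  -- S reverses products, so this is S applied to ∑ⱼ cₘⱼ S(cⱼₖ).
  have hdS : ∀ m k, ∑ j, d j k * HopfAlgebra.antipode K (c m j) = if m = k then 1 else 0 := by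
    intro m k
    simp only [d, ← HopfAlgebra.antipode_mul_antidistrib, ← map_sum, hc.sum_mul_antipode]
    split_ifs <;> simp
  have hint : ∀ l x, hit (φ l) x = φ l x • (1 : H) := by
    intro l x
    -- Inserting this Kronecker delta frees the index of the coordinate from that of d. Summing over
    -- k then moves d inside `hit`, and the last S(c) cancels the coefficients c coming from Δ.
    have e : ∀ k, hit (b.coord k ∘ₗ LinearMap.mulRight K (d k l)) x =
        ∑ m, hit (b.coord m ∘ₗ LinearMap.mulRight K (d k l)) x *
          ∑ j, d j k * HopfAlgebra.antipode K (c m j) := by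
      intro k
      simp [hdS]
    calc hit (φ l) x = ∑ k, ∑ m, hit (b.coord m ∘ₗ LinearMap.mulRight K (d k l)) x *
          ∑ j, d j k * HopfAlgebra.antipode K (c m j) := by
          rw [hit_sum]
          exact Finset.sum_congr rfl fun k _ => e k
      _ = ∑ m, ∑ j, hit (b.coord m) (x * d j l) * HopfAlgebra.antipode K (c m j) := by
          simp only [hit_mul_comatrix hd, Finset.mul_sum, Finset.sum_mul, mul_assoc]
          rw [Finset.sum_comm]
          exact Finset.sum_congr rfl fun m _ => Finset.sum_comm
      _ = ∑ j, ∑ i, b.coord i (x * d j l) • ∑ m, c i m * HopfAlgebra.antipode K (c m j) := by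
          simp only [hcoord, Finset.smul_sum, Finset.sum_mul, smul_mul_assoc]
          rw [Finset.sum_comm]
          exact Finset.sum_congr rfl fun m _ => Finset.sum_comm
      _ = φ l x • 1 := by
          simp only [hc.sum_mul_antipode, hφ, smul_ite, smul_zero, Finset.sum_ite_eq',
            Finset.mem_univ, if_true, Finset.sum_smul]
  by_contra hno
  push Not at hno
  have hzero : ∀ l, φ l = 0 := fun l => by
    by_contra h
    obtain ⟨x, hx⟩ := hno (φ l) h
    exact hx (hint l x)
  -- The φⱼ determine the coordinates, bₗ*(x) = ∑ⱼ φⱼ(x S(cⱼₗ)), so they cannot all vanish on a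
  -- nonzero H.
  have hco : ∀ l x, b.coord l x = 0 := by
    intro l x
    calc b.coord l x = ∑ k, b.coord k (x * HopfAlgebra.antipode K
          (∑ j, HopfAlgebra.antipode K (c k j) * c j l)) := by
          simp only [hc.sum_antipode_mul]
          rw [Finset.sum_eq_single l]
          · simp
          · intro k _ hk
            simp [hk]
          · simp
      _ = ∑ j, φ j (x * HopfAlgebra.antipode K (c j l)) := by
          simp only [hφ, map_sum, HopfAlgebra.antipode_mul_antidistrib, Finset.mul_sum, mul_assoc,
            d]
          exact Finset.sum_comm
      _ = 0 := by simp [hzero]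
  have h1 : (1 : H) = 0 := by
    rw [← b.sum_repr 1]
    exact Finset.sum_eq_zero fun i _ => by
      rw [← Module.Basis.coord_apply, hco, zero_smul]
  have h2 := congrArg (Coalgebra.counit (R := K)) h1
  simp at h2

end Comatrix

/-! ### Finite dimension: splitting off the scalars and injectivity of H̄ → H̄ ⊗ H̄. -/

section FiniteDimensional

variable {K : Type u} {H : Type v} [Field K] [Ring H] [HopfAlgebra K H]

/-- A colinear projection of `H` onto the scalars, for finite dimensional hereditary `H`. -/
theorem IsLeftHereditary.exists_projection [FiniteDimensional K H] (h : IsLeftHereditary K H) :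
    ∃ (G : H →ₗ[K] H) (μ : H → K), (LeftComodule.regular K H).IsColinear
      (LeftComodule.regular K H) G ∧ (∀ x, G x = μ x • 1) ∧ G 1 = 1 := by
  obtain ⟨φ, hφ, hint⟩ := exists_integral (K := K) (H := H)
  have hmem : ∀ r : K, r • (1 : H) ∈ LinearMap.range (Algebra.linearMap K H) := fun r =>
    ⟨r, by rw [Algebra.linearMap_apply, Algebra.algebraMap_eq_smul_one]⟩
  obtain ⟨Y, hY⟩ := (LeftComodule.regular K H).exists_sub
    (LinearMap.range (Algebra.linearMap K H)) (by
      rintro _ ⟨r, rfl⟩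
      refine ⟨r • (1 ⊗ₜ ⟨1, by simpa using hmem 1⟩), ?_⟩
      rw [map_smul, LinearMap.lTensor_tmul, Algebra.linearMap_apply,
        Algebra.algebraMap_eq_smul_one, map_smul]
      exact congrArg (r • ·) Bialgebra.comul_one.symm)
  -- x₁φ(x₂) = φ(x)1 says exactly that x ↦ φ(x)1 is left colinear, so the subcomodule K1 is a
  -- quotient of H.
  let p : H →ₗ[K] LinearMap.range (Algebra.linearMap K H) :=
    (Algebra.linearMap K H).rangeRestrict ∘ₗ φ
  have hp1 : (LinearMap.range (Algebra.linearMap K H)).subtype ∘ₗ p =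
      (Algebra.linearMap K H) ∘ₗ φ := LinearMap.ext fun x => rfl
  have hsp : Intertwines (LeftComodule.regular K H).coact (LeftComodule.regular K H).coact
      ((LinearMap.range (Algebra.linearMap K H)).subtype ∘ₗ p) := by
    refine LinearMap.ext fun x => ?_
    rw [hp1]
    have h1 : ∀ t : H ⊗[K] H, ((Algebra.linearMap K H) ∘ₗ φ).lTensor H t =
        TensorProduct.rid K H (φ.lTensor H t) ⊗ₜ 1 := by
      intro t
      induction t with
      | zero => simp
      | add x y hx hy => simp only [map_add, hx, hy, TensorProduct.add_tmul]
      | tmul a b =>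
        simp [Algebra.algebraMap_eq_smul_one, TensorProduct.smul_tmul]
    refine Eq.trans ?_ (h1 _).symm
    refine Eq.trans ?_ (congrArg (· ⊗ₜ[K] (1 : H)) (hint x).symm)
    simp only [LinearMap.comp_apply, Algebra.linearMap_apply, Algebra.algebraMap_eq_smul_one,
      map_smul, LeftComodule.regular, Bialgebra.comul_one, Algebra.TensorProduct.one_def,
      TensorProduct.smul_tmul']
  have hp : (LeftComodule.regular K H).IsColinear Y p := by
    refine LinearMap.ext fun x => lTensor_subtype_injective _ ?_
    refine (Intertwines.apply hY (p x)).symm.trans ?_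
    refine (hsp.apply x).trans ?_
    rw [LinearMap.lTensor_comp]
    rfl
  have hps : Function.Surjective p := by
    have hφs : Function.Surjective φ := LinearMap.surjective hφ
    exact (Algebra.linearMap K H).surjective_rangeRestrict.comp hφs
  -- Hereditariness makes K1 injective, so its inclusion into H has a colinear retraction.
  have hinj := h _ _ _ _ p hp hps LeftComodule.isInjective_regular
  obtain ⟨g, hg, e⟩ := hinj _ _ Y _ (LinearMap.range (Algebra.linearMap K H)).subtype
    LinearMap.id hY (Submodule.injective_subtype _) intertwines_id
  choose μ hμ using fun x => (g x).2
  refine ⟨(LinearMap.range (Algebra.linearMap K H)).subtype ∘ₗ g, μ,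
    Intertwines.comp hY hg, fun x => ?_, ?_⟩
  · rw [← Algebra.algebraMap_eq_smul_one]
    exact (hμ x).symm
  · exact congrArg Subtype.val
      (LinearMap.congr_fun e ⟨1, by simpa using hmem 1⟩)

theorem comulCokerUnit_mkQ (x : H) : comulCokerUnit K H (unitMkQ K H x) =
    TensorProduct.map (unitMkQ K H) (unitMkQ K H) (Coalgebra.comul (R := K) x) := by
  rw [← LinearMap.rTensor_comp_lTensor]
  rfl

/-- With P = id − ε(·)1, a class x̄ in the kernel satisfies Δ(x) = P(x) ⊗ 1 + 1 ⊗ x. Applying the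
colinear projection G onto K1 to the right factor gives 1 ⊗ G(x) = P(x) ⊗ 1 + 1 ⊗ G(x), so P(x) = 0
and x is a scalar. -/
theorem comulCokerUnit_injective [FiniteDimensional K H] (h : IsLeftHereditary K H) :
    Function.Injective (comulCokerUnit K H) := by
  obtain ⟨G, μ, hG, hμ, hG1⟩ := h.exists_projection
  rw [← LinearMap.ker_eq_bot, LinearMap.ker_eq_bot']
  intro x hx
  obtain ⟨x, rfl⟩ := Submodule.mkQ_surjective _ x
  let P : H →ₗ[K] H := LinearMap.id - Algebra.linearMap K H ∘ₗ Coalgebra.counit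
  obtain ⟨P', hP'⟩ : ∃ P' : CokerUnit K H →ₗ[K] H, P' ∘ₗ unitMkQ K H = P :=
    ⟨(LinearMap.range (Algebra.linearMap K H)).liftQ P (by
      rintro _ ⟨r, rfl⟩
      simp [P]), Submodule.liftQ_mkQ _ _ _⟩
  have h1 := congrArg (TensorProduct.map P' P') ((comulCokerUnit_mkQ x).symm.trans hx)
  rw [map_zero, ← LinearMap.comp_apply, ← TensorProduct.map_comp, hP'] at h1
  have hl : P.lTensor H (Coalgebra.comul (R := K) x) = Coalgebra.comul (R := K) x - x ⊗ₜ 1 := by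
    simp [P, LinearMap.lTensor_sub, LinearMap.lTensor_comp]
  have hr : P.rTensor H (Coalgebra.comul (R := K) x) = Coalgebra.comul (R := K) x - 1 ⊗ₜ x := by
    simp [P, LinearMap.rTensor_sub, LinearMap.rTensor_comp]
  rw [← LinearMap.rTensor_comp_lTensor, LinearMap.comp_apply, hl, map_sub, hr,
    LinearMap.rTensor_tmul, sub_eq_zero, sub_eq_iff_eq_add] at h1
  have h2 := Intertwines.apply hG x
  have h3 : G.lTensor H (Coalgebra.comul (R := K) x) = P x ⊗ₜ 1 + 1 ⊗ₜ G x := by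
    rw [h1, map_add, LinearMap.lTensor_tmul, LinearMap.lTensor_tmul, hG1]
  -- Colinearity turns the left side of `h3` into Δ(G(x)), which is 1 ⊗ G(x) because G(x) is a
  -- scalar.
  have h4 : (1 : H) ⊗ₜ[K] G x = P x ⊗ₜ 1 + 1 ⊗ₜ G x := by
    refine Eq.trans ?_ (h2.trans h3)
    rw [hμ, map_smul, TensorProduct.tmul_smul]
    exact congrArg (μ x • ·) Bialgebra.comul_one.symm
  have h5 := congrArg (counitR K H H) (right_eq_add.1 h4)
  rw [counitR_tmul, Bialgebra.counit_one, one_smul, map_zero] at h5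
  rw [Submodule.mkQ_apply, Submodule.Quotient.mk_eq_zero]
  exact ⟨Coalgebra.counit (R := K) x, (sub_eq_zero.1 h5).symm⟩

theorem intertwines_unitMkQ_rTensor (V : Type v) [AddCommGroup V] [Module K V] :
    Intertwines (cofreeCoact K H V) ((LeftComodule.cokerUnit K H).tensorRight V).coact
      ((unitMkQ K H).rTensor V) := by
  refine TensorProduct.ext' fun x m => ?_
  simp only [LeftComodule.tensorRight, LinearMap.comp_apply, LinearMap.rTensor_tmul,
    intertwines_unitMkQ.apply]
  generalize Coalgebra.comul (R := K) x = s
  induction s with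
  | zero => simp
  | add x y hx hy => simp only [TensorProduct.add_tmul, map_add, hx, hy]
  | tmul a b => simp

theorem isColinear_comulCokerUnit : (LeftComodule.cokerUnit K H).IsColinear
    ((LeftComodule.cokerUnit K H).tensorRight (CokerUnit K H)) (comulCokerUnit K H) :=
  (intertwines_unitMkQ_rTensor _).comp (LeftComodule.cokerUnit K H).intertwines_coact

/-- The comultiplication of H̄ is its coaction followed by the colinear map H ⊗ H̄ → H̄ ⊗ H̄, so
precomposing χ with that map splits the coaction. -/
theorem exists_isFsRetraction_of_retraction_comul
    {χ : CokerUnit K H ⊗[K] CokerUnit K H →ₗ[K] CokerUnit K H}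
    (hχ : ((LeftComodule.cokerUnit K H).tensorRight (CokerUnit K H)).IsColinear
      (LeftComodule.cokerUnit K H) χ) (h : χ ∘ₗ comulCokerUnit K H = LinearMap.id) :
    ∃ χ : H ⊗[K] CokerUnit K H →ₗ[K] CokerUnit K H, IsFsRetraction χ :=
  ⟨χ ∘ₗ (unitMkQ K H).rTensor _, isFsRetraction_iff.2
    ⟨Intertwines.comp hχ (intertwines_unitMkQ_rTensor _), h⟩⟩

end FiniteDimensional

end FormalSmooth

/-! ### Assembly. -/

open FormalSmooth in
theorem mainTheorem9 {K : Type u} {H : Type v} [Field K] [Ring H] [HopfAlgebra K H] :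
    List.TFAE
      [IsFormallySmooth K H,
       (ModuleCoalgebra.regular K H).IsFormallySmooth,
       (LeftComodule.cokerUnit K H).IsInjective,
       ∃ χ : H ⊗[K] CokerUnit K H →ₗ[K] CokerUnit K H, IsFsRetraction χ,
       IsLeftHereditary K H,
       IsRightHereditary K H] ∧
    (FiniteDimensional K H →
      (IsFormallySmooth K H ↔
        ∃ χ : CokerUnit K H ⊗[K] CokerUnit K H →ₗ[K] CokerUnit K H,
          ((LeftComodule.cokerUnit K H).tensorRight (CokerUnit K H)).IsColinear
            (LeftComodule.cokerUnit K H) χ ∧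
          χ ∘ₗ comulCokerUnit K H = LinearMap.id)) := by
  have h := isFormallySmooth_tfae (K := K) (H := H)
  refine ⟨?_, fun _ => ⟨fun h1 => ?_, fun ⟨χ, hχ, e⟩ => ?_⟩⟩
  · tfae_have 1 ↔ 2 := h.out 0 1
    tfae_have 1 ↔ 3 := h.out 0 2
    tfae_have 1 ↔ 4 := h.out 0 3
    tfae_have 1 ↔ 5 := h.out 0 4
    tfae_have 1 ↔ 6 := isFormallySmooth_iff_isRightHereditary
    tfae_finish
  -- The comultiplication of H̄ is a colinear monomorphism here, so injectivity of H̄ extends the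
  -- identity along it.
  · have h2 : (LeftComodule.cokerUnit K H).IsInjective := (h.out 0 2).1 h1
    exact h2 _ _ _ _ _ _ isColinear_comulCokerUnit
      (comulCokerUnit_injective ((h.out 0 4).1 h1)) intertwines_id
  · exact (h.out 0 3).2 (exists_isFsRetraction_of_retraction_comul hχ e)
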